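/- All graphs are finite, simple and undirected, with edges of unit length. For a positive integer $t$, an \emph{additive $t$-spanner} of $G=(V,E)$ is a spanning subgraph $H$ of $G$ such that $\mathrm{dist}_H(u,v)\le \mathrm{dist}_G(u,v)+t$ or $\mathrm{dist}_G(u,v)=\infty$ for all $u,v\in V$. The problem \textsc{Parameterized Minimum Additive $t$-Spanner} is: given a graph $G=(V,E)$ and a positive integer $k$ (the parameter), find a set $E'\subseteq E$ with $|E'|\ge k$ such that $(V,E\setminus E')$ is an additive $t$-spanner of $G$, or report that no such set exists. \textbf{Theorem.} For every positive integer $t$ there is a fixed-parameter algorithm for \textsc{Parameterized Minimum Additive $t$-Spanner} (in fact one algorithm that takes $t$ as part of its input serves all $t$). It outputs a set $E'$ of exactly $k$ edges such that $(V,E\setminus E')$ is an additive $t$-spanner of $G$, or correctly reports that no set of at least $k$ edges can be so removed. Its running time is $(t+1)^{O(k^2+tk)}\,|V|\,|E|$, where the constant hidden in the $O$ is absolute; in particular, it is $2^{O(k^2)}\,|V|\,|E|$ for each fixed $t$. Here $|V|\,|E|$ is read as $1$ if the graph has no edges, the running time is counted on a word RAM with word length $\Theta(\log(|V|+|E|+t+k))$,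 and the graph is given by its number of vertices and a list of its edges. Moreover, there is a function $f_4$ with $f_4(t,k)=(t+1)^{O(k+t)}$ such that for all positive integers $t,k$ and every graph $G=(V,E)$: if more than $f_4(t,k)$ edges of $G$ lie on cycles of length at most $t+2$, then there is a set $E'\subseteq E$ with $|E'|=k$ such that $(V,E\setminus E')$ is an additive $t$-spanner of $G$. -/

import Mathlib

/-! ### A word RAM with a step count -/

namespace WordRAM

/-- Binary word operations. -/
inductive BinOp : Type
  | add | sub | mul | div | lt | eq

/-- Value of a word operation at word length `w`: sums and products are taken modulo `2 ^ w`,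
subtraction is truncated at `0`, division rounds down, comparisons return `1` or `0`. -/
def BinOp.eval (w : ℕ) : BinOp → ℕ → ℕ → ℕ
  | .add, a, b => (a + b) % 2 ^ w
  | .sub, a, b => a - b
  | .mul, a, b => (a * b) % 2 ^ w
  | .div, a, b => a / b
  | .lt, a, b => if a < b then 1 else 0
  | .eq, a, b => if a = b then 1 else 0

/-- Word-valued expressions: constants, registers, cells of the named arrays, word operations. -/
inductive Expr : Type
  | const (c : ℕ)
  | reg (x : ℕ)
  | get (a : ℕ) (i : Expr)
  | op (o : BinOp) (e₁ e₂ : Expr)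

/-- The memory: registers, and arrays of words that are indexed by words. A program mentions
only finitely many registers and arrays. -/
structure State : Type where
  reg : ℕ → ℕ
  arr : ℕ → ℕ → ℕ

/-- The value of an expression. -/
def Expr.eval (w : ℕ) (s : State) : Expr → ℕ
  | .const c => c % 2 ^ w
  | .reg x => s.reg x
  | .get a i => s.arr a (i.eval w s)
  | .op o e₁ e₂ => o.eval w (e₁.eval w s) (e₂.eval w s)

/-- The number of elementary steps that the evaluation of an expression takes: one for each
constant, register, array access and word operation. -/
def Expr.cost : Expr → ℕ
  | .const _ => 1
  | .reg _ => 1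
  | .get _ i => i.cost + 1
  | .op _ e₁ e₂ => e₁.cost + e₂.cost + 1

/-- Programs. -/
inductive Program : Type
  | skip
  /-- write the value of `e` into register `x` -/
  | assign (x : ℕ) (e : Expr)
  /-- write the value of `e` into cell `i` of array `a` -/
  | store (a : ℕ) (i e : Expr)
  | seq (p q : Program)
  /-- run `p` if the value of `e` is nonzero, and `q` otherwise -/
  | cond (e : Expr) (p q : Program)
  /-- repeat `p` as long as the value of `e` is nonzero -/
  | loop (e : Expr) (p : Program)

/-- Overwrite a register. -/
def State.setReg (s : State) (x v : ℕ) : State :=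
  { s with reg := Function.update s.reg x v }

/-- Overwrite an array cell. -/
def State.setArr (s : State) (a i v : ℕ) : State :=
  { s with arr := Function.update s.arr a (Function.update (s.arr a) i v) }

/-- `Exec w p s T s'`: at word length `w`, the program `p` started in memory state `s` halts after
exactly `T` elementary steps, in memory state `s'`. -/
inductive Exec (w : ℕ) : Program → State → ℕ → State → Prop
  | skip (s : State) : Exec w .skip s 1 s
  | assign (x : ℕ) (e : Expr) (s : State) :
      Exec w (.assign x e) s (e.cost + 1) (s.setReg x (e.eval w s))
  | store (a : ℕ) (i e : Expr) (s : State) :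
      Exec w (.store a i e) s (i.cost + e.cost + 1) (s.setArr a (i.eval w s) (e.eval w s))
  | seq {p q : Program} {s s' s'' : State} {T T' : ℕ} :
      Exec w p s T s' → Exec w q s' T' s'' → Exec w (.seq p q) s (T + T') s''
  | cond_pos {e : Expr} {p q : Program} {s s' : State} {T : ℕ} :
      e.eval w s ≠ 0 → Exec w p s T s' → Exec w (.cond e p q) s (e.cost + 1 + T) s'
  | cond_neg {e : Expr} {p q : Program} {s s' : State} {T : ℕ} :
      e.eval w s = 0 → Exec w q s T s' → Exec w (.cond e p q) s (e.cost + 1 + T) s'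
  | loop_stop {e : Expr} {p : Program} {s : State} :
      e.eval w s = 0 → Exec w (.loop e p) s (e.cost + 1) s
  | loop_step {e : Expr} {p : Program} {s s' s'' : State} {T T' : ℕ} :
      e.eval w s ≠ 0 → Exec w p s T s' → Exec w (.loop e p) s' T' s'' →
      Exec w (.loop e p) s (e.cost + 1 + T + T') s''

end WordRAM

/-! ### Additive spanners -/

namespace SimpleGraph

/-- `H` is an additive `t`-spanner of `G`: a spanning subgraph with
`dist_H(u, v) ≤ dist_G(u, v) + t` for all `u, v`. Distances are `⊤` between different components,
so that pairs at infinite distance in `G` impose no condition. -/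
def IsAdditiveSpanner {V : Type*} (t : ℕ) (G H : SimpleGraph V) : Prop :=
  H ≤ G ∧ ∀ u v : V, H.edist u v ≤ G.edist u v + t

/-- The edges of `G` that lie on a cycle of length at most `l`. -/
def shortCycleEdges {V : Type*} (G : SimpleGraph V) (l : ℕ) : Set (Sym2 V) :=
  {e | ∃ (v : V) (p : G.Walk v v), p.IsCycle ∧ p.length ≤ l ∧ e ∈ p.edges}

end SimpleGraph

/-! ### The computational problem -/

namespace SpannerProblem

open WordRAM

/-- `E'` is a set of edges of `G` whose removal leaves an additive `t`-spanner of `G`. -/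
def IsRemovable {V : Type*} (t : ℕ) (G : SimpleGraph V) (E' : Set (Sym2 V)) : Prop :=
  E' ⊆ G.edgeSet ∧ SimpleGraph.IsAdditiveSpanner t G (G.deleteEdges E')

/-- The list `L` lists every edge of `G` exactly once, each in one of its two orientations. -/
def IsEdgeList {n : ℕ} (G : SimpleGraph (Fin n)) (L : List (Fin n × Fin n)) : Prop :=
  (L.map fun p => s(p.1, p.2)).Nodup ∧
    ∀ e : Sym2 (Fin n), e ∈ (L.map fun p => s(p.1, p.2)) ↔ e ∈ G.edgeSet

/-- The input memory. Registers 0, 1, 2, 3 hold the number of vertices, the number of edges,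
`t` and `k`; cells `2 * i` and `2 * i + 1` of array 0 hold the endpoints of the `i`-th edge;
everything else is zero. -/
def initState {n : ℕ} (t k : ℕ) (L : List (Fin n × Fin n)) : State where
  reg x := match x with
    | 0 => n
    | 1 => L.length
    | 2 => t
    | 3 => k
    | _ => 0
  arr a i := match a with
    | 0 => match L[i / 2]? with
      | some p => if i % 2 = 0 then (p.1 : ℕ) else (p.2 : ℕ)
      | none => 0
    | _ => 0

/-- The edge set that a final memory state describes: the `i`-th edge of the input is selected
if and only if cell `i` of array 1 is nonzero. -/
def outputEdges {n : ℕ} (L : List (Fin n × Fin n)) (s : State) : Set (Sym2 (Fin n)) :=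
  {e | ∃ (i : ℕ) (h : i < L.length), s.arr 1 i ≠ 0 ∧ e = s(L[i].1, L[i].2)}

/-- The final memory state answers the instance `(G, t, k)` correctly: either register 0 holds `1`
and the output describes `k` edges whose removal leaves an additive `t`-spanner, or register 0
holds `0` and no set of at least `k` edges can be removed. -/
def CorrectAnswer {n : ℕ} (t k : ℕ) (G : SimpleGraph (Fin n)) (L : List (Fin n × Fin n))
    (s : State) : Prop :=
  (s.reg 0 = 1 ∧ IsRemovable t G (outputEdges L s) ∧ (outputEdges L s).ncard = k) ∨
  (s.reg 0 = 0 ∧ ¬ ∃ E' : Set (Sym2 (Fin n)), IsRemovable t G E' ∧ k ≤ E'.ncard)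

/-- For the given `t`, the program `P` solves the problem on every finite graph `G = (V, E)`, given
by any edge list, and for every parameter `k ≥ 1`, within `f k * |V| * |E|` steps (within `f k`
steps if `|V| * |E| = 0`), on every word RAM whose word length is at least `d` times the binary
logarithm of `|V| + |E| + t + k + 2`. -/
def SolvesInTime (P : Program) (d t : ℕ) (f : ℕ → ℕ) : Prop :=
  ∀ k : ℕ, 0 < k → ∀ (n : ℕ) (G : SimpleGraph (Fin n)) (L : List (Fin n × Fin n)),
    IsEdgeList G L → ∀ w : ℕ, (n + L.length + t + k + 2) ^ d ≤ 2 ^ w →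
      ∃ (T : ℕ) (s : State), Exec w P (initState t k L) T s ∧
        T ≤ f k * max 1 (n * G.edgeSet.ncard) ∧ CorrectAnswer t k G L s

end SpannerProblem

/-!
The structural part rests on two ways to remove `k` edges. An edge outside a tree of shortest paths
to `w` can be removed without changing any distance to `w`; hence edges outside the tree that lie on
circuits of length at most `t + 2` through `w` can all be removed together, since a detour through
`w` costs at most `t` more (`IsParent.isRemovable`). On the other hand, take one edge `e` from each
of `k` vertex-disjoint short circuits, and choose a hub on every circuit. A shortest path between two
vertices is rerouted around the circuit of the last removed edge that it uses, in the order in which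
the circuits were chosen; the two sides of the detour end in the hub of this circuit, and it costs at
most `t` provided that the distances from the earlier edges to the hub have not changed
(`isRemovable_of_pairwise`). For each vertex, every circuit has an edge whose removal keeps all
distances to this vertex (`Walk.IsCircuit.exists_edist_deleteEdges_eq`). So the edges can be chosen
greedily from sufficiently many disjoint circuits: by the pigeonhole principle, one edge of the
current circuit serves the hubs of a fraction of the later circuits, and only these are kept, except
for those that are met by fixed shortest paths from the edges already chosen to the current hub. If
some shortest path meets too many circuits, then circuits along this path are used, at a sufficient
distance from each other, and otherwise few circuits are given up in each step
(`exists_isRemovable_of_disjoint_circuits`).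

Consequently, a set `F` of edges that is a union of short circuits contains `k` removable edges if
it is large: a maximal family of disjoint short circuits inside `F` is either large, or some vertex
`w` of it lies on short circuits that cover many edges of `F`, and then many edges lie outside the
tree of `w` (`CoveredByShortCircuits.exists_isRemovable`). The set of all edges on short cycles is
such an `F`, which gives the second part of the theorem.

The algorithm builds such a set `F` step by step. For each vertex `v` it computes a search tree up to
the distance `t`. An edge between different branches of the tree, whose ends have total distance at
most `t + 1` from `v`, closes a short circuit through `v` together with two tree paths, and these
circuits are added to `F`. Such edges are removable together, so that it suffices to add `k` circuits
for each `v`. If there are fewer, then each edge `vy` on a short circuit has been added, because the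
circuit has to leave the branch of `y` through an edge of this kind (`SearchTree.exists_bridge`).
Whenever `F` has grown, all `k`-tuples of edges in `F` are tested by breadth-first searches from the
ends of their edges (`search_spec`). As long as no test succeeds, `F` is small, so that the number of
tests is bounded in terms of `t` and `k`. If no test succeeds at all, then there is no solution: each
edge of a removable set lies on a short circuit, hence in `F`.
-/


/-! ### Distances after the deletion of edges -/

namespace SimpleGraph

variable {V : Type*} {G : SimpleGraph V} {E' : Set (Sym2 V)} {u v w : V}

theorem edist_le_add_of_le {a b : ℕ} (h₁ : G.edist u v ≤ a) (h₂ : G.edist v w ≤ b) :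
    G.edist u w ≤ (a + b : ℕ) := by
  push_cast
  exact SimpleGraph.edist_triangle.trans (add_le_add h₁ h₂)

theorem edist_deleteEdges_le (p : G.Walk u v) (h : ∀ e ∈ p.edges, e ∉ E') :
    (G.deleteEdges E').edist u v ≤ p.length := by
  have h' : ∀ e ∈ p.edges, e ∈ (G.deleteEdges E').edgeSet := fun e he => by
    rw [edgeSet_deleteEdges]
    exact ⟨p.edges_subset_edgeSet he, h e he⟩
  simpa using (p.transfer _ h').edist_le

theorem exists_walk_of_edist_deleteEdges_le {n : ℕ} (h : (G.deleteEdges E').edist u v ≤ n) :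
    ∃ p : G.Walk u v, p.length ≤ n ∧ ∀ e ∈ p.edges, e ∉ E' := by
  obtain ⟨q, hq⟩ := exists_walk_of_edist_ne_top (ne_top_of_le_ne_top (ENat.natCast_ne_top n) h)
  have hmem : ∀ e ∈ q.edges, e ∈ G.edgeSet ∧ e ∉ E' := fun e he => by
    have := q.edges_subset_edgeSet he
    rwa [edgeSet_deleteEdges] at this
  refine ⟨q.transfer G fun e he => (hmem e he).1, ?_, ?_⟩
  · rw [Walk.length_transfer]
    rw [← hq] at h
    exact_mod_cast h
  · intro e he
    rw [Walk.edges_transfer] at he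
    exact (hmem e he).2

theorem edist_le_deleteEdges : G.edist u v ≤ (G.deleteEdges E').edist u v :=
  edist_anti (deleteEdges_le E')

theorem exists_edist_eq_of_le {n : ℕ} (h : G.edist u v ≤ n) :
    ∃ m : ℕ, G.edist u v = m ∧ m ≤ n :=
  ENat.le_natCast_iff.mp h

namespace Walk

/-- A walk that uses an edge of `E'` splits at the first such edge. -/
theorem exists_first_edge (p : G.Walk u v) (E' : Set (Sym2 V)) :
    (∀ e ∈ p.edges, e ∉ E') ∨
      ∃ (a b : V) (h : G.Adj a b) (p₁ : G.Walk u a) (p₂ : G.Walk b v),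
        p = p₁.append (cons h p₂) ∧ s(a, b) ∈ E' ∧ ∀ e ∈ p₁.edges, e ∉ E' := by
  induction p with
  | nil => left; simp
  | @cons x y z h q ih =>
    by_cases hxy : s(x, y) ∈ E'
    · exact .inr ⟨x, y, h, .nil, q, rfl, hxy, by simp⟩
    · rcases ih with ih | ⟨a, b, hab, p₁, p₂, rfl, hmem, hp₁⟩
      · left
        simp only [edges_cons, List.mem_cons]
        rintro e (rfl | he)
        exacts [hxy, ih e he]
      · refine .inr ⟨a, b, hab, cons h p₁, p₂, rfl, hmem, ?_⟩
        simp only [edges_cons, List.mem_cons]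
        rintro e (rfl | he)
        exacts [hxy, hp₁ e he]

theorem exists_eq_append_of_mem_edges {e : Sym2 V} (p : G.Walk u v) (he : e ∈ p.edges) :
    ∃ (a b : V) (h : G.Adj a b) (p₁ : G.Walk u a) (p₂ : G.Walk b v),
      p = p₁.append (cons h p₂) ∧ s(a, b) = e := by
  rcases p.exists_first_edge {e} with h | ⟨a, b, h, p₁, p₂, hp, hmem, -⟩
  · exact absurd rfl (h e he)
  · exact ⟨a, b, h, p₁, p₂, hp, hmem⟩

/-- The rest of a closed trail through the edge `cd` joins `c` to `d` by way of any vertex `h` of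
the trail. -/
theorem IsTrail.exists_detour {p : G.Walk v v} (hp : p.IsTrail) {c d h : V}
    (he : s(c, d) ∈ p.edges) (hh : h ∈ p.support) :
    ∃ (q₁ : G.Walk c h) (q₂ : G.Walk h d), q₁.length + q₂.length + 1 = p.length ∧
      (∀ e ∈ q₁.edges, e ∈ p.edges ∧ e ≠ s(c, d)) ∧
      ∀ e ∈ q₂.edges, e ∈ p.edges ∧ e ≠ s(c, d) := by
  classical
  obtain ⟨a, b, hab, p₁, p₂, rfl, hs⟩ := p.exists_eq_append_of_mem_edges he
  have hedges : ∀ e ∈ (p₂.append p₁).edges,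
      e ∈ (p₁.append (cons hab p₂)).edges ∧ e ≠ s(c, d) := by
    intro e hmem
    have hnd := hp.edges_nodup
    simp only [edges_append, edges_cons, List.mem_append, List.mem_cons] at hmem hnd ⊢
    rw [List.nodup_append] at hnd
    obtain ⟨-, h2, h3⟩ := hnd
    refine ⟨by tauto, ?_⟩
    rw [← hs]
    rintro rfl
    rcases hmem with hmem | hmem
    · exact (List.nodup_cons.mp h2).1 hmem
    · exact h3 _ hmem _ (by simp) rfl
  have hh' : h ∈ (p₂.append p₁).support := by
    simp only [mem_support_append_iff, support_cons, List.mem_cons] at hh ⊢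
    rcases hh with hh | rfl | hh
    · exact .inr hh
    · exact .inr p₁.end_mem_support
    · exact .inl hh
  set q := p₂.append p₁ with hq
  have hlen : (q.takeUntil h hh').length + (q.dropUntil h hh').length + 1 =
      (p₁.append (cons hab p₂)).length := by
    rw [← length_append, take_spec, hq]
    simp only [length_append, length_cons]
    omega
  rcases Sym2.eq_iff.mp hs with ⟨rfl, rfl⟩ | ⟨rfl, rfl⟩
  · refine ⟨(q.dropUntil h hh').reverse, (q.takeUntil h hh').reverse, ?_, ?_, ?_⟩
    · rw [length_reverse, length_reverse, ← hlen]
      omega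
    · intro e he
      rw [edges_reverse, List.mem_reverse] at he
      exact hedges e (q.edges_dropUntil_subset_edges hh' he)
    · intro e he
      rw [edges_reverse, List.mem_reverse] at he
      exact hedges e (q.edges_takeUntil_subset_edges hh' he)
  · exact ⟨q.takeUntil h hh', q.dropUntil h hh', hlen,
      fun e he => hedges e (q.edges_takeUntil_subset_edges hh' he),
      fun e he => hedges e (q.edges_dropUntil_subset_edges hh' he)⟩

end Walk

/-- Either the deletion of `E'` keeps the distance from `u` to `v`, or some shortest path enters
`E'` first at an edge `ab`. -/
theorem edist_deleteEdges_eq_or_exists_first {n : ℕ} (h : G.edist u v = n) :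
    (G.deleteEdges E').edist u v = n ∨
      ∃ (a b : V) (i j : ℕ), s(a, b) ∈ E' ∧ G.Adj a b ∧ i + 1 + j = n ∧ G.edist u a = i ∧
        G.edist b v = j ∧ (G.deleteEdges E').edist u a = i := by
  obtain ⟨p, hp⟩ := exists_walk_of_edist_eq_coe h
  rcases p.exists_first_edge E' with hE | ⟨a, b, hab, p₁, p₂, rfl, hmem, hp₁⟩
  · left
    refine le_antisymm (hp ▸ edist_deleteEdges_le p hE) (h ▸ edist_le_deleteEdges)
  · right
    simp only [Walk.length_append, Walk.length_cons] at hp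
    obtain ⟨i, hi, hi'⟩ := exists_edist_eq_of_le p₁.edist_le
    obtain ⟨j, hj, hj'⟩ := exists_edist_eq_of_le p₂.edist_le
    have h1 : G.edist a b ≤ (1 : ℕ) := by simpa using (edist_eq_one_iff_adj.mpr hab).le
    have h2 := edist_le_add_of_le (edist_le_add_of_le hi.le h1) hj.le
    rw [h] at h2
    have h3 : n ≤ i + 1 + j := by exact_mod_cast h2
    refine ⟨a, b, i, j, hmem, hab, by omega, hi, hj, ?_⟩
    obtain rfl : i = p₁.length := by omega
    exact le_antisymm (edist_deleteEdges_le p₁ hp₁) (hi ▸ edist_le_deleteEdges)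

theorem edist_deleteEdges_eq_or_exists_last {n : ℕ} (h : G.edist u v = n) :
    (G.deleteEdges E').edist u v = n ∨
      ∃ (a b : V) (i j : ℕ), s(a, b) ∈ E' ∧ G.Adj a b ∧ i + 1 + j = n ∧ G.edist u a = i ∧
        G.edist b v = j ∧ (G.deleteEdges E').edist b v = j := by
  rw [edist_comm] at h
  rcases edist_deleteEdges_eq_or_exists_first (E' := E') h with h | ⟨a, b, i, j, h1, h2, h3, h4, h5, h6⟩
  · left
    rwa [edist_comm]
  · refine .inr ⟨b, a, j, i, by rwa [Sym2.eq_swap], h2.symm, by omega, ?_, ?_, ?_⟩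
    all_goals rwa [edist_comm]

/-! ### Shortest path trees -/

/-- `par` is the parent function of a tree of shortest paths to `c`. -/
def IsParent (G : SimpleGraph V) (c : V) (par : V → V) : Prop :=
  ∀ x, x ≠ c → G.edist x c ≠ ⊤ → G.Adj x (par x) ∧ G.edist x c = G.edist (par x) c + 1

theorem exists_isParent (G : SimpleGraph V) (c : V) : ∃ par, G.IsParent c par := by
  have : ∀ x, ∃ y, x ≠ c → G.edist x c ≠ ⊤ → G.Adj x y ∧ G.edist x c = G.edist y c + 1 := by
    intro x
    by_cases hx : x ≠ c ∧ G.edist x c ≠ ⊤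
    · obtain ⟨p, hp⟩ := exists_walk_of_edist_ne_top hx.2
      cases p with
      | nil => exact absurd rfl hx.1
      | @cons _ y _ h q =>
        refine ⟨y, fun _ _ => ⟨h, ?_⟩⟩
        rw [Walk.length_cons] at hp
        obtain ⟨j, hj, hj'⟩ := exists_edist_eq_of_le q.edist_le
        have h1 : G.edist x y ≤ (1 : ℕ) := by simpa using (edist_eq_one_iff_adj.mpr h).le
        have h2 := edist_le_add_of_le h1 hj.le
        rw [← hp] at h2
        have h3 : q.length + 1 ≤ 1 + j := by exact_mod_cast h2
        obtain rfl : j = q.length := by omega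
        rw [← hp, hj]
        push_cast
        rfl
    · exact ⟨x, fun h1 h2 => absurd ⟨h1, h2⟩ hx⟩
  choose par hpar using this
  exact ⟨par, hpar⟩

/-- The deletion of edges outside a tree of shortest paths to `c` keeps all distances to `c`. -/
theorem IsParent.edist_deleteEdges_eq {c : V} {par : V → V} (hpar : G.IsParent c par)
    (hE : ∀ x, x ≠ c → G.edist x c ≠ ⊤ → s(x, par x) ∉ E') (x : V) :
    (G.deleteEdges E').edist x c = G.edist x c := by
  refine le_antisymm ?_ edist_le_deleteEdges
  by_cases htop : G.edist x c = ⊤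
  · simp [htop]
  obtain ⟨n, hn⟩ := ENat.ne_top_iff_exists.mp htop
  rw [← hn]
  clear htop
  induction n generalizing x with
  | zero =>
    have : x = c := edist_eq_zero_iff.mp (by rw [← hn]; rfl)
    simp [this]
  | succ n ih =>
    have hx : x ≠ c := by
      rintro rfl
      rw [edist_self] at hn
      norm_cast at hn
    have hx' : G.edist x c ≠ ⊤ := by rw [← hn]; exact ENat.natCast_ne_top _
    obtain ⟨h1, h2⟩ := hpar x hx hx'
    have h3 : (n : ℕ∞) = G.edist (par x) c := by
      have : ((n : ℕ∞) + 1) = G.edist (par x) c + 1 := by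
        rw [← h2, ← hn]
        push_cast
        rfl
      exact ENat.add_left_injective_of_ne_top ENat.one_ne_top this
    have h4 : (G.deleteEdges E').edist x (par x) ≤ (1 : ℕ) := by
      have : (G.deleteEdges E').Adj x (par x) := (deleteEdges_adj).mpr ⟨h1, hE x hx hx'⟩
      simpa using (edist_eq_one_iff_adj.mpr this).le
    have := edist_le_add_of_le h4 (ih (par x) h3)
    rwa [add_comm] at this

/-- For every vertex `c`, a circuit has an edge whose deletion keeps all distances to `c`. -/
theorem Walk.IsCircuit.exists_edist_deleteEdges_eq {p : G.Walk v v} (hp : p.IsCircuit) (c : V) :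
    ∃ e ∈ p.edges, ∀ x, (G.deleteEdges {e}).edist x c = G.edist x c := by
  classical
  obtain ⟨par, hpar⟩ := exists_isParent G c
  by_contra! hcon
  have htree : ∀ e ∈ p.edges, ∃ x, x ≠ c ∧ G.edist x c ≠ ⊤ ∧ s(x, par x) = e := by
    intro e he
    by_contra! h
    obtain ⟨x, hx⟩ := hcon e he
    exact hx (hpar.edist_deleteEdges_eq (fun y h1 h2 => h y h1 h2) x)
  obtain ⟨z, hz, hmin⟩ := p.support.toFinset.exists_min_image (fun x => G.edist x c)
    ⟨v, by simp⟩
  -- The tree edge at `x ↦ par x` determines `x`, and the nearest vertex `z` gives no tree edge.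
  have hsub : p.edges.toFinset ⊆ (p.support.toFinset.erase z).image fun x => s(x, par x) := by
    intro e he
    rw [List.mem_toFinset] at he
    obtain ⟨x, hx, hx', rfl⟩ := htree e he
    refine Finset.mem_image.mpr ⟨x, Finset.mem_erase.mpr ⟨?_, ?_⟩, rfl⟩
    · rintro rfl
      have h1 := hmin (par x) (List.mem_toFinset.mpr (p.snd_mem_support_of_mem_edges he))
      rw [(hpar x hx hx').2] at h1
      have h2 : G.edist (par x) c ≠ ⊤ := by
        intro h
        rw [(hpar x hx hx').2, h] at hx'
        exact hx' rfl
      obtain ⟨m, hm⟩ := ENat.ne_top_iff_exists.mp h2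
      rw [← hm] at h1
      norm_cast at h1
      omega
    · exact List.mem_toFinset.mpr (p.fst_mem_support_of_mem_edges he)
  have h1 : p.length ≤ p.support.toFinset.card - 1 := by
    rw [← p.length_edges, ← List.toFinset_card_of_nodup hp.isTrail.edges_nodup,
      ← Finset.card_erase_of_mem hz]
    exact (Finset.card_le_card hsub).trans Finset.card_image_le
  have h2 : p.support.toFinset.card ≤ p.length := by
    have hss : p.support.toFinset ⊆ p.support.tail.toFinset := by
      intro x hx
      rw [List.mem_toFinset] at hx ⊢
      rcases p.mem_support_iff.mp hx with rfl | h
      · exact p.end_mem_tail_support hp.not_nil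
      · exact h
    refine (Finset.card_le_card hss).trans ((List.toFinset_card_le _).trans ?_)
    simp
  have := hp.three_le_length
  omega

end SimpleGraph

/-! ### Removable sets of edges -/

namespace SimpleGraph

variable {V : Type*} {G : SimpleGraph V} {E' : Set (Sym2 V)} {u v w : V}

open SpannerProblem

theorem le_of_edist_eq_of_le {a b : ℕ} (h₁ : G.edist u v = a) (h₂ : G.edist u v ≤ b) : a ≤ b := by
  rw [h₁] at h₂
  exact_mod_cast h₂

theorem Adj.edist_le_one (h : G.Adj u v) : G.edist u v ≤ (1 : ℕ) := by
  simpa using (edist_eq_one_iff_adj.mpr h).le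

theorem isRemovable_iff {t : ℕ} : IsRemovable t G E' ↔ E' ⊆ G.edgeSet ∧
    ∀ (u v : V) (n : ℕ), G.edist u v = n → (G.deleteEdges E').edist u v ≤ (n + t : ℕ) := by
  constructor
  · rintro ⟨h, -, h'⟩
    refine ⟨h, fun u v n hn => ?_⟩
    have := h' u v
    rw [hn] at this
    exact_mod_cast this
  · rintro ⟨h, h'⟩
    refine ⟨h, deleteEdges_le E', fun u v => ?_⟩
    by_cases htop : G.edist u v = ⊤
    · simp [htop]
    · obtain ⟨n, hn⟩ := ENat.ne_top_iff_exists.mp htop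
      rw [← hn]
      exact_mod_cast h' u v n hn.symm

theorem _root_.SpannerProblem.IsRemovable.mono {t : ℕ} {E₁ E₂ : Set (Sym2 V)}
    (h : IsRemovable t G E₂) (h₁₂ : E₁ ⊆ E₂) : IsRemovable t G E₁ :=
  ⟨h₁₂.trans h.1, deleteEdges_le E₁, fun u v =>
    (edist_anti (deleteEdges_anti h₁₂)).trans (h.2.2 u v)⟩

/-- For a removable set of edges it is enough to compare the distances between endpoints of removed
edges: a shortest path is kept up to its first and from its last removed edge. -/
theorem isRemovable_of_endpoints {t : ℕ} (hE : E' ⊆ G.edgeSet)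
    (h : ∀ a b : V, (∃ e ∈ E', a ∈ e) → (∃ e ∈ E', b ∈ e) →
      (G.deleteEdges E').edist a b ≤ G.edist a b + t) : IsRemovable t G E' := by
  refine isRemovable_iff.mpr ⟨hE, fun u v n hn => ?_⟩
  rcases edist_deleteEdges_eq_or_exists_first (E' := E') hn with
    h1 | ⟨a, b, i, j, he, hab, hij, hi, hj, hi'⟩
  · rw [h1]
    exact_mod_cast Nat.le_add_right n t
  · have hav := edist_le_add_of_le hab.edist_le_one hj.le
    obtain ⟨m, hm, hm'⟩ := exists_edist_eq_of_le hav
    rcases edist_deleteEdges_eq_or_exists_last (E' := E') hm with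
      h1 | ⟨a', b', i', j', he', hab', hij', hi1, hj1, hj'⟩
    · refine (edist_le_add_of_le hi'.le h1.le).trans ?_
      norm_cast
      omega
    · have h2 := h a b' ⟨_, he, by simp⟩ ⟨_, he', by simp⟩
      have h3 : (G.deleteEdges E').edist a b' ≤ (i' + 1 + t : ℕ) := by
        refine h2.trans ?_
        have := edist_le_add_of_le hi1.le hab'.edist_le_one
        push_cast at this ⊢
        gcongr
      refine (edist_le_add_of_le (edist_le_add_of_le hi'.le h3) hj'.le).trans ?_
      norm_cast
      omega

/-- Every removed edge is replaced by a walk of length at most `t + 1`. -/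
theorem _root_.SpannerProblem.IsRemovable.exists_walk {t : ℕ} (h : IsRemovable t G E') {x y : V}
    (he : s(x, y) ∈ E') : ∃ q : G.Walk x y, q.length ≤ t + 1 ∧ s(x, y) ∉ q.edges := by
  have hadj : G.Adj x y := h.1 he
  have h1 := (isRemovable_iff.mp h).2 x y 1 (by simpa using edist_eq_one_iff_adj.mpr hadj)
  obtain ⟨q, hq, hq'⟩ := exists_walk_of_edist_deleteEdges_le h1
  exact ⟨q, by omega, fun hmem => hq' _ hmem he⟩

/-- Edges near a root `w` that lie outside a tree of shortest paths to `w` can be removed together: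
all distances to `w` are kept, and a shortest path that uses one of the edges is replaced by a path
through `w`. -/
theorem IsParent.isRemovable {t : ℕ} {par : V → V} (hpar : G.IsParent w par)
    (hE : E' ⊆ G.edgeSet) (htree : ∀ x, x ≠ w → G.edist x w ≠ ⊤ → s(x, par x) ∉ E')
    (hshort : ∀ x y, s(x, y) ∈ E' → G.edist x w + G.edist y w ≤ (t + 1 : ℕ)) :
    IsRemovable t G E' := by
  refine isRemovable_iff.mpr ⟨hE, fun u v n hn => ?_⟩
  rcases edist_deleteEdges_eq_or_exists_first (E' := E') hn with
    h1 | ⟨a, b, i, j, he, hab, hij, hi, hj, -⟩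
  · rw [h1]
    exact_mod_cast Nat.le_add_right n t
  · have hs := hshort a b he
    obtain ⟨α, hα, -⟩ := exists_edist_eq_of_le (le_self_add.trans hs)
    obtain ⟨β, hβ, -⟩ := exists_edist_eq_of_le (le_add_self.trans hs)
    rw [hα, hβ] at hs
    have hs' : α + β ≤ t + 1 := by exact_mod_cast hs
    have h1 := edist_le_add_of_le hi.le hα.le
    have h2 := edist_le_add_of_le (by rw [edist_comm, hj] : G.edist v b ≤ j) hβ.le
    rw [← hpar.edist_deleteEdges_eq htree] at h1 h2
    rw [edist_comm] at h2
    refine (edist_le_add_of_le h1 h2).trans ?_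
    norm_cast
    omega

section Circuits

variable {ι : Type*} {b : ι → V} {p : ∀ i, G.Walk (b i) (b i)} {c : ι → V} {t : ℕ}
  {l : List (ι × Sym2 V)}

theorem notMem_of_mem_edges_of_pairwise
    (hC : ∀ x ∈ l, (p x.1).IsTrail ∧ (p x.1).length ≤ t + 2 ∧ x.2 ∈ (p x.1).edges ∧
      c x.1 ∈ (p x.1).support)
    (hdisj : l.Pairwise fun x y => (p x.1).support.Disjoint (p y.1).support)
    {j : ℕ} (hj : j < l.length) {e : Sym2 V} (he : e ∈ (p l[j].1).edges) (hne : e ≠ l[j].2) :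
    e ∉ {e | ∃ z ∈ l, z.2 = e} := by
  rintro ⟨z, hz, rfl⟩
  obtain ⟨i, hi, rfl⟩ := List.getElem_of_mem hz
  have hij : i ≠ j := by rintro rfl; exact hne rfl
  have hz2 := (hC _ hz).2.2.1
  have hd : (p l[i].1).support.Disjoint (p l[j].1).support := by
    rcases lt_or_gt_of_ne hij with h | h
    · exact List.pairwise_iff_getElem.mp hdisj i j hi hj h
    · exact (List.pairwise_iff_getElem.mp hdisj j i hj hi h).symm
  revert he hz2
  generalize l[i].2 = e
  induction e with | _ x y =>
  intro he hz2
  exact hd ((p _).fst_mem_support_of_mem_edges hz2) ((p _).fst_mem_support_of_mem_edges he)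

/-- If a shortest path from `u` passes through `c₀` and then the removed edge `c₀d₀` of the `j`-th
circuit, and `j` is the largest index of an edge removed from such paths, then the hub of the
circuit can be reached from `u` at no more than the cost of the way `q` around the circuit. -/
theorem edist_hub_le
    (hC : ∀ x ∈ l, (p x.1).IsTrail ∧ (p x.1).length ≤ t + 2 ∧ x.2 ∈ (p x.1).edges ∧
      c x.1 ∈ (p x.1).support)
    (hdisj : l.Pairwise fun x y => (p x.1).support.Disjoint (p y.1).support)
    (hhub : l.Pairwise fun x y => ∀ a ∈ x.2,
      (G.deleteEdges ({e | ∃ z ∈ l, z.2 = e} \ {y.2})).edist a (c y.1) = G.edist a (c y.1))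
    {j : ℕ} (hj : j < l.length) {c₀ d₀ : V} (hcd : s(c₀, d₀) = l[j].2)
    {u : V} {i₁ : ℕ} (huc : G.edist u c₀ = i₁) (hud : G.edist u d₀ = (i₁ + 1 : ℕ))
    (hmax : ∀ (j' : ℕ) (hj' : j' < l.length) (x y : V) (i i' : ℕ), s(x, y) = l[j'].2 →
      G.edist u x = i → G.edist y c₀ = i' → i + 1 + i' = i₁ → j' ≤ j)
    (q : G.Walk c₀ (c l[j].1)) (hq : ∀ e ∈ q.edges, e ∈ (p l[j].1).edges ∧ e ≠ s(c₀, d₀)) :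
    (G.deleteEdges {e | ∃ z ∈ l, z.2 = e}).edist u (c l[j].1) ≤ (i₁ + q.length : ℕ) := by
  set E' := {e | ∃ z ∈ l, z.2 = e} with hE'
  have hq' : (G.deleteEdges E').edist c₀ (c l[j].1) ≤ q.length :=
    edist_deleteEdges_le q fun e he =>
      notMem_of_mem_edges_of_pairwise hC hdisj hj (hq e he).1 (hcd ▸ (hq e he).2)
  rcases edist_deleteEdges_eq_or_exists_first (E' := E') huc with
    h1 | ⟨x, y, i, i', ⟨z, hz, hze⟩, hxy, hsum, hi, hi', hi''⟩
  · exact edist_le_add_of_le h1.le hq'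
  obtain ⟨j', hj', rfl⟩ := List.getElem_of_mem hz
  have hle : j' ≤ j := hmax j' hj' x y i i' hze.symm hi hi' hsum
  have hlt : j' < j := by
    refine lt_of_le_of_ne hle ?_
    rintro rfl
    rw [← hcd] at hze
    rcases Sym2.eq_iff.mp hze with ⟨rfl, rfl⟩ | ⟨rfl, rfl⟩
    · have := le_of_edist_eq_of_le huc hi.le
      omega
    · have := le_of_edist_eq_of_le hud hi.le
      omega
  have hhubx := List.pairwise_iff_getElem.mp hhub j' j hj' hj hlt x (by rw [hze]; simp)
  have hxc := edist_le_add_of_le hxy.edist_le_one hi'.le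
  obtain ⟨m, hm, hm'⟩ := exists_edist_eq_of_le (edist_le_add_of_le hxc q.edist_le)
  obtain ⟨Q, hQ, hQ'⟩ := exists_walk_of_edist_deleteEdges_le (hhubx.trans hm).le
  rcases Q.exists_first_edge {l[j].2} with hno | ⟨a', b', hab, p₁, p₂, rfl, hmem, hp₁⟩
  · have : (G.deleteEdges E').edist x (c l[j].1) ≤ Q.length :=
      edist_deleteEdges_le Q fun e he hE => hQ' e he ⟨hE, hno e he⟩
    refine (edist_le_add_of_le hi''.le this).trans ?_
    norm_cast
    omega
  · have hp₁' : (G.deleteEdges E').edist x a' ≤ p₁.length :=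
      edist_deleteEdges_le p₁ fun e he hE => hQ' e (by simp [he]) ⟨hE, hp₁ e he⟩
    simp only [Walk.length_append, Walk.length_cons] at hQ
    rw [Set.mem_singleton_iff, ← hcd] at hmem
    rcases Sym2.eq_iff.mp hmem with ⟨rfl, rfl⟩ | ⟨rfl, rfl⟩
    · have h2 := le_of_edist_eq_of_le hm
        (edist_le_add_of_le hxc (edist_le_add_of_le hab.edist_le_one p₂.edist_le))
      refine (edist_le_add_of_le hi''.le (edist_le_add_of_le hp₁' hq')).trans ?_
      norm_cast
      omega
    · exfalso
      have h2 := le_of_edist_eq_of_le hm (edist_le_add_of_le hxc p₂.edist_le)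
      have h3 := le_of_edist_eq_of_le hud (edist_le_add_of_le hi.le p₁.edist_le)
      omega

/-- One edge from each of several vertex-disjoint short circuits is removable if, for each of the
circuits, the removal of all other edges keeps the distance from the earlier removed edges to a hub
on the circuit. -/
theorem isRemovable_of_pairwise
    (hC : ∀ x ∈ l, (p x.1).IsTrail ∧ (p x.1).length ≤ t + 2 ∧ x.2 ∈ (p x.1).edges ∧
      c x.1 ∈ (p x.1).support)
    (hdisj : l.Pairwise fun x y => (p x.1).support.Disjoint (p y.1).support)
    (hhub : l.Pairwise fun x y => ∀ a ∈ x.2,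
      (G.deleteEdges ({e | ∃ z ∈ l, z.2 = e} \ {y.2})).edist a (c y.1) = G.edist a (c y.1)) :
    IsRemovable t G {e | ∃ z ∈ l, z.2 = e} := by
  classical
  refine isRemovable_iff.mpr ⟨?_, fun u v n hn => ?_⟩
  · rintro _ ⟨z, hz, rfl⟩
    exact Walk.edges_subset_edgeSet _ (hC z hz).2.2.1
  set E' := {e | ∃ z ∈ l, z.2 = e} with hE'
  let P : ℕ → Prop := fun j => ∃ (hj : j < l.length) (x y : V) (i i' : ℕ), s(x, y) = l[j].2 ∧
    G.edist u x = i ∧ G.edist y v = i' ∧ i + 1 + i' = n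
  rcases edist_deleteEdges_eq_or_exists_first (E' := E') hn with
    h1 | ⟨a, b', i, i', ⟨z, hz, hze⟩, hab, hij, hi, hi', -⟩
  · rw [h1]
    exact_mod_cast Nat.le_add_right n t
  obtain ⟨j₀, hj₀, rfl⟩ := List.getElem_of_mem hz
  have hP : P j₀ := ⟨hj₀, a, b', i, i', hze.symm, hi, hi', hij⟩
  obtain ⟨j, hj, hjmax⟩ := ((Finset.range l.length).filter P).exists_max_image id
    ⟨j₀, Finset.mem_filter.mpr ⟨Finset.mem_range.mpr hj₀, hP⟩⟩
  clear! a b' i i' j₀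
  obtain ⟨hjr, hj, c₀, d₀, i₁, i₂, hcd, hi₁, hi₂, hsum⟩ := Finset.mem_filter.mp hj
  have hmax : ∀ j' : ℕ, P j' → j' ≤ j := fun j' h =>
    hjmax j' (Finset.mem_filter.mpr ⟨Finset.mem_range.mpr h.1, h⟩)
  obtain ⟨htr, hlen, hmem, hsup⟩ := hC _ (List.getElem_mem hj)
  have hadj : G.Adj c₀ d₀ := by
    rw [← hcd] at hmem
    exact Walk.adj_of_mem_edges _ hmem
  have hud : G.edist u d₀ = (i₁ + 1 : ℕ) := by
    obtain ⟨m, hm, hm'⟩ := exists_edist_eq_of_le (edist_le_add_of_le hi₁.le hadj.edist_le_one)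
    have := le_of_edist_eq_of_le hn (edist_le_add_of_le hm.le hi₂.le)
    rw [hm]
    norm_cast
    omega
  rw [edist_comm] at hi₂
  have hvc : G.edist v c₀ = (i₂ + 1 : ℕ) := by
    obtain ⟨m, hm, hm'⟩ := exists_edist_eq_of_le (edist_le_add_of_le hi₂.le hadj.symm.edist_le_one)
    have := le_of_edist_eq_of_le hn (edist_le_add_of_le hi₁.le (by rw [edist_comm]; exact hm.le))
    rw [hm]
    norm_cast
    omega
  obtain ⟨q₁, q₂, hq, hq₁, hq₂⟩ := htr.exists_detour (hcd ▸ hmem) hsup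
  have h1 := edist_hub_le hC hdisj hhub hj hcd hi₁ hud (fun j' hj' x y i i' hxy hx hy hs => by
    refine hmax j' ⟨hj', x, y, i, i' + 1 + i₂, hxy, hx, ?_, by omega⟩
    obtain ⟨m, hm, hm'⟩ := exists_edist_eq_of_le (edist_le_add_of_le
      (edist_le_add_of_le hy.le hadj.edist_le_one) (by rw [edist_comm]; exact hi₂.le))
    have hxy' : G.Adj x y := by
      have := (hC _ (List.getElem_mem hj')).2.2.1
      rw [← hxy] at this
      exact Walk.adj_of_mem_edges _ this
    have := le_of_edist_eq_of_le hn
      (edist_le_add_of_le (edist_le_add_of_le hx.le hxy'.edist_le_one) hm.le)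
    rw [hm]
    norm_cast
    omega) q₁ hq₁
  have h2 := edist_hub_le hC hdisj hhub hj (Sym2.eq_swap.trans hcd) hi₂ hvc
    (fun j' hj' x y i i' hxy hx hy hs => by
    refine hmax j' ⟨hj', y, x, i₁ + 1 + i', i, Sym2.eq_swap.trans hxy, ?_, ?_, by omega⟩
    · obtain ⟨m, hm, hm'⟩ := exists_edist_eq_of_le (edist_le_add_of_le
        (edist_le_add_of_le hi₁.le hadj.edist_le_one) (by rw [edist_comm]; exact hy.le))
      have hxy' : G.Adj y x := by
        have := (hC _ (List.getElem_mem hj')).2.2.1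
        rw [← hxy] at this
        exact (Walk.adj_of_mem_edges _ this).symm
      have := le_of_edist_eq_of_le hn (edist_le_add_of_le
        (edist_le_add_of_le hm.le hxy'.edist_le_one) (by rw [edist_comm]; exact hx.le))
      rw [hm]
      norm_cast
      omega
    · rwa [edist_comm]) q₂.reverse (fun e he => by
        rw [Walk.edges_reverse, List.mem_reverse] at he
        rw [Sym2.eq_swap]
        exact hq₂ e he)
  rw [edist_comm] at h2
  refine (edist_le_add_of_le h1 h2).trans ?_
  rw [Walk.length_reverse]
  norm_cast
  omega

end Circuits

end SimpleGraph

/-! ### Many disjoint short circuits -/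

namespace SimpleGraph

variable {V : Type*} {G : SimpleGraph V} {u v w : V}

open SpannerProblem

namespace Walk

theorem edist_le_length_of_mem_support (q : G.Walk v v) {x y : V} (hx : x ∈ q.support)
    (hy : y ∈ q.support) : G.edist x y ≤ q.length := by
  classical
  have hy' : y ∈ (q.rotate x hx).support := (q.mem_support_rotate_iff x hx).mpr hy
  refine ((q.rotate x hx).takeUntil y hy').edist_le.trans ?_
  have := (q.rotate x hx).length_takeUntil_le_length hy'
  rw [length_rotate] at this
  exact_mod_cast this

theorem edist_getVert_le (q : G.Walk u v) {i j : ℕ} (hij : i ≤ j) (hj : j ≤ q.length) :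
    G.edist (q.getVert i) (q.getVert j) ≤ (j - i : ℕ) := by
  induction j, hij using Nat.le_induction with
  | base => simp
  | succ j hij ih =>
    have := edist_le_add_of_le (ih (by omega)) (q.adj_getVert_succ (by omega : j < _)).edist_le_one
    rwa [← Nat.sub_add_comm hij] at this

theorem le_of_edist_getVert_le (q : G.Walk u v) (hq : (q.length : ℕ∞) = G.edist u v) {i j m : ℕ}
    (hij : i ≤ j) (hj : j ≤ q.length) (h : G.edist (q.getVert i) (q.getVert j) ≤ m) :
    j ≤ i + m := by
  have h1 := q.edist_getVert_le (Nat.zero_le i) (hij.trans hj)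
  have h2 := q.edist_getVert_le hj le_rfl
  rw [getVert_zero] at h1
  rw [getVert_length] at h2
  have := le_of_edist_eq_of_le hq.symm (edist_le_add_of_le (edist_le_add_of_le h1 h) h2)
  omega

end Walk

section Circuits

variable {ι : Type*} {b : ι → V} {p : ∀ i, G.Walk (b i) (b i)} {c : ι → V} {t : ℕ}

theorem notMem_edges_of_disjoint_support {x y x' y' : V} {q : G.Walk x y} {q' : G.Walk x' y'}
    (h : q.support.Disjoint q'.support) {e : Sym2 V} (he : e ∈ q.edges) : e ∉ q'.edges := by
  induction e with | _ x y =>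
  exact fun he' => h (q.fst_mem_support_of_mem_edges he) (q'.fst_mem_support_of_mem_edges he')

/-- A circuit of `G` that avoids `D` has an edge whose deletion, in addition to that of `D`, keeps
all distances to `c`. -/
theorem exists_edge_deleteEdges_insert {q : G.Walk v v} (hq : q.IsCircuit) {D : Set (Sym2 V)}
    (hD : ∀ e ∈ q.edges, e ∉ D) (c : V) :
    ∃ e ∈ q.edges, ∀ x, (G.deleteEdges (insert e D)).edist x c = (G.deleteEdges D).edist x c := by
  have h' : ∀ e ∈ q.edges, e ∈ (G.deleteEdges D).edgeSet := fun e he => by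
    rw [edgeSet_deleteEdges]
    exact ⟨q.edges_subset_edgeSet he, hD e he⟩
  have hc : (q.transfer _ h').IsCircuit := by
    refine ⟨⟨?_⟩, ?_⟩
    · rw [Walk.edges_transfer]
      exact hq.isTrail.edges_nodup
    · intro h
      have := congrArg Walk.length h
      have h3 := hq.three_le_length
      rw [Walk.length_transfer, Walk.length_nil] at this
      omega
  obtain ⟨e, he, hx⟩ := hc.exists_edist_deleteEdges_eq c
  rw [Walk.edges_transfer] at he
  refine ⟨e, he, fun x => ?_⟩
  rw [← hx x, deleteEdges_deleteEdges, Set.union_singleton]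

/-- Selection of the edges to be removed, one circuit after the other in the order given by `pos`.
The edge of the current circuit `r` is one whose deletion keeps all distances to the hubs of a
fraction `1 / (t + 2)` of the later circuits, and only these are kept. Moreover, the set `A` of
endpoints of the edges selected so far has shortest paths to the hub of `r`, and the few later
circuits that meet them are given up. -/
theorem exists_list_of_pow_le_card [DecidableEq ι] (pos : ι → ℕ) (N K : ℕ) (R₀ : Finset ι)
    (hpos : Set.InjOn pos R₀)
    (hC : ∀ r ∈ R₀, (p r).IsCircuit ∧ (p r).length ≤ t + 2)
    (hdisj : ∀ r ∈ R₀, ∀ r' ∈ R₀, r ≠ r' → (p r).support.Disjoint (p r').support)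
    (hN : ∀ r₀ ∈ R₀, ∀ r ∈ R₀, pos r₀ < pos r → ∀ a ∈ (p r₀).support, ∀ Q : G.Walk a (c r),
      (Q.length : ℕ∞) = G.edist a (c r) → ∃ T : Finset ι, T.card ≤ N ∧
        ∀ r' ∈ R₀, pos r < pos r' → r' ∉ T → Q.support.Disjoint (p r').support) :
    ∀ (k : ℕ) (R : Finset ι) (D : Set (Sym2 V)) (A : Finset V), R ⊆ R₀ →
      A.card + 2 * k ≤ 2 * K →
      (∀ a ∈ A, ∃ r₀ ∈ R₀, a ∈ (p r₀).support ∧ ∀ r ∈ R, pos r₀ < pos r) →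
      (∀ e ∈ D, ∃ r₀ ∈ R₀, r₀ ∉ R ∧ e ∈ (p r₀).edges) →
      (∀ r ∈ R, ∀ x, (G.deleteEdges D).edist x (c r) = G.edist x (c r)) →
      (t + 3) ^ k * (1 + 2 * K * N) ≤ R.card →
      ∃ l : List (ι × Sym2 V), l.length = k ∧ (∀ x ∈ l, x.1 ∈ R ∧ x.2 ∈ (p x.1).edges) ∧
        l.Pairwise (fun x y => x.1 ≠ y.1) ∧
        (∀ y ∈ l, ∀ a ∈ A, (G.deleteEdges ((D ∪ {e | ∃ z ∈ l, z.2 = e}) \ {y.2})).edist a (c y.1) =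
          G.edist a (c y.1)) ∧
        l.Pairwise fun x y => ∀ a ∈ x.2,
          (G.deleteEdges ((D ∪ {e | ∃ z ∈ l, z.2 = e}) \ {y.2})).edist a (c y.1) =
            G.edist a (c y.1) := by
  classical
  intro k
  induction k with
  | zero => exact fun _ _ _ _ _ _ _ _ _ => ⟨[], by simp⟩
  | succ k ih =>
    intro R D A hR hA hAR hDR hhub hcard
    have hRne : R.Nonempty := by
      rw [← Finset.card_pos]
      exact lt_of_lt_of_le (by positivity) hcard
    obtain ⟨r, hr, hrmin⟩ := R.exists_min_image pos hRne
    have hlater : ∀ r' ∈ R, r' ≠ r → pos r < pos r' := fun r' hr' hne =>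
      lt_of_le_of_ne (hrmin r' hr') fun h => hne (hpos (hR hr') (hR hr) h.symm)
    -- Shortest paths to the hub of `r` that survive the deletions made so far.
    have hT : ∀ a : V, ∃ T : Finset ι, a ∈ A → T.card ≤ N ∧ ∀ E'' : Set (Sym2 V),
        (∀ e ∈ E'', e ∈ D ∨ ∃ r' ∈ R, r' ≠ r ∧ r' ∉ T ∧ e ∈ (p r').edges) →
        (G.deleteEdges E'').edist a (c r) = G.edist a (c r) := by
      intro a
      by_cases ha : a ∈ A
      swap
      · exact ⟨∅, fun h => absurd h ha⟩
      by_cases htop : G.edist a (c r) = ⊤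
      · exact ⟨∅, fun _ => ⟨by simp, fun E'' _ =>
          le_antisymm (by rw [htop]; exact le_top) edist_le_deleteEdges⟩⟩
      obtain ⟨n, hn⟩ := ENat.ne_top_iff_exists.mp htop
      obtain ⟨Q, hQ, hQD⟩ := exists_walk_of_edist_deleteEdges_le ((hhub r hr a).trans hn.symm).le
      have hQn : (Q.length : ℕ∞) = G.edist a (c r) :=
        le_antisymm (hn ▸ by exact_mod_cast hQ) Q.edist_le
      obtain ⟨r₀, hr₀, har₀, hlt⟩ := hAR a ha
      obtain ⟨T, hTN, hTd⟩ := hN r₀ hr₀ r (hR hr) (hlt r hr) a har₀ Q hQn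
      refine ⟨T, fun _ => ⟨hTN, fun E'' hE'' => le_antisymm ?_ edist_le_deleteEdges⟩⟩
      rw [← hQn]
      refine edist_deleteEdges_le Q fun e he heE => ?_
      rcases hE'' e heE with h | ⟨r', hr', hne, hrT, her'⟩
      · exact hQD e he h
      · exact notMem_edges_of_disjoint_support (hTd r' (hR hr') (hlater r' hr' hne) hrT) he her'
    choose T hT using hT
    set R₁ := R.erase r \ A.biUnion T with hR₁
    have hR₁card : (t + 2) * ((t + 3) ^ k * (1 + 2 * K * N)) ≤ R₁.card := by
      have h1 : (A.biUnion T).card ≤ 2 * K * N := by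
        refine (Finset.card_biUnion_le_card_mul A T N fun a ha => (hT a ha).1).trans ?_
        exact Nat.mul_le_mul_right N (by omega)
      have h2 := Finset.le_card_sdiff (A.biUnion T) (R.erase r)
      rw [Finset.card_erase_of_mem hr] at h2
      have h3 : 1 + 2 * K * N ≤ (t + 3) ^ k * (1 + 2 * K * N) :=
        Nat.le_mul_of_pos_left _ (by positivity)
      have h4 : (t + 3) ^ (k + 1) * (1 + 2 * K * N) =
          (t + 2) * ((t + 3) ^ k * (1 + 2 * K * N)) + (t + 3) ^ k * (1 + 2 * K * N) := by ring
      rw [hR₁]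
      omega
    obtain ⟨hcirc, hlen⟩ := hC r (hR hr)
    have hDr : ∀ e ∈ (p r).edges, e ∉ D := by
      intro e he heD
      obtain ⟨r₀, hr₀, hr₀R, her₀⟩ := hDR e heD
      exact notMem_edges_of_disjoint_support
        (hdisj r (hR hr) r₀ hr₀ (by rintro rfl; exact hr₀R hr)) he her₀
    choose f hf hf' using fun r' : ι => exists_edge_deleteEdges_insert hcirc hDr (c r')
    have hedge : (p r).edges.toFinset.card ≤ t + 2 :=
      (List.toFinset_card_le _).trans (by rwa [Walk.length_edges])
    obtain ⟨e, he, hecard⟩ := Finset.exists_le_card_fiber_of_mul_le_card_of_maps_to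
      (s := R₁) (t := (p r).edges.toFinset) (f := f) (n := (t + 3) ^ k * (1 + 2 * K * N))
      (fun r' _ => List.mem_toFinset.mpr (hf r')) ⟨f r, List.mem_toFinset.mpr (hf r)⟩
      ((Nat.mul_le_mul_right _ hedge).trans hR₁card)
    rw [List.mem_toFinset] at he
    set R₂ := R₁.filter fun r' => f r' = e with hR₂
    have hmem₂ : ∀ r' ∈ R₂, r' ∈ R ∧ r' ≠ r ∧ (∀ a ∈ A, r' ∉ T a) ∧ f r' = e := by
      intro r' hr'
      simp only [hR₂, hR₁, Finset.mem_filter, Finset.mem_sdiff, Finset.mem_erase,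
        Finset.mem_biUnion, not_exists, not_and] at hr'
      exact ⟨hr'.1.1.2, hr'.1.1.1, hr'.1.2, hr'.2⟩
    have hA₂ : (A ∪ e.toFinset).card ≤ A.card + 2 := by
      refine (Finset.card_union_le _ _).trans (Nat.add_le_add_left ?_ _)
      rw [Sym2.card_toFinset]
      split_ifs <;> omega
    obtain ⟨l, hll, hl, hlne, hlA, hlp⟩ := ih R₂ (insert e D) (A ∪ e.toFinset)
      (fun r' hr' => hR (hmem₂ r' hr').1) (by omega)
      (by
        intro a ha
        rcases Finset.mem_union.mp ha with ha | ha
        · obtain ⟨r₀, h1, h2, h3⟩ := hAR a ha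
          exact ⟨r₀, h1, h2, fun r' hr' => h3 r' (hmem₂ r' hr').1⟩
        · refine ⟨r, hR hr, ?_, fun r' hr' => hlater r' (hmem₂ r' hr').1 (hmem₂ r' hr').2.1⟩
          rw [Sym2.mem_toFinset] at ha
          obtain ⟨y, rfl⟩ := Sym2.mem_iff_exists.mp ha
          exact (p r).fst_mem_support_of_mem_edges he)
      (by
        intro e' he'
        rcases Set.mem_insert_iff.mp he' with rfl | he'
        · exact ⟨r, hR hr, fun h => (hmem₂ r h).2.1 rfl, he⟩
        · obtain ⟨r₀, h1, h2, h3⟩ := hDR e' he'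
          exact ⟨r₀, h1, fun h => h2 (hmem₂ r₀ h).1, h3⟩)
      (by
        intro r' hr' x
        rw [← hhub r' (hmem₂ r' hr').1 x, ← hf' r' x, (hmem₂ r' hr').2.2.2])
      hecard
    have hset : insert e D ∪ {e | ∃ z ∈ l, z.2 = e} =
        D ∪ {e' | ∃ z ∈ (r, e) :: l, z.2 = e'} := by
      ext e'
      simp only [Set.mem_union, Set.mem_insert_iff, Set.mem_ofPred_eq, List.mem_cons,
        exists_eq_or_imp]
      rw [eq_comm (a := e)]
      tauto
    rw [hset] at hlA hlp
    refine ⟨(r, e) :: l, by simp [hll], ?_, ?_, ?_, ?_⟩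
    · intro x hx
      rcases List.mem_cons.mp hx with rfl | hx
      · exact ⟨hr, he⟩
      · exact ⟨(hmem₂ _ (hl x hx).1).1, (hl x hx).2⟩
    · exact List.pairwise_cons.mpr ⟨fun y hy => (hmem₂ _ (hl y hy).1).2.1.symm, hlne⟩
    · intro y hy a ha
      rcases List.mem_cons.mp hy with rfl | hy
      · refine (hT a ha).2 _ ?_
        rintro e' ⟨h1 | ⟨z, hz, rfl⟩, h2⟩
        · exact .inl h1
        · rcases List.mem_cons.mp hz with rfl | hz
          · exact absurd rfl h2
          · have := hmem₂ _ (hl z hz).1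
            exact .inr ⟨z.1, this.1, this.2.1, this.2.2.1 a ha, (hl z hz).2⟩
      · exact hlA y hy a (Finset.mem_union_left _ ha)
    · exact List.pairwise_cons.mpr ⟨fun y hy a ha =>
        hlA y hy a (Finset.mem_union_right _ (Sym2.mem_toFinset.mpr ha)), hlp⟩

theorem exists_isRemovable_of_pow_le_card (pos : ι → ℕ) (N k : ℕ) (R : Finset ι)
    (hpos : Set.InjOn pos R)
    (hC : ∀ r ∈ R, (p r).IsCircuit ∧ (p r).length ≤ t + 2 ∧ c r ∈ (p r).support)
    (hdisj : ∀ r ∈ R, ∀ r' ∈ R, r ≠ r' → (p r).support.Disjoint (p r').support)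
    (hN : ∀ r₀ ∈ R, ∀ r ∈ R, pos r₀ < pos r → ∀ a ∈ (p r₀).support, ∀ Q : G.Walk a (c r),
      (Q.length : ℕ∞) = G.edist a (c r) → ∃ T : Finset ι, T.card ≤ N ∧
        ∀ r' ∈ R, pos r < pos r' → r' ∉ T → Q.support.Disjoint (p r').support)
    (hcard : (t + 3) ^ k * (1 + 2 * k * N) ≤ R.card) :
    ∃ E' : Set (Sym2 V), IsRemovable t G E' ∧ E'.ncard = k ∧
      ∀ e ∈ E', ∃ r ∈ R, e ∈ (p r).edges := by
  classical
  obtain ⟨l, hll, hl, hlne, -, hlp⟩ := exists_list_of_pow_le_card pos N k R hpos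
    (fun r hr => ⟨(hC r hr).1, (hC r hr).2.1⟩) hdisj hN k R ∅ ∅ subset_rfl (by simp) (by simp)
    (by simp) (by simp) hcard
  rw [Set.empty_union] at hlp
  have hpw : l.Pairwise fun x y => (p x.1).support.Disjoint (p y.1).support :=
    hlne.imp_of_mem fun hx hy h => hdisj _ (hl _ hx).1 _ (hl _ hy).1 h
  refine ⟨{e | ∃ z ∈ l, z.2 = e}, isRemovable_of_pairwise (c := c) (fun x hx => ?_) hpw hlp, ?_, ?_⟩
  · have := hC _ (hl x hx).1
    exact ⟨this.1.isTrail, this.2.1, (hl x hx).2, this.2.2⟩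
  · have hnd : (l.map Prod.snd).Nodup := by
      rw [List.nodup_iff_pairwise_ne, List.pairwise_map]
      refine hpw.imp_of_mem fun {x y} hx hy h heq => ?_
      exact notMem_edges_of_disjoint_support h (hl x hx).2 (heq ▸ (hl y hy).2)
    have : {e | ∃ z ∈ l, z.2 = e} = ((l.map Prod.snd).toFinset : Set (Sym2 V)) := by
      ext e
      simp
    rw [this, Set.ncard_coe_finset, List.toFinset_card_of_nodup hnd, List.length_map, hll]
  · rintro _ ⟨z, hz, rfl⟩
    exact ⟨z.1, hl z hz⟩

/-- Circuits that all meet one shortest path: the hubs are taken on the path, far apart, and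
selected from one end of the path to the other. A shortest path to a hub cannot reach later ones. -/
theorem exists_isRemovable_of_meet_geodesic (k : ℕ) (R : Finset ι)
    (hC : ∀ r ∈ R, (p r).IsCircuit ∧ (p r).length ≤ t + 2)
    (hdisj : ∀ r ∈ R, ∀ r' ∈ R, r ≠ r' → (p r).support.Disjoint (p r').support)
    (P : G.Walk u v) (hP : (P.length : ℕ∞) = G.edist u v)
    (hmeet : ∀ r ∈ R, ¬ P.support.Disjoint (p r).support)
    (hcard : (3 * t + 7) * (t + 3) ^ k ≤ R.card) :
    ∃ E' : Set (Sym2 V), IsRemovable t G E' ∧ E'.ncard = k ∧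
      ∀ e ∈ E', ∃ r ∈ R, e ∈ (p r).edges := by
  classical
  have hex : ∀ r, ∃ i : ℕ, r ∈ R → i ≤ P.length ∧ P.getVert i ∈ (p r).support := by
    intro r
    by_cases hr : r ∈ R
    · have := hmeet r hr
      rw [List.disjoint_left] at this
      push Not at this
      obtain ⟨x, hx, hx'⟩ := this
      obtain ⟨i, rfl, hi⟩ := Walk.mem_support_iff_exists_getVert.mp hx
      exact ⟨i, fun _ => ⟨hi, hx'⟩⟩
    · exact ⟨0, fun h => absurd h hr⟩
  choose pos hpos using hex
  obtain ⟨y, -, hy⟩ := Finset.exists_le_card_fiber_of_mul_le_card_of_maps_to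
    (s := R) (t := Finset.range (3 * t + 7)) (f := fun r => pos r % (3 * t + 7))
    (n := (t + 3) ^ k) (fun r _ => Finset.mem_range.mpr (Nat.mod_lt _ (by omega)))
    ⟨0, by simp⟩ (by rwa [Finset.card_range])
  set S := R.filter fun r => pos r % (3 * t + 7) = y with hS
  have hSR : ∀ r ∈ S, r ∈ R := fun r hr => (Finset.mem_filter.mp hr).1
  have hSy : ∀ r ∈ S, pos r % (3 * t + 7) = y := fun r hr => (Finset.mem_filter.mp hr).2
  obtain ⟨E', h1, h2, h3⟩ := exists_isRemovable_of_pow_le_card (p := p) (t := t)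
    (c := fun r => P.getVert (pos r)) pos 0 k S
    (by
      intro r hr r' hr' h
      by_contra hne
      refine hdisj r (hSR r hr) r' (hSR r' hr') hne (hpos r (hSR r hr)).2 ?_
      rw [h]
      exact (hpos r' (hSR r' hr')).2)
    (fun r hr => ⟨(hC r (hSR r hr)).1, (hC r (hSR r hr)).2, (hpos r (hSR r hr)).2⟩)
    (fun r hr r' hr' => hdisj r (hSR r hr) r' (hSR r' hr'))
    (by
      intro r₀ hr₀ r hr hlt a ha Q hQ
      refine ⟨∅, by simp, fun r' hr' hlt' _ x hxQ hxr' => ?_⟩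
      have hbound : ∀ r ∈ S, ∀ x ∈ (p r).support, G.edist x (P.getVert (pos r)) ≤ (t + 2 : ℕ) :=
        fun r hr x hx => ((p r).edist_le_length_of_mem_support hx (hpos r (hSR r hr)).2).trans
          (by exact_mod_cast (hC r (hSR r hr)).2)
      have e1 := hbound r₀ hr₀ a ha
      have e2 := hbound r' hr' x hxr'
      have e3 := edist_le_add_of_le e1
        (P.edist_getVert_le hlt.le (hpos r (hSR r hr)).1)
      rw [← hQ] at e3
      have e4 : G.edist a x ≤ Q.length := (Q.takeUntil x hxQ).edist_le.trans
        (by exact_mod_cast Q.length_takeUntil_le_length hxQ)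
      rw [edist_comm] at e1
      have e5 := P.le_of_edist_getVert_le hP (hlt.trans hlt').le (hpos r' (hSR r' hr')).1
        (edist_le_add_of_le (edist_le_add_of_le e1 (e4.trans e3)) e2)
      have hmod : pos r ≡ pos r' [MOD (3 * t + 7)] := (hSy r hr).trans (hSy r' hr').symm
      have h6 := Nat.le_of_dvd (by omega) ((Nat.modEq_iff_dvd' hlt'.le).mp hmod)
      omega)
    (by simpa using hy)
  exact ⟨E', h1, h2, fun e he => by
    obtain ⟨r, hr, her⟩ := h3 e he
    exact ⟨r, hSR r hr, her⟩⟩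

/-- A number of disjoint circuits of length at most `t + 2` that forces `k` removable edges. -/
def circuitBound (t k : ℕ) : ℕ :=
  (t + 3) ^ k * (1 + 2 * k * ((3 * t + 7) * (t + 3) ^ k))

/-- Many disjoint short circuits contain `k` removable edges: either many of them meet one shortest
path, or every shortest path meets few of them and the hubs may be chosen arbitrarily. -/
theorem exists_isRemovable_of_disjoint_circuits (k : ℕ) (R : Finset ι)
    (hC : ∀ r ∈ R, (p r).IsCircuit ∧ (p r).length ≤ t + 2)
    (hdisj : ∀ r ∈ R, ∀ r' ∈ R, r ≠ r' → (p r).support.Disjoint (p r').support)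
    (hcard : circuitBound t k ≤ R.card) :
    ∃ E' : Set (Sym2 V), IsRemovable t G E' ∧ E'.ncard = k ∧
      ∀ e ∈ E', ∃ r ∈ R, e ∈ (p r).edges := by
  classical
  by_cases hline : ∃ (u v : V) (P : G.Walk u v), (P.length : ℕ∞) = G.edist u v ∧
      (3 * t + 7) * (t + 3) ^ k ≤
        (R.filter fun r => ¬ P.support.Disjoint (p r).support).card
  · obtain ⟨u, v, P, hP, hPc⟩ := hline
    obtain ⟨E', h1, h2, h3⟩ := exists_isRemovable_of_meet_geodesic k
      (R.filter fun r => ¬ P.support.Disjoint (p r).support)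
      (fun r hr => hC r (Finset.mem_filter.mp hr).1)
      (fun r hr r' hr' => hdisj r (Finset.mem_filter.mp hr).1 r' (Finset.mem_filter.mp hr').1)
      P hP (fun r hr => (Finset.mem_filter.mp hr).2) hPc
    refine ⟨E', h1, h2, fun e he => ?_⟩
    obtain ⟨r, hr, her⟩ := h3 e he
    exact ⟨r, (Finset.mem_filter.mp hr).1, her⟩
  · push Not at hline
    obtain ⟨pos, hpos⟩ := (Set.countable_iff_exists_injOn.mp R.countable_toSet)
    exact exists_isRemovable_of_pow_le_card (c := b) pos _ k R hpos
      (fun r hr => ⟨(hC r hr).1, (hC r hr).2, (p r).start_mem_support⟩) hdisj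
      (fun r₀ _ r _ _ a _ Q hQ => ⟨_, (hline a (b r) Q hQ).le, fun r' hr' _ hT => by
        by_contra h
        exact hT (Finset.mem_filter.mpr ⟨hr', h⟩)⟩) hcard

end Circuits

end SimpleGraph

/-! ### Many edges on short circuits -/

namespace SimpleGraph

variable {V : Type*} {G : SimpleGraph V} {u v w : V} {t : ℕ}

open SpannerProblem

/-- Every edge in `F` lies on a circuit of length at most `t + 2` all of whose edges are in `F`. -/
def CoveredByShortCircuits (G : SimpleGraph V) (t : ℕ) (F : Set (Sym2 V)) : Prop :=
  ∀ e ∈ F, ∃ (v : V) (q : G.Walk v v), q.IsCircuit ∧ q.length ≤ t + 2 ∧ e ∈ q.edges ∧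
    ∀ e' ∈ q.edges, e' ∈ F

/-- If many edges lie on short circuits through `w`, then many of them lie outside a tree of
shortest paths to `w`: a tree edge on such a circuit lies below an endpoint of a non-tree edge at
which the circuit leaves the subtree hanging on the tree edge. -/
theorem exists_isRemovable_or_card_le [DecidableEq V] (F : Finset (Sym2 V)) (k : ℕ) (w : V)
    (Fw : Finset (Sym2 V))
    (hF : ∀ e, e ∈ Fw ↔ e ∈ F ∧ ∃ (v : V) (q : G.Walk v v), q.IsCircuit ∧ q.length ≤ t + 2 ∧
      e ∈ q.edges ∧ w ∈ q.support ∧ ∀ e' ∈ q.edges, e' ∈ F) :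
    (∃ E' : Set (Sym2 V), IsRemovable t G E' ∧ E'.ncard = k ∧ ∀ e ∈ E', e ∈ F) ∨
      Fw.card ≤ k * (t + 2) := by
  classical
  obtain ⟨par, hpar⟩ := exists_isParent G w
  have hshort : ∀ x y, s(x, y) ∈ Fw → ∃ i j : ℕ, G.edist x w = i ∧ G.edist y w = j ∧
      i + j ≤ t + 1 := by
    intro x y hxy
    obtain ⟨-, v, q, hq, hlen, he, hw, -⟩ := (hF _).mp hxy
    obtain ⟨q₁, q₂, hsum, -, -⟩ := hq.isTrail.exists_detour he hw
    obtain ⟨i, hi, hi'⟩ := exists_edist_eq_of_le q₁.edist_le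
    obtain ⟨j, hj, hj'⟩ := exists_edist_eq_of_le q₂.reverse.edist_le
    rw [Walk.length_reverse] at hj'
    exact ⟨i, j, hi, hj, by omega⟩
  set NT := Fw.filter fun e => ∀ x, x ≠ w → G.edist x w ≠ ⊤ → s(x, par x) ≠ e with hNT
  rcases le_or_gt k NT.card with hk | hk
  · left
    obtain ⟨E', hE', hcard⟩ := Finset.exists_subset_card_eq hk
    have hmem : ∀ e ∈ E', e ∈ Fw ∧ ∀ x, x ≠ w → G.edist x w ≠ ⊤ → s(x, par x) ≠ e :=
      fun e he => Finset.mem_filter.mp (hE' he)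
    refine ⟨E', hpar.isRemovable ?_ ?_ ?_, by rw [Set.ncard_coe_finset, hcard],
      fun e he => ((hF e).mp (hmem e he).1).1⟩
    · intro e he
      obtain ⟨-, v, q, -, -, heq, -⟩ := (hF e).mp (hmem e he).1
      exact q.edges_subset_edgeSet heq
    · exact fun x h1 h2 h3 => (hmem _ h3).2 x h1 h2 rfl
    · intro x y hxy
      obtain ⟨i, j, hi, hj, hij⟩ := hshort x y (hmem _ hxy).1
      rw [hi, hj]
      exact_mod_cast hij
  right
  let d : V → ℕ := fun x => (G.edist x w).toNat
  have hd : ∀ x, G.edist x w ≠ ⊤ → G.edist x w = d x := fun x hx => (ENat.natCast_toNat hx).symm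
  -- The tree paths from the two endpoints of an edge.
  have hP : ∀ f : Sym2 V, ∃ P : Finset (Sym2 V), f ∈ Fw → P.card ≤ t + 2 ∧ f ∈ P ∧
      ∀ a ∈ f, ∀ i < d a, s(par^[i] a, par^[i + 1] a) ∈ P := by
    intro f
    by_cases hf : f ∈ Fw
    swap
    · exact ⟨∅, fun h => absurd h hf⟩
    induction f with | _ x y =>
    let T : V → Finset (Sym2 V) := fun a =>
      (Finset.range (d a)).image fun i => s(par^[i] a, par^[i + 1] a)
    have hT : ∀ a, (T a).card ≤ d a := fun a =>
      Finset.card_image_le.trans (Finset.card_range _).le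
    refine ⟨insert s(x, y) (T x ∪ T y), fun _ => ⟨?_, by simp, ?_⟩⟩
    · obtain ⟨i, j, hi, hj, hij⟩ := hshort x y hf
      have h1 : d x = i := by simp [d, hi]
      have h2 : d y = j := by simp [d, hj]
      refine (Finset.card_insert_le _ _).trans ?_
      have := Finset.card_union_le (T x) (T y)
      have := hT x
      have := hT y
      omega
    · intro a ha i hi
      refine Finset.mem_insert_of_mem ?_
      rcases Sym2.mem_iff.mp ha with rfl | rfl
      · exact Finset.mem_union_left _ (Finset.mem_image.mpr ⟨i, Finset.mem_range.mpr hi, rfl⟩)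
      · exact Finset.mem_union_right _ (Finset.mem_image.mpr ⟨i, Finset.mem_range.mpr hi, rfl⟩)
  choose P hP using hP
  have hpard : ∀ x, x ≠ w → G.edist x w ≠ ⊤ → G.edist (par x) w ≠ ⊤ ∧ d x = d (par x) + 1 := by
    intro x h1 h2
    have h3 := (hpar x h1 h2).2
    have h4 : G.edist (par x) w ≠ ⊤ := by
      intro h
      rw [h] at h3
      exact h2 h3
    refine ⟨h4, ?_⟩
    rw [hd x h2, hd _ h4] at h3
    exact_mod_cast h3
  have hsub : Fw ⊆ NT.biUnion P := by
    intro e he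
    by_cases heN : e ∈ NT
    · exact Finset.mem_biUnion.mpr ⟨e, heN, (hP e he).2.1⟩
    have hex : ∃ y, y ≠ w ∧ G.edist y w ≠ ⊤ ∧ s(y, par y) = e := by
      by_contra! h
      exact heN (Finset.mem_filter.mpr ⟨he, h⟩)
    obtain ⟨y, hy, hy', rfl⟩ := hex
    obtain ⟨-, v, q, hq, hlen, heq, hw, hqF⟩ := (hF _).mp he
    obtain ⟨q₁, -, -, hq₁, -⟩ := hq.isTrail.exists_detour heq hw
    let S : Set V := {x | G.edist x w ≠ ⊤ ∧ ∃ i, par^[i] x = y ∧ i + d y = d x}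
    have hdy := (hpard y hy hy').2
    have hwS : w ∉ S := by
      rintro ⟨-, i, -, hi⟩
      have : d w = 0 := by simp [d]
      omega
    obtain ⟨δ, hδ, ⟨ha, i, hi, hid⟩, hb⟩ :=
      q₁.exists_boundary_dart S ⟨hy', 0, rfl, by omega⟩ hwS
    have hδe : s(δ.fst, δ.snd) ∈ q₁.edges := by
      rw [Walk.edges]
      exact List.mem_map.mpr ⟨δ, hδ, rfl⟩
    have haw : δ.fst ≠ w := by
      intro h
      rw [h] at hid
      have : d w = 0 := by simp [d]
      omega
    obtain ⟨hmemq, hne⟩ := hq₁ _ hδe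
    have hfw : s(δ.fst, δ.snd) ∈ Fw := (hF _).mpr ⟨hqF _ hmemq, v, q, hq, hlen, hmemq, hw, hqF⟩
    refine Finset.mem_biUnion.mpr ⟨s(δ.fst, δ.snd), Finset.mem_filter.mpr ⟨hfw, ?_⟩, ?_⟩
    · intro x hx hx' hxe
      obtain ⟨h1, h2⟩ := hpard x hx hx'
      rcases Sym2.eq_iff.mp hxe with ⟨hxa, hxb⟩ | ⟨hxb, hxa⟩
      · rw [hxa] at hxb h2
        cases i with
        | zero =>
          apply hne
          rw [← hxb, ← hi]
          rfl
        | succ i =>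
          refine hb ⟨hxb ▸ hxa ▸ h1, i, ?_, ?_⟩
          · rw [← hxb, ← Function.iterate_succ_apply, hi]
          · rw [← hxb]
            omega
      · refine hb ⟨hxb ▸ hx', i + 1, ?_, ?_⟩
        · rw [← hxb, Function.iterate_succ_apply, hxa, hi]
        · rw [← hxb, h2, hxa]
          omega
    · have := (hP _ hfw).2.2 δ.fst (by simp) i (by omega)
      rwa [Function.iterate_succ_apply', hi] at this
  refine (Finset.card_le_card hsub).trans ((Finset.card_biUnion_le_card_mul NT P (t + 2) fun f hf =>
    (hP f (Finset.mem_filter.mp hf).1).1).trans ?_)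
  exact Nat.mul_le_mul_right _ hk.le

/-- A number of edges on short circuits that forces `k` removable edges. -/
def edgeBound (t k : ℕ) : ℕ :=
  circuitBound t k * (t + 3) * (k * (t + 2))

theorem CoveredByShortCircuits.exists_isRemovable {F : Finset (Sym2 V)}
    (hF : G.CoveredByShortCircuits t F) {k : ℕ} (hcard : edgeBound t k < F.card) :
    ∃ E' : Set (Sym2 V), IsRemovable t G E' ∧ E'.ncard = k ∧ ∀ e ∈ E', e ∈ F := by
  classical
  by_contra hno
  let good : Finset (Σ v, G.Walk v v) → Prop := fun R =>
    (∀ r ∈ R, r.2.IsCircuit ∧ r.2.length ≤ t + 2 ∧ ∀ e ∈ r.2.edges, e ∈ F) ∧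
      ∀ r ∈ R, ∀ r' ∈ R, r ≠ r' → r.2.support.Disjoint r'.2.support
  have hlt : ∀ R, good R → R.card < circuitBound t k := by
    intro R hR
    by_contra! h
    obtain ⟨E', h1, h2, h3⟩ := exists_isRemovable_of_disjoint_circuits (ι := Σ v, G.Walk v v)
      (b := Sigma.fst) (p := Sigma.snd) k R (fun r hr => ⟨(hR.1 r hr).1, (hR.1 r hr).2.1⟩) hR.2 h
    exact hno ⟨E', h1, h2, fun e he => by
      obtain ⟨r, hr, her⟩ := h3 e he
      exact (hR.1 r hr).2.2 e her⟩
  -- A largest family of disjoint short circuits.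
  have hbdd : BddAbove {n | ∃ R, good R ∧ R.card = n} := by
    refine ⟨circuitBound t k, ?_⟩
    rintro _ ⟨R, hR, rfl⟩
    exact (hlt R hR).le
  have hne : {n | ∃ R, good R ∧ R.card = n}.Nonempty := ⟨0, ∅, by simp [good], rfl⟩
  obtain ⟨R, hR, hRcard⟩ := Nat.sSup_mem hne hbdd
  have hmax : ∀ R', good R' → R'.card ≤ R.card := fun R' hR' =>
    hRcard ▸ le_csSup hbdd ⟨R', hR', rfl⟩
  let W : Finset V := R.biUnion fun r => r.2.support.toFinset
  have hW : W.card ≤ circuitBound t k * (t + 3) := by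
    refine (Finset.card_biUnion_le_card_mul R _ (t + 3) fun r hr => ?_).trans
      (Nat.mul_le_mul_right _ (hlt R hR).le)
    refine (List.toFinset_card_le _).trans ?_
    rw [Walk.length_support]
    have := (hR.1 r hr).2.1
    omega
  let Fw : V → Finset (Sym2 V) := fun w => F.filter fun e => ∃ (v : V) (q : G.Walk v v),
    q.IsCircuit ∧ q.length ≤ t + 2 ∧ e ∈ q.edges ∧ w ∈ q.support ∧ ∀ e' ∈ q.edges, e' ∈ F
  have hsub : F ⊆ W.biUnion Fw := by
    intro e he
    obtain ⟨v, q, hq, hlen, heq, hqF⟩ := hF e he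
    suffices h : ∃ w ∈ W, w ∈ q.support by
      obtain ⟨w, hw, hwq⟩ := h
      exact Finset.mem_biUnion.mpr ⟨w, hw, Finset.mem_filter.mpr
        ⟨he, v, q, hq, hlen, heq, hwq, hqF⟩⟩
    by_contra! hW'
    have hdis : ∀ r ∈ R, r.2.support.Disjoint q.support := fun r hr x hx hxq =>
      hW' x (Finset.mem_biUnion.mpr ⟨r, hr, List.mem_toFinset.mpr hx⟩) hxq
    have hnew : (⟨v, q⟩ : Σ v, G.Walk v v) ∉ R := fun h =>
      hdis _ h q.start_mem_support q.start_mem_support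
    have := hmax (insert ⟨v, q⟩ R) (by
      constructor
      · intro r hr
        rcases Finset.mem_insert.mp hr with rfl | hr
        exacts [⟨hq, hlen, hqF⟩, hR.1 r hr]
      · intro r hr r' hr' hne
        rcases Finset.mem_insert.mp hr with rfl | hr <;>
          rcases Finset.mem_insert.mp hr' with rfl | hr'
        exacts [absurd rfl hne, (hdis r' hr').symm, hdis r hr, hR.2 r hr r' hr' hne])
    rw [Finset.card_insert_of_notMem hnew] at this
    omega
  have h1 := (Finset.card_le_card hsub).trans (Finset.card_biUnion_le_card_mul W Fw (k * (t + 2))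
    fun w _ => (exists_isRemovable_or_card_le F k w (Fw w)
      (fun e => Finset.mem_filter)).resolve_left hno)
  have h2 : F.card ≤ edgeBound t k := h1.trans (Nat.mul_le_mul_right _ hW)
  omega

theorem edgeBound_le {t k : ℕ} (ht : 0 < t) (hk : 0 < k) : edgeBound t k ≤ (t + 1) ^ (6 * k + 10) := by
  obtain ⟨T, hT⟩ : ∃ T, T = t + 1 := ⟨_, rfl⟩
  have hT2 : 2 ≤ T := by omega
  have h3 : t + 3 ≤ T ^ 2 := by subst hT; nlinarith
  have h2 : t + 2 ≤ T ^ 2 := by omega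
  have h7 : 3 * t + 7 ≤ T ^ 4 := by
    have : T ^ 4 = T ^ 2 * T ^ 2 := by ring
    nlinarith
  have hkT : k ≤ T ^ k := (Nat.lt_pow_self (by omega)).le
  have h3k : (t + 3) ^ k ≤ T ^ (2 * k) := by
    rw [pow_mul]
    exact Nat.pow_le_pow_left h3 k
  have hX : (3 * t + 7) * (t + 3) ^ k ≤ T ^ (4 + 2 * k) := by
    rw [pow_add]
    exact Nat.mul_le_mul h7 h3k
  have hY : 1 + 2 * k * ((3 * t + 7) * (t + 3) ^ k) ≤ T ^ (6 + 3 * k) := by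
    have h1 : 1 ≤ k * ((3 * t + 7) * (t + 3) ^ k) := Nat.mul_pos hk (by positivity)
    have h4 : k * ((3 * t + 7) * (t + 3) ^ k) ≤ T ^ k * T ^ (4 + 2 * k) := Nat.mul_le_mul hkT hX
    have h5 : T ^ (6 + 3 * k) = T ^ 2 * (T ^ k * T ^ (4 + 2 * k)) := by ring
    have h6 : 4 ≤ T ^ 2 := by nlinarith
    rw [h5]
    nlinarith
  rw [← hT, edgeBound, circuitBound]
  calc (t + 3) ^ k * (1 + 2 * k * ((3 * t + 7) * (t + 3) ^ k)) * (t + 3) * (k * (t + 2))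
      ≤ T ^ (2 * k) * T ^ (6 + 3 * k) * T ^ 2 * (T ^ k * T ^ 2) :=
        Nat.mul_le_mul (Nat.mul_le_mul (Nat.mul_le_mul h3k hY) h3) (Nat.mul_le_mul hkT h2)
    _ = T ^ (6 * k + 10) := by ring

theorem coveredByShortCircuits_shortCycleEdges (G : SimpleGraph V) (t : ℕ) :
    G.CoveredByShortCircuits t (G.shortCycleEdges (t + 2)) := by
  rintro e ⟨v, q, hq, hlen, he⟩
  exact ⟨v, q, hq.isCircuit, hlen, he, fun e' he' => ⟨v, q, hq, hlen, he'⟩⟩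

end SimpleGraph

/-! ### Reasoning about programs of the word RAM -/

namespace WordRAM

variable {w : ℕ} {p q : Program} {s s' : State} {T T' : ℕ}

/-- Started in `s`, the program `p` halts, and its running time and final state satisfy `Q`. -/
def RunT (w : ℕ) (p : Program) (s : State) (Q : ℕ → State → Prop) : Prop :=
  ∃ T s', Exec w p s T s' ∧ Q T s'

/-- Started in `s`, the program `p` halts within `T` steps in a state that satisfies `Q`. -/
def Run (w : ℕ) (p : Program) (s : State) (T : ℕ) (Q : State → Prop) : Prop :=
  RunT w p s fun T' s' => T' ≤ T ∧ Q s'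

theorem RunT.mono {Q Q' : ℕ → State → Prop} (h : RunT w p s Q) (hQ : ∀ T s', Q T s' → Q' T s') :
    RunT w p s Q' := by
  obtain ⟨T, s', h1, h2⟩ := h
  exact ⟨T, s', h1, hQ T s' h2⟩

theorem Run.mono {Q Q' : State → Prop} (h : Run w p s T Q) (hT : T ≤ T')
    (hQ : ∀ s', Q s' → Q' s') : Run w p s T' Q' :=
  RunT.mono h fun _ s' h => ⟨h.1.trans hT, hQ s' h.2⟩

theorem RunT.seq {Q Q' : ℕ → State → Prop} (h : RunT w p s Q)
    (h' : ∀ T s', Q T s' → RunT w q s' fun T' s'' => Q' (T + T') s'') :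
    RunT w (.seq p q) s Q' := by
  obtain ⟨T, s', h1, h2⟩ := h
  obtain ⟨T', s'', h3, h4⟩ := h' T s' h2
  exact ⟨T + T', s'', .seq h1 h3, h4⟩

theorem Run.seq {T₁ T₂ : ℕ} {Q Q' : State → Prop} (h : Run w p s T₁ Q)
    (h' : ∀ s', Q s' → Run w q s' T₂ Q') (hT : T₁ + T₂ ≤ T) : Run w (.seq p q) s T Q' :=
  RunT.seq h fun T s' hs => (h' s' hs.2).mono le_rfl (fun _ h => h) |> fun h =>
    RunT.mono h fun T' s'' h'' => ⟨by have := hs.1; have := h''.1; omega, h''.2⟩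

theorem Run.cond {e : Expr} {T₁ : ℕ} {Q : State → Prop}
    (h : e.eval w s ≠ 0 → Run w p s T₁ Q) (h' : e.eval w s = 0 → Run w q s T₁ Q)
    (hT : e.cost + 1 + T₁ ≤ T) : Run w (.cond e p q) s T Q := by
  by_cases he : e.eval w s = 0
  · obtain ⟨T', s', h1, h2, h3⟩ := h' he
    exact ⟨_, s', .cond_neg he h1, by omega, h3⟩
  · obtain ⟨T', s', h1, h2, h3⟩ := h he
    exact ⟨_, s', .cond_pos he h1, by omega, h3⟩

theorem Run.skip {Q : State → Prop} (h : Q s) (hT : 1 ≤ T) : Run w .skip s T Q :=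
  ⟨1, s, .skip s, hT, h⟩

/-! #### Straight-line programs -/

/-- Programs without loops. -/
def Program.loopFree : Program → Bool
  | .skip => true
  | .assign _ _ => true
  | .store _ _ _ => true
  | .seq p q => p.loopFree && q.loopFree
  | .cond _ p q => p.loopFree && q.loopFree
  | .loop _ _ => false

/-- A bound for the running time of a program without loops. -/
def Program.time : Program → ℕ
  | .skip => 1
  | .assign _ e => e.cost + 1
  | .store _ i e => i.cost + e.cost + 1
  | .seq p q => p.time + q.time
  | .cond e p q => e.cost + 1 + max p.time q.time
  | .loop _ _ => 0

/-- The effect of a program without loops; the value at loops is irrelevant. -/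
def Program.effect (w : ℕ) : Program → State → State
  | .skip, s => s
  | .assign x e, s => s.setReg x (e.eval w s)
  | .store a i e, s => s.setArr a (i.eval w s) (e.eval w s)
  | .seq p q, s => q.effect w (p.effect w s)
  | .cond e p q, s => if e.eval w s = 0 then q.effect w s else p.effect w s
  | .loop _ _, s => s

theorem Run.of_loopFree {Q : State → Prop} (hp : p.loopFree = true) (hQ : Q (p.effect w s))
    (hT : p.time ≤ T) : Run w p s T Q := by
  suffices h : ∀ s, ∃ T', Exec w p s T' (p.effect w s) ∧ T' ≤ p.time by
    obtain ⟨T', h1, h2⟩ := h s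
    exact ⟨T', _, h1, h2.trans hT, hQ⟩
  clear hQ hT
  induction p with
  | skip => exact fun s => ⟨1, .skip s, le_rfl⟩
  | assign x e => exact fun s => ⟨_, .assign x e s, le_rfl⟩
  | store a i e => exact fun s => ⟨_, .store a i e s, le_rfl⟩
  | seq p q ihp ihq =>
    intro s
    simp only [Program.loopFree, Bool.and_eq_true] at hp
    obtain ⟨T₁, h1, h2⟩ := ihp hp.1 s
    obtain ⟨T₂, h3, h4⟩ := ihq hp.2 (p.effect w s)
    exact ⟨_, .seq h1 h3, Nat.add_le_add h2 h4⟩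
  | cond e p q ihp ihq =>
    intro s
    simp only [Program.loopFree, Bool.and_eq_true] at hp
    by_cases he : e.eval w s = 0
    · obtain ⟨T₁, h1, h2⟩ := ihq hp.2 s
      refine ⟨_, by simpa only [Program.effect, if_pos he] using .cond_neg he h1, ?_⟩
      simp only [Program.time]
      omega
    · obtain ⟨T₁, h1, h2⟩ := ihp hp.1 s
      refine ⟨_, by simpa only [Program.effect, if_neg he] using .cond_pos he h1, ?_⟩
      simp only [Program.time]
      omega
  | loop e p => simp [Program.loopFree] at hp

/-! #### What a program leaves unchanged -/

/-- Whether the program may write into register `y`. -/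
def Program.writesReg : Program → ℕ → Bool
  | .skip, _ => false
  | .assign x _, y => x == y
  | .store _ _ _, _ => false
  | .seq p q, y => p.writesReg y || q.writesReg y
  | .cond _ p q, y => p.writesReg y || q.writesReg y
  | .loop _ p, y => p.writesReg y

/-- Whether the program may write into array `b`. -/
def Program.writesArr : Program → ℕ → Bool
  | .skip, _ => false
  | .assign _ _, _ => false
  | .store a _ _, b => a == b
  | .seq p q, b => p.writesArr b || q.writesArr b
  | .cond _ p q, b => p.writesArr b || q.writesArr b
  | .loop _ p, b => p.writesArr b

/-- The states `s` and `s'` agree on all registers and arrays that `p` cannot write into. -/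
def Frame (p : Program) (s s' : State) : Prop :=
  (∀ x, p.writesReg x = false → s'.reg x = s.reg x) ∧
    ∀ a, p.writesArr a = false → s'.arr a = s.arr a

theorem Frame.reg (h : Frame p s s') {x : ℕ} (hx : p.writesReg x = false) :
    s'.reg x = s.reg x := h.1 x hx

theorem Frame.arr (h : Frame p s s') {a : ℕ} (ha : p.writesArr a = false) :
    s'.arr a = s.arr a := h.2 a ha

theorem Frame.refl (p : Program) (s : State) : Frame p s s := ⟨fun _ _ => rfl, fun _ _ => rfl⟩

theorem Frame.trans {s'' : State} (h : Frame p s s') (h' : Frame p s' s'') : Frame p s s'' :=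
  ⟨fun x hx => (h'.1 x hx).trans (h.1 x hx), fun a ha => (h'.2 a ha).trans (h.2 a ha)⟩

theorem Frame.of_le {p' : Program} (h : Frame p s s')
    (hr : ∀ x, p'.writesReg x = false → p.writesReg x = false)
    (ha : ∀ a, p'.writesArr a = false → p.writesArr a = false) : Frame p' s s' :=
  ⟨fun x hx => h.1 x (hr x hx), fun a hx => h.2 a (ha a hx)⟩

theorem Exec.frame (h : Exec w p s T s') : Frame p s s' := by
  induction h with
  | skip s => exact Frame.refl _ _
  | assign x e s =>
    refine ⟨fun y hy => ?_, fun _ _ => rfl⟩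
    simp only [Program.writesReg, beq_eq_false_iff_ne] at hy
    exact Function.update_of_ne hy.symm _ _
  | store a i e s =>
    refine ⟨fun _ _ => rfl, fun b hb => ?_⟩
    simp only [Program.writesArr, beq_eq_false_iff_ne] at hb
    exact Function.update_of_ne hb.symm _ _
  | seq _ _ ih ih' =>
    refine (ih.of_le ?_ ?_).trans (ih'.of_le ?_ ?_) <;>
      simp +contextual [Program.writesReg, Program.writesArr]
  | cond_pos _ _ ih | cond_neg _ _ ih =>
    refine ih.of_le ?_ ?_ <;> simp +contextual [Program.writesReg, Program.writesArr]
  | loop_stop _ => exact Frame.refl _ _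
  | loop_step _ _ _ ih ih' =>
    refine (ih.of_le ?_ ?_).trans ih' <;> simp [Program.writesReg, Program.writesArr]

theorem Frame.of_effect (hp : p.loopFree = true) : Frame p s (p.effect w s) := by
  obtain ⟨T, s', h1, h2, rfl⟩ := Run.of_loopFree (w := w) (s := s) (Q := fun s' => s' = p.effect w s)
    hp rfl le_rfl
  exact h1.frame

theorem RunT.with_frame {Q : ℕ → State → Prop} (h : RunT w p s Q) :
    RunT w p s fun T s' => Q T s' ∧ Frame p s s' := by
  obtain ⟨T, s', h1, h2⟩ := h
  exact ⟨T, s', h1, h2, h1.frame⟩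

theorem Run.with_frame {Q : State → Prop} (h : Run w p s T Q) :
    Run w p s T fun s' => Q s' ∧ Frame p s s' :=
  RunT.mono (RunT.with_frame h) fun _ _ h => ⟨h.1.1, h.1.2, h.2⟩

@[simp] theorem State.reg_setReg (s : State) (x v y : ℕ) :
    (s.setReg x v).reg y = if y = x then v else s.reg y := by
  simp [State.setReg, Function.update_apply]

@[simp] theorem State.arr_setReg (s : State) (x v : ℕ) : (s.setReg x v).arr = s.arr := rfl

@[simp] theorem State.reg_setArr (s : State) (a i v : ℕ) : (s.setArr a i v).reg = s.reg := rfl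

@[simp] theorem State.arr_setArr (s : State) (a i v b : ℕ) :
    (s.setArr a i v).arr b = if b = a then Function.update (s.arr a) i v else s.arr b := by
  simp [State.setArr, Function.update_apply]

/-! #### Loops -/

theorem Run.loop_stop {e : Expr} {Q : State → Prop} (he : e.eval w s = 0) (h : Q s)
    (hT : e.cost + 1 ≤ T) : Run w (.loop e p) s T Q :=
  ⟨_, s, Exec.loop_stop he, hT, h⟩

theorem Run.loop_step {e : Expr} {T₁ T₂ : ℕ} {Q Q' : State → Prop} (he : e.eval w s ≠ 0)
    (h : Run w p s T₁ Q) (h' : ∀ s', Q s' → Run w (.loop e p) s' T₂ Q')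
    (hT : e.cost + 1 + T₁ + T₂ ≤ T) : Run w (.loop e p) s T Q' := by
  obtain ⟨T', s', h1, h2, h3⟩ := h
  obtain ⟨T'', s'', h4, h5, h6⟩ := h' s' h3
  exact ⟨_, s'', .loop_step he h1 h4, by omega, h6⟩

/-- A loop whose body runs at most `j` more times whenever `Inv j` holds. -/
theorem Run.loop {e : Expr} {B : ℕ} {Inv : ℕ → State → Prop}
    (hbody : ∀ j s, Inv j s → e.eval w s ≠ 0 → ∃ j', j = j' + 1 ∧ Run w p s B (Inv j'))
    (j : ℕ) (h : Inv j s) (hT : j * (B + e.cost + 1) + e.cost + 1 ≤ T) :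
    Run w (.loop e p) s T fun s' => (∃ j', Inv j' s') ∧ e.eval w s' = 0 := by
  refine Run.mono ?_ hT fun _ h => h
  clear hT
  induction j generalizing s with
  | zero =>
    by_cases he : e.eval w s = 0
    · exact ⟨_, s, Exec.loop_stop he, by omega, ⟨0, h⟩, he⟩
    · obtain ⟨j', hj', -⟩ := hbody 0 s h he
      omega
  | succ j ih =>
    by_cases he : e.eval w s = 0
    · exact ⟨_, s, Exec.loop_stop he, by omega, ⟨_, h⟩, he⟩
    · obtain ⟨j', hj', T₁, s₁, h1, h2, h3⟩ := hbody _ s h he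
      obtain rfl : j = j' := by omega
      obtain ⟨T₂, s₂, h4, h5, h6⟩ := ih h3
      refine ⟨_, s₂, .loop_step he h1 h4, ?_, h6⟩
      rw [Nat.add_mul]
      omega

/-- Run `p` for all values of the register `i` below that of the register `x`. -/
def Program.forLoop (i x : ℕ) (p : Program) : Program :=
  .seq (.assign i (.const 0))
    (.loop (.op .lt (.reg i) (.reg x)) (.seq p (.assign i (.op .add (.reg i) (.const 1)))))

/-- The rule for counting loops. The invariant may speak of the time `τ` spent in the body. -/
theorem RunT.forLoop {i x N : ℕ} {Inv : ℕ → ℕ → State → Prop} (hx : s.reg x = N)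
    (hpx : p.writesReg x = false) (hpi : p.writesReg i = false) (hix : i ≠ x) (hN : N < 2 ^ w)
    (h0 : Inv 0 0 (s.setReg i 0))
    (hbody : ∀ j < N, ∀ τ s', Inv j τ s' → s'.reg i = j → Frame (.forLoop i x p) s s' →
      RunT w p s' fun T s'' => Inv (j + 1) (τ + T) (s''.setReg i (j + 1))) :
    RunT w (.forLoop i x p) s fun T s' => ∃ τ, T = τ + 8 * N + 6 ∧ Inv N τ s' := by
  set F := Program.forLoop i x p with hF
  have hFx : F.writesReg x = false := by
    simp [hF, Program.forLoop, Program.writesReg, hpx, hix]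
  suffices h : ∀ r j τ s', r + j = N → Inv j τ s' → s'.reg i = j → Frame F s s' →
      RunT w (.loop (.op .lt (.reg i) (.reg x)) (.seq p (.assign i (.op .add (.reg i) (.const 1)))))
        s' fun T s'' => ∃ τ', T + τ = τ' + 8 * r + 4 ∧ Inv N τ' s'' by
    have hass : Exec w (.assign i (.const 0)) s 2 (s.setReg i 0) := by
      have := Exec.assign (w := w) i (.const 0) s
      simpa [Expr.cost, Expr.eval] using this
    have hfr : Frame F s (s.setReg i 0) := by
      refine hass.frame.of_le ?_ ?_ <;>
        simp +contextual [hF, Program.forLoop, Program.writesReg, Program.writesArr]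
    obtain ⟨T, s', h1, τ', h2, h3⟩ := h N 0 0 _ (by simp) h0 (by simp) hfr
    exact ⟨_, s', .seq hass h1, τ', by omega, h3⟩
  intro r
  induction r with
  | zero =>
    intro j τ s' hj hinv hi hfr
    have he : Expr.eval w s' (.op .lt (.reg i) (.reg x)) = 0 := by
      have := hfr.reg hFx
      simp only [Expr.eval, BinOp.eval, hi, this, hx]
      simp
      omega
    refine ⟨_, s', Exec.loop_stop he, τ, ?_, ?_⟩
    · simp [Expr.cost]
      omega
    · rwa [show N = j by omega]
  | succ r ih =>
    intro j τ s' hj hinv hi hfr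
    have he : Expr.eval w s' (.op .lt (.reg i) (.reg x)) ≠ 0 := by
      have := hfr.reg hFx
      simp only [Expr.eval, BinOp.eval, hi, this, hx]
      simp
      omega
    obtain ⟨T₁, s₁, h1, h2, h3⟩ := (hbody j (by omega) τ s' hinv hi hfr).with_frame
    have h1i : s₁.reg i = j := (h3.reg hpi).trans hi
    have hass : Exec w (.assign i (.op .add (.reg i) (.const 1))) s₁ 4 (s₁.setReg i (j + 1)) := by
      have := Exec.assign (w := w) i (.op .add (.reg i) (.const 1)) s₁
      have h5 : (j + 1 % 2 ^ w) % 2 ^ w = j + 1 := by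
        rw [Nat.add_mod_mod, Nat.mod_eq_of_lt (by omega)]
      simpa [Expr.cost, Expr.eval, BinOp.eval, h1i, h5] using this
    have hfr' : Frame F s (s₁.setReg i (j + 1)) := by
      refine (hfr.trans (h3.of_le ?_ ?_)).trans (hass.frame.of_le ?_ ?_) <;>
        simp +contextual [hF, Program.forLoop, Program.writesReg, Program.writesArr]
    obtain ⟨T₂, s₂, h4, τ', h5, h6⟩ := ih (j + 1) (τ + T₁) _ (by omega) h2 (by simp) hfr'
    refine ⟨_, s₂, .loop_step he (.seq h1 hass) h4, τ', ?_, h6⟩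
    simp only [Expr.cost]
    omega

theorem Run.forLoop {i x N B : ℕ} {Inv : ℕ → State → Prop} (hx : s.reg x = N)
    (hpx : p.writesReg x = false) (hpi : p.writesReg i = false) (hix : i ≠ x) (hN : N < 2 ^ w)
    (h0 : Inv 0 (s.setReg i 0))
    (hbody : ∀ j < N, ∀ s', Inv j s' → s'.reg i = j → Frame (.forLoop i x p) s s' →
      Run w p s' B fun s'' => Inv (j + 1) (s''.setReg i (j + 1)))
    (hT : N * (B + 8) + 6 ≤ T) :
    Run w (.forLoop i x p) s T (Inv N) := by
  refine (RunT.forLoop (Inv := fun j τ s => τ ≤ j * B ∧ Inv j s) hx hpx hpi hix hN ⟨by simp, h0⟩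
    fun j hj τ s' h hi hfr => RunT.mono (hbody j hj s' h.2 hi hfr) fun T s'' hs =>
      ⟨?_, hs.2⟩).mono fun T' s' hs => ?_
  · rw [Nat.add_mul, one_mul]
    exact Nat.add_le_add h.1 hs.1
  · obtain ⟨τ, rfl, h1, h2⟩ := hs
    exact ⟨by rw [Nat.mul_add] at hT; omega, h2⟩

end WordRAM

/-! ### Breadth-first search -/

namespace WordRAM

/-- The first endpoint of the input edge number `e`. -/
def fstEnd (e : Expr) : Expr := .get 0 (.op .mul (.const 2) e)

/-- The second endpoint of the input edge number `e`. -/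
def sndEnd (e : Expr) : Expr := .get 0 (.op .add (.op .mul (.const 2) e) (.const 1))

/-- Visit the vertex in register `y` from the vertex in register `x` over the edge in register 14
if `x` lies in the current layer (register 13) and `y` has not been visited. Arrays 2, 3, 4, 5 hold
the distances, the parents, the edges to the parents, and the branches of the search tree at its
root, named by their vertices next to the root; unvisited vertices have the distance in
register 4. -/
def visit (x y : ℕ) : Program :=
  .cond (.op .eq (.get 2 (.reg x)) (.reg 13))
    (.cond (.op .eq (.get 2 (.reg y)) (.reg 4))
      (.seq (.store 2 (.reg y) (.op .add (.reg 13) (.const 1)))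
        (.seq (.store 3 (.reg y) (.reg x))
          (.seq (.store 4 (.reg y) (.reg 14))
            (.cond (.reg 13) (.store 5 (.reg y) (.get 5 (.reg x)))
              (.store 5 (.reg y) (.reg y))))))
      .skip)
    .skip

/-- Use the edge in register 14 in both directions; if register 11 holds `1`, then the edges marked
in array 1 are ignored. -/
def scanEdge : Program :=
  .seq (.assign 15 (fstEnd (.reg 14)))
    (.seq (.assign 16 (sndEnd (.reg 14)))
      (.cond (.op .mul (.reg 11) (.get 1 (.reg 14))) .skip (.seq (visit 15 16) (visit 16 15))))

/-- Breadth-first search from the vertex in register 10 up to the distance in register 12, layer by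
layer, where each layer costs one scan of the edge list. The initialization is restricted to the
ends of the edges, so that its cost does not depend on the number of vertices. -/
def bfs : Program :=
  .seq (.forLoop 14 1 (.seq (.store 2 (fstEnd (.reg 14)) (.reg 4))
      (.store 2 (sndEnd (.reg 14)) (.reg 4))))
    (.seq (.store 2 (.reg 10) (.const 0)) (.forLoop 13 12 (.forLoop 14 1 scanEdge)))

/-- The memory contains the instance, `n + t` in register 4 and `2 * k` in register 7. -/
structure HasInput {n : ℕ} (t k : ℕ) (L : List (Fin n × Fin n)) (s : State) : Prop where
  reg_zero : s.reg 0 = n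
  reg_one : s.reg 1 = L.length
  reg_two : s.reg 2 = t
  reg_three : s.reg 3 = k
  reg_four : s.reg 4 = n + t
  reg_seven : s.reg 7 = 2 * k
  fst : ∀ (i : ℕ) (h : i < L.length), s.arr 0 (2 * i) = L[i].1
  snd : ∀ (i : ℕ) (h : i < L.length), s.arr 0 (2 * i + 1) = L[i].2

/-- The program does not write into the part of the memory that holds the input. -/
def Program.keepsInput (p : Program) : Bool :=
  [0, 1, 2, 3, 4, 7].all (fun x => !p.writesReg x) && !p.writesArr 0

variable {n t k w : ℕ} {L : List (Fin n × Fin n)} {s s' : State}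

theorem HasInput.frame (h : HasInput t k L s) {p : Program} (hf : Frame p s s')
    (hp : p.keepsInput = true) : HasInput t k L s' := by
  simp only [Program.keepsInput, List.all_cons, List.all_nil, Bool.and_eq_true, Bool.and_true,
    Bool.not_eq_true'] at hp
  obtain ⟨⟨h0, h1, h2, h3, h4, h7⟩, ha⟩ := hp
  exact ⟨(hf.reg h0).trans h.1, (hf.reg h1).trans h.2, (hf.reg h2).trans h.3,
    (hf.reg h3).trans h.4, (hf.reg h4).trans h.5, (hf.reg h7).trans h.6,
    fun i hi => by rw [hf.arr ha]; exact h.7 i hi, fun i hi => by rw [hf.arr ha]; exact h.8 i hi⟩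

/-- The word length suffices for the numbers that occur in the computation. -/
def WordBound {n : ℕ} (w t k : ℕ) (L : List (Fin n × Fin n)) : Prop :=
  2 * (n + L.length + t + k + 2) ≤ 2 ^ w

theorem HasInput.eval_fstEnd (h : HasInput t k L s) (hw : WordBound w t k L) {e : Expr} {i : ℕ}
    (hi : i < L.length) (he : e.eval w s = i) : (fstEnd e).eval w s = L[i].1 := by
  unfold WordBound at hw
  rw [← h.fst i hi]
  simp only [fstEnd, Expr.eval, BinOp.eval, he]
  rw [Nat.mod_eq_of_lt (a := 2) (by omega), Nat.mod_eq_of_lt (by omega)]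

theorem HasInput.eval_sndEnd (h : HasInput t k L s) (hw : WordBound w t k L) {e : Expr} {i : ℕ}
    (hi : i < L.length) (he : e.eval w s = i) : (sndEnd e).eval w s = L[i].2 := by
  unfold WordBound at hw
  rw [← h.snd i hi]
  simp only [sndEnd, Expr.eval, BinOp.eval, he]
  rw [Nat.mod_eq_of_lt (a := 2) (by omega), Nat.mod_eq_of_lt (a := 1) (by omega),
    Nat.mod_eq_of_lt (a := 2 * i) (by omega), Nat.mod_eq_of_lt (by omega)]

/-- The distance of `x` from `src` if it is at most `r`, and `inf` otherwise. -/
noncomputable def layer (H : SimpleGraph (Fin n)) (src : Fin n) (inf r : ℕ) (x : Fin n) : ℕ :=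
  if H.edist src x ≤ r then (H.edist src x).toNat else inf

section Layer

variable {H : SimpleGraph (Fin n)} {src x y : Fin n} {inf r d : ℕ}

theorem layer_of_eq (h : H.edist src x = d) (hd : d ≤ r) : layer H src inf r x = d := by
  rw [layer, if_pos (by rw [h]; exact_mod_cast hd), h, ENat.toNat_natCast]

theorem layer_of_not_le (h : ¬ H.edist src x ≤ r) : layer H src inf r x = inf := if_neg h

theorem layer_eq_iff (hr : d ≤ r) (hinf : r < inf) :
    layer H src inf r x = d ↔ H.edist src x = d := by
  refine ⟨fun h => ?_, fun h => layer_of_eq h hr⟩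
  by_cases hle : H.edist src x ≤ r
  · obtain ⟨m, hm, hm'⟩ := ENat.le_natCast_iff.mp hle
    rw [layer_of_eq hm hm'] at h
    rw [hm, h]
  · rw [layer_of_not_le hle] at h
    omega

theorem layer_eq_inf_iff (hinf : r < inf) :
    layer H src inf r x = inf ↔ ¬ H.edist src x ≤ r := by
  refine ⟨fun h hle => ?_, layer_of_not_le⟩
  obtain ⟨m, hm, hm'⟩ := ENat.le_natCast_iff.mp hle
  rw [layer_of_eq hm hm'] at h
  omega

theorem layer_succ_eq (hne : H.edist src x ≠ (r + 1 : ℕ)) :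
    layer H src inf (r + 1) x = layer H src inf r x := by
  by_cases hle : H.edist src x ≤ r
  · obtain ⟨m, hm, hm'⟩ := ENat.le_natCast_iff.mp hle
    rw [layer_of_eq hm hm', layer_of_eq hm (by omega)]
  · rw [layer_of_not_le hle, layer_of_not_le]
    intro h
    obtain ⟨m, hm, hm'⟩ := ENat.le_natCast_iff.mp h
    refine hne (hm.trans ?_)
    rw [hm] at hle
    have : ¬ m ≤ r := fun h' => hle (by exact_mod_cast h')
    rw [show m = r + 1 by omega]

end Layer

/-- The source and the ends of the edges: the vertices for which the search computes something. -/
def Touched (L : List (Fin n × Fin n)) (src x : Fin n) : Prop :=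
  x = src ∨ ∃ (i : ℕ) (h : i < L.length), x = L[i].1 ∨ x = L[i].2

/-- The entries of `x` in the arrays 3, 4 and 5 describe its place in a search tree. -/
def TreeAt (L : List (Fin n × Fin n)) (H : SimpleGraph (Fin n)) (src : Fin n) (s : State)
    (x : Fin n) : Prop :=
  ∃ (i : ℕ) (h : i < L.length) (y : Fin n), s.arr 4 x = i ∧ s.arr 3 x = y ∧
    s(L[i].1, L[i].2) = s(x, y) ∧ H.edist src x = H.edist src y + 1 ∧
    s.arr 5 x = if y = src then (x : ℕ) else s.arr 5 y

/-- During round `r` of the search the layers up to `r` have been visited completely, and the layer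
`r + 1` partially. -/
def SearchInv (L : List (Fin n × Fin n)) (H : SimpleGraph (Fin n)) (src : Fin n) (inf r : ℕ)
    (s : State) : Prop :=
  (∀ x, Touched L src x →
    s.arr 2 x = layer H src inf r x ∨ s.arr 2 x = layer H src inf (r + 1) x) ∧
  ∀ x, Touched L src x → x ≠ src → s.arr 2 x ≠ inf → TreeAt L H src s x

section Search

variable {H : SimpleGraph (Fin n)} {src : Fin n} {r : ℕ}

theorem SearchInv.arr_two_eq_iff {inf : ℕ} (h : SearchInv L H src inf r s) (hinf : r + 1 < inf)
    {x : Fin n} (hx : Touched L src x) : s.arr 2 x = r ↔ H.edist src x = r := by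
  rcases h.1 x hx with h | h
  · rw [h, layer_eq_iff le_rfl (by omega)]
  · rw [h, layer_eq_iff (by omega) (by omega)]

theorem visit_spec (hI : SearchInv L H src (n + t) r s) (hr : r + 1 < n + t)
    (hw : n + t < 2 ^ w) {X Y : ℕ} {x y : Fin n} (hx : Touched L src x) (hy : Touched L src y)
    (hadj : H.Adj x y) (hX : s.reg X = x) (hY : s.reg Y = y) {i : ℕ} (hi : i < L.length)
    (hLi : s(L[i].1, L[i].2) = s(x, y)) (h13 : s.reg 13 = r) (h4 : s.reg 4 = n + t)
    (h14 : s.reg 14 = i) (hs' : s' = (visit X Y).effect w s) :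
    SearchInv L H src (n + t) r s' ∧
      (H.edist src x = r → s'.arr 2 y = layer H src (n + t) (r + 1) y) ∧
      (∀ z, Touched L src z → s.arr 2 z = layer H src (n + t) (r + 1) z →
        s'.arr 2 z = layer H src (n + t) (r + 1) z) ∧
      s'.reg = s.reg := by
  have hxr := hI.arr_two_eq_iff hr hx
  have e1 : Expr.eval w s (.op .eq (.get 2 (.reg X)) (.reg 13)) =
      if s.arr 2 x = r then 1 else 0 := by simp [Expr.eval, BinOp.eval, hX, h13]
  have e2 : Expr.eval w s (.op .eq (.get 2 (.reg Y)) (.reg 4)) =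
      if s.arr 2 y = n + t then 1 else 0 := by simp [Expr.eval, BinOp.eval, hY, h4]
  by_cases c1 : s.arr 2 x = r
  swap
  · have : s' = s := by rw [hs', visit, Program.effect, e1, if_neg c1, if_pos rfl]; rfl
    rw [this]
    exact ⟨hI, fun h => absurd (hxr.mpr h) c1, fun _ _ h => h, rfl⟩
  have hdx := hxr.mp c1
  by_cases c2 : s.arr 2 y = n + t
  swap
  · have : s' = s := by
      rw [hs', visit, Program.effect, e1, if_pos c1, if_neg one_ne_zero, Program.effect, e2,
        if_neg c2, if_pos rfl]
      rfl
    rw [this]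
    refine ⟨hI, fun _ => ?_, fun _ _ h => h, rfl⟩
    rcases hI.1 y hy with h | h
    · rw [h, layer_eq_inf_iff (by omega), not_not] at c2
      rw [h, layer_succ_eq]
      intro h'
      rw [h'] at c2
      norm_cast at c2
      omega
    · exact h
  -- Now `y` is reached for the first time.
  have hyr : ¬ H.edist src y ≤ r := by
    rcases hI.1 y hy with h | h
    · rwa [h, layer_eq_inf_iff (by omega)] at c2
    · rw [h, layer_eq_inf_iff (by omega)] at c2
      refine fun h' => c2 (h'.trans ?_)
      norm_cast
      omega
  have hdy : H.edist src y = (r + 1 : ℕ) := by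
    obtain ⟨m, hm, hm'⟩ := SimpleGraph.exists_edist_eq_of_le
      (SimpleGraph.edist_le_add_of_le hdx.le hadj.edist_le_one)
    rw [hm]
    rw [hm] at hyr
    norm_cast at hyr
    rw [show m = r + 1 by omega]
  have hysrc : y ≠ src := by
    rintro rfl
    simp at hyr
  have hxy : x ≠ y := hadj.ne
  have hxyv : (x : ℕ) ≠ y := fun h => hxy (Fin.ext h)
  have hmod : (r + 1) % 2 ^ w = r + 1 := Nat.mod_eq_of_lt (by omega)
  have hmod1 : 1 % 2 ^ w = 1 := Nat.mod_eq_of_lt (by omega)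
  have heff : s' = ((((s.setArr 2 y (r + 1)).setArr 3 y x).setArr 4 y i).setArr 5 y
      (if r = 0 then (y : ℕ) else s.arr 5 x)) := by
    rw [hs', visit, Program.effect, e1, if_pos c1, if_neg one_ne_zero, Program.effect, e2,
      if_pos c2, if_neg one_ne_zero]
    by_cases h0 : r = 0 <;>
      simp [Program.effect, Expr.eval, BinOp.eval, hX, hY, h13, h14, h0, hmod, hmod1]
  have hlay : layer H src (n + t) (r + 1) y = r + 1 := layer_of_eq hdy le_rfl
  have a2 : ∀ z : Fin n, s'.arr 2 z = if z = y then r + 1 else s.arr 2 z := by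
    intro z
    simp [heff, Function.update_apply, Fin.ext_iff]
  have a3 : ∀ z : Fin n, s'.arr 3 z = if z = y then (x : ℕ) else s.arr 3 z := by
    intro z
    simp [heff, Function.update_apply, Fin.ext_iff]
  have a4 : ∀ z : Fin n, s'.arr 4 z = if z = y then i else s.arr 4 z := by
    intro z
    simp [heff, Function.update_apply, Fin.ext_iff]
  have a5 : ∀ z : Fin n, s'.arr 5 z =
      if z = y then (if r = 0 then (y : ℕ) else s.arr 5 x) else s.arr 5 z := by
    intro z
    simp [heff, Function.update_apply, Fin.ext_iff]
  refine ⟨⟨fun z hz => ?_, fun z hz hzs hzi => ?_⟩, fun _ => ?_, fun z hz h => ?_, by simp [heff]⟩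
  · rw [a2]
    split_ifs with h
    · rw [h, hlay]
      exact .inr rfl
    · exact hI.1 z hz
  · by_cases hzy : z = y
    · subst hzy
      refine ⟨i, hi, x, by simp [a4], by simp [a3], by rw [hLi, Sym2.eq_swap], ?_, ?_⟩
      · rw [hdx, hdy]
        push_cast
        rfl
      · have hx0 : x = src ↔ r = 0 := by
          constructor
          · rintro rfl
            rw [SimpleGraph.edist_self] at hdx
            exact_mod_cast hdx.symm
          · rintro rfl
            exact (SimpleGraph.edist_eq_zero_iff.mp hdx).symm
        rw [a5, a5, if_pos rfl, if_neg hxy]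
        simp only [hx0]
    · rw [a2, if_neg hzy] at hzi
      obtain ⟨j, hj, y', h4', h3', hL', hd', h5'⟩ := hI.2 z hz hzs hzi
      -- The parent of `z` was visited before `y`.
      have hy' : y' ≠ y := by
        rintro rfl
        rw [hdy] at hd'
        rcases hI.1 z hz with h | h
        · rw [h] at hzi
          refine hzi (layer_of_not_le ?_)
          rw [hd']
          norm_cast
          omega
        · rw [h] at hzi
          refine hzi (layer_of_not_le ?_)
          rw [hd']
          norm_cast
          omega
      refine ⟨j, hj, y', ?_, ?_, hL', hd', ?_⟩
      · rw [a4, if_neg hzy, h4']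
      · rw [a3, if_neg hzy, h3']
      · rw [a5, if_neg hzy, h5', a5, if_neg hy']
  · rw [a2, if_pos rfl, hlay]
  · rw [a2]
    split_ifs with h'
    · rw [h', hlay]
    · exact h

/-- A bound for the running time of the search. -/
def bfsTime (m R : ℕ) : ℕ := m * 22 + 6 + 3 + (R * (m * (scanEdge.time + 8) + 6 + 8) + 6)

theorem bfs_spec {R : ℕ} {U : ℕ → Prop} (hs : HasInput t k L s) (hw : WordBound w t k L)
    (hsrc : s.reg 10 = src) (h12 : s.reg 12 = R) (hR : R < n + t)
    (hU : ∀ i < L.length, (s.reg 11 * s.arr 1 i) % 2 ^ w = 0 ↔ U i)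
    (hH : ∀ x y, H.Adj x y ↔ ∃ (i : ℕ) (h : i < L.length), U i ∧ s(L[i].1, L[i].2) = s(x, y)) :
    Run w bfs s (bfsTime L.length R) fun s' =>
      ∀ x, Touched L src x → s'.arr 2 x = layer H src (n + t) R x ∧
        (x ≠ src → H.edist src x ≤ R → TreeAt L H src s' x) := by
  have hw' := hw
  unfold WordBound at hw'
  have hTf : ∀ (i : ℕ) (h : i < L.length), Touched L src L[i].1 := fun i h => .inr ⟨i, h, .inl rfl⟩
  have hTs : ∀ (i : ℕ) (h : i < L.length), Touched L src L[i].2 := fun i h => .inr ⟨i, h, .inr rfl⟩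
  -- The part of the memory that the search reads but does not change.
  set K : State → Prop := fun s' => HasInput t k L s' ∧ s'.reg 10 = src ∧ s'.reg 11 = s.reg 11 ∧
    s'.reg 12 = R ∧ s'.arr 1 = s.arr 1 with hK
  have hKf : ∀ (p : Program) {s' s''}, p.keepsInput = true → p.writesReg 10 = false →
      p.writesReg 11 = false → p.writesReg 12 = false → p.writesArr 1 = false → K s' →
      Frame p s' s'' → K s'' := fun p _ _ hp h10 h11 h12 h1 hs' hf =>
    ⟨hs'.1.frame hf hp, (hf.reg h10).trans hs'.2.1, (hf.reg h11).trans hs'.2.2.1,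
      (hf.reg h12).trans hs'.2.2.2.1, (hf.arr h1).trans hs'.2.2.2.2⟩
  have hKs : K s := ⟨hs, hsrc, rfl, h12, rfl⟩
  refine Run.seq (T₁ := L.length * 22 + 6)
    (T₂ := 3 + (R * (L.length * (scanEdge.time + 8) + 6 + 8) + 6)) (Q := fun s₁ =>
    K s₁ ∧ (∀ x, Touched L src x → x = src ∨ s₁.arr 2 x = n + t)) ?_ ?_
    (by rw [bfsTime]; omega)
  · refine (Run.forLoop (N := L.length) (B := 14) (Inv := fun j s₁ => ∀ i (h : i < L.length), i < j →
      s₁.arr 2 L[i].1 = n + t ∧ s₁.arr 2 L[i].2 = n + t) hs.reg_one rfl rfl (by decide) (by omega)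
      (fun i h h' => absurd h' (by omega)) ?_ (by omega)).with_frame.mono le_rfl
      fun s₁ h => ⟨hKf _ rfl rfl rfl rfl rfl hKs h.2, fun x hx => ?_⟩
    · intro j hj s₁ hinv h14 hfr
      have hs₁ := hs.frame hfr rfl
      refine Run.of_loopFree rfl (fun i h hij => ?_) (by decide)
      have e1 := hs₁.eval_fstEnd hw (e := .reg 14) hj h14
      have hs₂ : HasInput t k L (s₁.setArr 2 L[j].1 (n + t)) := by
        refine ⟨hs₁.1, hs₁.2, hs₁.3, hs₁.4, hs₁.5, hs₁.6, fun i hi => ?_, fun i hi => ?_⟩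
        · simpa using hs₁.7 i hi
        · simpa using hs₁.8 i hi
      have e2 := hs₂.eval_sndEnd hw (e := .reg 14) hj h14
      have e3 : (Expr.reg 4).eval w s₁ = n + t := hs₁.reg_four
      have e4 : (Expr.reg 4).eval w (s₁.setArr 2 L[j].1 (n + t)) = n + t := hs₁.reg_four
      simp only [Program.effect, e1, e3, e2, e4]
      rcases Nat.lt_succ_iff_lt_or_eq.mp hij with h1 | rfl
      · have := hinv i h h1
        simp [Function.update_apply, this.1, this.2]
      · simp [Function.update_apply]
    · rcases hx with rfl | ⟨i, hi, rfl | rfl⟩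
      · exact .inl rfl
      · exact .inr (h.1 i hi hi).1
      · exact .inr (h.1 i hi hi).2
  rintro s₁ ⟨hK₁, hinit⟩
  refine Run.seq (T₁ := 3) (Q := fun s₂ => K s₂ ∧ ∀ x, Touched L src x →
      s₂.arr 2 x = layer H src (n + t) 0 x) ?_ ?_ le_rfl
  · refine (Run.of_loopFree (Q := fun s₂ => ∀ x, Touched L src x →
      s₂.arr 2 x = layer H src (n + t) 0 x) rfl (fun x hx => ?_) (by decide)).with_frame.mono le_rfl
      fun s₂ h => ⟨hKf _ rfl rfl rfl rfl rfl hK₁ h.2, h.1⟩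
    by_cases hxs : x = src
    · subst hxs
      rw [layer_of_eq (d := 0) (by simp) le_rfl]
      simp [Program.effect, Expr.eval, hK₁.2.1]
    · rw [layer_of_not_le]
      · have : s₁.arr 2 x = n + t := (hinit x hx).resolve_left hxs
        have hxv : (x : ℕ) ≠ src := fun h => hxs (Fin.ext h)
        simp [Program.effect, Expr.eval, hK₁.2.1, hxv, this]
      · simpa [SimpleGraph.edist_eq_zero_iff] using Ne.symm hxs
  rintro s₂ ⟨hK₂, hzero⟩
  refine Run.forLoop (N := R) (B := L.length * (scanEdge.time + 8) + 6) (Inv := fun r s' =>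
      ∀ x, Touched L src x → s'.arr 2 x = layer H src (n + t) r x ∧
        (x ≠ src → H.edist src x ≤ r → TreeAt L H src s' x)) hK₂.2.2.2.1 rfl rfl (by decide)
    (by omega) (fun x hx => ⟨hzero x hx, fun hxs h => ?_⟩) ?_ le_rfl
  · simp [SimpleGraph.edist_eq_zero_iff] at h
    exact absurd h.symm hxs
  intro r hr s₃ hinv h13 hfr
  have hK₃ : K s₃ := hKf _ rfl rfl rfl rfl rfl hK₂ hfr
  -- One round.
  refine (Run.forLoop (N := L.length) (B := scanEdge.time) (Inv := fun e s' =>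
      SearchInv L H src (n + t) r s' ∧ ∀ i (h : i < L.length), i < e → U i →
        (H.edist src L[i].1 = r → s'.arr 2 L[i].2 = layer H src (n + t) (r + 1) L[i].2) ∧
        (H.edist src L[i].2 = r → s'.arr 2 L[i].1 = layer H src (n + t) (r + 1) L[i].1))
    hK₃.1.reg_one rfl rfl (by decide) (by omega) ⟨⟨fun x hx => .inl (hinv x hx).1,
      fun x hx hxs hxi => (hinv x hx).2 hxs ?_⟩, fun i h h' => absurd h' (by omega)⟩ ?_
    le_rfl).mono le_rfl fun s' h x hx => ?_
  · by_contra hc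
    exact hxi (((hinv x hx).1).trans (layer_of_not_le hc))
  · rintro i hi s₄ ⟨hS, hdone⟩ h14 hfr'
    have hK₄ : K s₄ := hKf _ rfl rfl rfl rfl rfl hK₃ hfr'
    have h13' : s₄.reg 13 = r := (hfr'.reg rfl).trans h13
    refine Run.of_loopFree rfl ?_ le_rfl
    have e1 := hK₄.1.eval_fstEnd hw (e := .reg 14) hi h14
    set s₅ := s₄.setReg 15 (L[i].1 : ℕ) with hs₅
    have hin₅ : HasInput t k L s₅ :=
      ⟨hK₄.1.1, hK₄.1.2, hK₄.1.3, hK₄.1.4, hK₄.1.5, hK₄.1.6, hK₄.1.7, hK₄.1.8⟩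
    have e2 := hin₅.eval_sndEnd hw (e := .reg 14) hi h14
    set s₆ := s₅.setReg 16 (L[i].2 : ℕ) with hs₆
    have e3 : Expr.eval w s₆ (.op .mul (.reg 11) (.get 1 (.reg 14))) =
        (s.reg 11 * s.arr 1 i) % 2 ^ w := by
      rw [← hK₄.2.2.1, ← hK₄.2.2.2.2]
      simp [hs₆, hs₅, Expr.eval, BinOp.eval, h14]
    have heff : scanEdge.effect w s₄ =
        if (s.reg 11 * s.arr 1 i) % 2 ^ w = 0 then
          (visit 16 15).effect w ((visit 15 16).effect w s₆) else s₆ := by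
      rw [scanEdge, Program.effect, Program.effect, Program.effect, Program.effect, Program.effect,
        e1, ← hs₅, e2, ← hs₆, e3]
      rfl
    rw [heff]
    by_cases hUi : U i
    swap
    · rw [if_neg (fun h => hUi ((hU i hi).mp h))]
      refine ⟨hS, fun j hj hji hUj => ?_⟩
      rcases Nat.lt_succ_iff_lt_or_eq.mp hji with h | rfl
      · exact hdone j hj h hUj
      · exact absurd hUj hUi
    rw [if_pos ((hU i hi).mpr hUi)]
    have hadj : H.Adj L[i].1 L[i].2 := (hH _ _).mpr ⟨i, hi, hUi, rfl⟩
    have hw₁ : n + t < 2 ^ w := by omega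
    have hr₁ : r + 1 < n + t := by omega
    obtain ⟨v1, v2, v3, v4⟩ := visit_spec (s := s₆) (X := 15) (Y := 16) hS hr₁ hw₁ (hTf i hi)
      (hTs i hi) hadj (by simp [hs₆, hs₅]) (by simp [hs₆]) hi rfl (by simpa [hs₆, hs₅] using h13')
      hK₄.1.reg_four (by simpa [hs₆, hs₅] using h14) rfl
    set s₇ := (visit 15 16).effect w s₆
    obtain ⟨u1, u2, u3, u4⟩ := visit_spec (s := s₇) (X := 16) (Y := 15) v1 hr₁ hw₁ (hTs i hi)
      (hTf i hi) hadj.symm (by rw [v4]; simp [hs₆]) (by rw [v4]; simp [hs₆, hs₅]) hi Sym2.eq_swap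
      (by rw [v4]; simpa [hs₆, hs₅] using h13') (by rw [v4]; exact hK₄.1.reg_four)
      (by rw [v4]; simpa [hs₆, hs₅] using h14) rfl
    set s₈ := (visit 16 15).effect w s₇
    refine ⟨u1, fun j hj hji hUj => ?_⟩
    rcases Nat.lt_succ_iff_lt_or_eq.mp hji with h | rfl
    · exact ⟨fun hd => u3 _ (hTs j hj) (v3 _ (hTs j hj) ((hdone j hj h hUj).1 hd)),
        fun hd => u3 _ (hTf j hj) (v3 _ (hTf j hj) ((hdone j hj h hUj).2 hd))⟩
    · exact ⟨fun hd => u3 _ (hTs j hj) (v2 hd), u2⟩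
  · obtain ⟨hS, hdone⟩ := h
    have hlay : s'.arr 2 x = layer H src (n + t) (r + 1) x := by
      by_cases hd : H.edist src x = (r + 1 : ℕ)
      · -- A neighbour of `x` in layer `r` has been scanned.
        obtain ⟨p, hp⟩ := SimpleGraph.exists_walk_of_edist_eq_coe hd
        have hpn : p.reverse.length = r + 1 := by rw [SimpleGraph.Walk.length_reverse, hp]
        cases hq : p.reverse with
        | nil => simp [hq] at hpn
        | @cons _ y _ hxy q =>
          rw [hq, SimpleGraph.Walk.length_cons] at hpn
          have hyr : H.edist src y ≤ r := by
            rw [SimpleGraph.edist_comm]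
            refine q.edist_le.trans ?_
            exact_mod_cast (by omega : q.length ≤ r)
          obtain ⟨m, hm, hm'⟩ := SimpleGraph.exists_edist_eq_of_le hyr
          have hmr := SimpleGraph.le_of_edist_eq_of_le hd
            (SimpleGraph.edist_le_add_of_le hm.le hxy.symm.edist_le_one)
          have hym : H.edist src y = r := by rw [hm, show m = r by omega]
          obtain ⟨i, hi, hUi, hLi⟩ := (hH x y).mp hxy
          rcases Sym2.eq_iff.mp hLi with ⟨rfl, rfl⟩ | ⟨rfl, rfl⟩
          · exact (hdone i hi hi hUi).2 hym
          · exact (hdone i hi hi hUi).1 hym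
      · rcases hS.1 x hx with h | h
        · rw [h, layer_succ_eq hd]
        · exact h
    refine ⟨hlay, fun hxs hle => hS.2 x hx hxs ?_⟩
    rw [hlay, Ne, layer_eq_inf_iff (by omega), not_not]
    exact hle

end Search

end WordRAM

/-! ### Collecting edges on short circuits -/

namespace WordRAM

open SpannerProblem

/-- Add the edge in register 28 to the collection unless it has been added before. The collection
is stored as a list in array 6, its length in register 5, and its marks in array 7. -/
def addEdge : Program :=
  .cond (.get 7 (.reg 28)) .skip
    (.seq (.store 7 (.reg 28) (.const 1))
      (.seq (.store 6 (.reg 5) (.reg 28)) (.assign 5 (.op .add (.reg 5) (.const 1)))))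

/-- Add the edges of the tree path from the vertex in register 21 to the root. -/
def addPath : Program :=
  .loop (.get 2 (.reg 21))
    (.seq (.assign 28 (.get 4 (.reg 21))) (.seq addEdge (.assign 21 (.get 3 (.reg 21)))))

/-- Less than `k` edges have been selected, and the edge between the vertices in the registers 18
and 19 joins different branches of the search tree and lies on a short circuit through the root. -/
def selectionTest : Expr :=
  .op .mul (.op .lt (.reg 20) (.reg 3))
    (.op .mul (.op .lt (.const 0) (.get 2 (.reg 18)))
      (.op .mul (.op .lt (.const 0) (.get 2 (.reg 19)))
        (.op .mul
          (.op .lt (.op .add (.get 2 (.reg 18)) (.get 2 (.reg 19))) (.op .add (.reg 2) (.const 2)))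
          (.op .sub (.const 1) (.op .eq (.get 5 (.reg 18)) (.get 5 (.reg 19)))))))

/-- Select the edge in register 17 if it passes the test, and add the edges of its circuit. -/
def selectEdge : Program :=
  .seq (.assign 18 (fstEnd (.reg 17)))
    (.seq (.assign 19 (sndEnd (.reg 17)))
      (.cond selectionTest
        (.seq
          (.seq (.assign 20 (.op .add (.reg 20) (.const 1)))
            (.seq (.assign 28 (.reg 17)) (.seq addEdge (.assign 21 (.reg 18)))))
          (.seq addPath (.seq (.assign 21 (.reg 19)) addPath)))
        .skip))

/-- Add the edges of at most `k` short circuits through the root of the search tree. -/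
def collect : Program :=
  .seq (.assign 20 (.const 0)) (.forLoop 17 1 selectEdge)

variable {n t k w : ℕ} {L : List (Fin n × Fin n)} {s s' : State} {G : SimpleGraph (Fin n)}
  {src : Fin n} {F : Finset (Fin L.length)}

/-- The input edge number `i`. -/
def edgeAt (L : List (Fin n × Fin n)) (i : Fin L.length) : Sym2 (Fin n) :=
  s(L[(i : ℕ)].1, L[(i : ℕ)].2)

/-- The edges with the numbers in `F`. -/
def edgesOf (L : List (Fin n × Fin n)) (F : Finset (Fin L.length)) : Finset (Sym2 (Fin n)) :=
  F.image (edgeAt L)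

theorem edgeAt_mem_edgesOf {i : Fin L.length} (h : i ∈ F) : edgeAt L i ∈ edgesOf L F :=
  Finset.mem_image_of_mem _ h

theorem mem_edgesOf {e : Sym2 (Fin n)} : e ∈ edgesOf L F ↔ ∃ i ∈ F, edgeAt L i = e :=
  Finset.mem_image

theorem edgesOf_subset {F' : Finset (Fin L.length)} (h : F ⊆ F') : edgesOf L F ⊆ edgesOf L F' :=
  Finset.image_subset_image h

theorem _root_.SpannerProblem.IsEdgeList.edgeAt_injective (hL : IsEdgeList G L) :
    Function.Injective (edgeAt L) := by
  intro i j hij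
  have := (List.nodup_iff_injective_get.mp hL.1) (a₁ := i.cast (by simp)) (a₂ := j.cast (by simp))
    (by simpa [edgeAt] using hij)
  simpa [Fin.ext_iff] using this

theorem _root_.SpannerProblem.IsEdgeList.mem_edgeSet_iff (hL : IsEdgeList G L)
    {e : Sym2 (Fin n)} : e ∈ G.edgeSet ↔ ∃ i, edgeAt L i = e := by
  rw [← hL.2 e, List.mem_map]
  constructor
  · rintro ⟨p, hp, rfl⟩
    obtain ⟨i, hi, rfl⟩ := List.getElem_of_mem hp
    exact ⟨⟨i, hi⟩, rfl⟩
  · rintro ⟨i, rfl⟩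
    exact ⟨L[(i : ℕ)], List.getElem_mem _, rfl⟩

theorem _root_.SpannerProblem.IsEdgeList.card_edgesOf (hL : IsEdgeList G L)
    (F : Finset (Fin L.length)) : (edgesOf L F).card = F.card :=
  Finset.card_image_of_injective _ hL.edgeAt_injective

/-- The memory contains the collection `F` of edges. -/
structure Collected (L : List (Fin n × Fin n)) (F : Finset (Fin L.length)) (s : State) : Prop where
  card : s.reg 5 = F.card
  mark : ∀ i : Fin L.length, s.arr 7 i ≠ 0 ↔ i ∈ F
  cell : ∀ j < F.card, ∃ i ∈ F, s.arr 6 j = i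
  cover : ∀ i ∈ F, ∃ j < F.card, s.arr 6 j = i

theorem Collected.congr (h : Collected L F s) (h5 : s'.reg 5 = s.reg 5)
    (h6 : s'.arr 6 = s.arr 6) (h7 : s'.arr 7 = s.arr 7) : Collected L F s' :=
  ⟨h5.trans h.card, by rw [h7]; exact h.mark, by rw [h6]; exact h.cell, by rw [h6]; exact h.cover⟩

theorem Collected.effect_addEdge (h : Collected L F s) (hw : WordBound w t k L) {i : Fin L.length}
    (hi : s.reg 28 = i) : Collected L (insert i F) (addEdge.effect w s) := by
  unfold WordBound at hw
  have hmod1 : 1 % 2 ^ w = 1 := Nat.mod_eq_of_lt (by omega)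
  by_cases hiF : i ∈ F
  · have : addEdge.effect w s = s := by
      have := (h.mark i).mpr hiF
      simp [addEdge, Program.effect, Expr.eval, hi, this]
    rw [this, Finset.insert_eq_of_mem hiF]
    exact h
  · have h0 : s.arr 7 i = 0 := not_not.mp fun h' => hiF ((h.mark i).mp h')
    have hcard : (insert i F).card = F.card + 1 := Finset.card_insert_of_notMem hiF
    have hle : (insert i F).card ≤ L.length := by
      simpa using Finset.card_le_univ (insert i F)
    have heff : addEdge.effect w s =
        ((s.setArr 7 i 1).setArr 6 F.card i).setReg 5 (F.card + 1) := by
      have hmod : (F.card + 1) % 2 ^ w = F.card + 1 := Nat.mod_eq_of_lt (by omega)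
      simp [addEdge, Program.effect, Expr.eval, BinOp.eval, hi, h0, h.card, hmod1, hmod]
    rw [heff]
    refine ⟨by simp [hcard], fun j => ?_, fun j hj => ?_, fun j hj => ?_⟩
    · by_cases hji : j = i
      · simp [hji]
      · have hv : (j : ℕ) ≠ i := fun h' => hji (Fin.ext h')
        have := h.mark j
        simp [hji, hv, this]
    · rw [hcard] at hj
      rcases Nat.lt_succ_iff_lt_or_eq.mp hj with hj | rfl
      · obtain ⟨i', hi', h'⟩ := h.cell j hj
        exact ⟨i', Finset.mem_insert_of_mem hi', by simp [hj.ne, h']⟩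
      · exact ⟨i, Finset.mem_insert_self _ _, by simp⟩
    · rw [hcard]
      rcases Finset.mem_insert.mp hj with rfl | hj
      · exact ⟨F.card, by omega, by simp⟩
      · obtain ⟨j', hj', h'⟩ := h.cover j hj
        exact ⟨j', by omega, by simp [hj'.ne, h']⟩

/-- The result of the search from `src` in the whole graph up to the distance `t`. -/
def SearchTree (L : List (Fin n × Fin n)) (G : SimpleGraph (Fin n)) (t : ℕ) (src : Fin n)
    (s : State) : Prop :=
  ∀ x, Touched L src x → s.arr 2 x = layer G src (n + t) t x ∧
    (x ≠ src → G.edist src x ≤ t → TreeAt L G src s x)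

theorem SearchTree.congr (h : SearchTree L G t src s) (h2 : s'.arr 2 = s.arr 2)
    (h3 : s'.arr 3 = s.arr 3) (h4 : s'.arr 4 = s.arr 4) (h5 : s'.arr 5 = s.arr 5) :
    SearchTree L G t src s' := by
  unfold SearchTree TreeAt
  rw [h2, h3, h4, h5]
  exact h

theorem touched_of_edgeAt_eq {i : Fin L.length} {x y : Fin n} (h : edgeAt L i = s(x, y)) :
    Touched L src x ∧ Touched L src y := by
  rcases Sym2.eq_iff.mp h with ⟨rfl, rfl⟩ | ⟨rfl, rfl⟩
  · exact ⟨.inr ⟨i, i.2, .inl rfl⟩, .inr ⟨i, i.2, .inr rfl⟩⟩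
  · exact ⟨.inr ⟨i, i.2, .inr rfl⟩, .inr ⟨i, i.2, .inl rfl⟩⟩

/-- What the search tree says about a vertex other than the root. -/
theorem SearchTree.exists_parent (h : SearchTree L G t src s) (hL : IsEdgeList G L) {x : Fin n}
    (hx : Touched L src x) {d : ℕ} (hd : G.edist src x = (d + 1 : ℕ)) (hdt : d + 1 ≤ t) :
    ∃ (i : Fin L.length) (y : Fin n), s.arr 4 x = i ∧ s.arr 3 x = y ∧ edgeAt L i = s(x, y) ∧
      G.Adj x y ∧ Touched L src y ∧ G.edist src y = d ∧
      s.arr 5 x = if y = src then (x : ℕ) else s.arr 5 y := by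
  have hxs : x ≠ src := by
    rintro rfl
    rw [SimpleGraph.edist_self] at hd
    exact absurd hd.symm (by norm_cast)
  obtain ⟨i, hi, y, h4, h3, hLi, hdist, h5⟩ := (h x hx).2 hxs (by rw [hd]; exact_mod_cast hdt)
  have he : edgeAt L ⟨i, hi⟩ = s(x, y) := hLi
  refine ⟨⟨i, hi⟩, y, h4, h3, he, hL.mem_edgeSet_iff.mpr ⟨_, he⟩, (touched_of_edgeAt_eq he).2,
    ?_, h5⟩
  rw [hd] at hdist
  push_cast at hdist
  exact (WithTop.add_right_inj (by exact WithTop.one_ne_top)).mp hdist.symm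

/-- The walk `p` is a path inside one branch of the search tree, from `a` to the root. Its edges and
the edge from the root into the branch belong to `F'`, and only its edges have been added to `F`. -/
def IsTreePath (L : List (Fin n × Fin n)) (src : Fin n) (s : State)
    (F F' : Finset (Fin L.length)) {a : Fin n} (p : G.Walk a src) : Prop :=
  p.IsPath ∧ (∀ z ∈ p.support, z = src ∨ s.arr 5 z = s.arr 5 a) ∧
    (∀ e ∈ p.edges, e ∈ edgesOf L F') ∧ (∀ i ∈ F', i ∉ F → edgeAt L i ∈ p.edges) ∧
    (a ≠ src → ∃ y : Fin n, s.arr 5 a = y ∧ s(y, src) ∈ edgesOf L F')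

theorem addPath_spec (hL : IsEdgeList G L) (hw : WordBound w t k L) (d : ℕ) :
    ∀ {s : State} {F : Finset (Fin L.length)} {a : Fin n}, SearchTree L G t src s →
      Collected L F s → Touched L src a → G.edist src a = d → d ≤ t → s.reg 21 = a →
      Run w addPath s (d * 23 + 3) fun s' => ∃ F', Collected L F' s' ∧ F ⊆ F' ∧
        F'.card ≤ F.card + d ∧ ∃ p : G.Walk a src, p.length = d ∧ IsTreePath L src s F F' p := by
  induction d with
  | zero =>
    intro s F a hS hF ha hd _ h21
    have hlay := (hS a ha).1
    rw [layer_of_eq hd (Nat.zero_le _)] at hlay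
    obtain rfl : src = a := SimpleGraph.edist_eq_zero_iff.mp (by rw [hd]; rfl)
    refine Run.loop_stop (by simpa [Expr.eval, h21] using hlay) ⟨F, hF, subset_rfl, le_rfl, .nil,
      rfl, .nil, by simp, by simp, fun i h1 h2 => absurd h1 h2, fun h => absurd rfl h⟩ le_rfl
  | succ d ih =>
    intro s F a hS hF ha hd hdt h21
    obtain ⟨i, y, h4, h3, he, hadj, hy, hdy, h5⟩ := hS.exists_parent hL ha hd hdt
    have hlay := (hS a ha).1
    rw [layer_of_eq hd hdt] at hlay
    refine Run.loop_step (T₁ := 20) (T₂ := d * 23 + 3) (Q := fun s' =>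
      Collected L (insert i F) s' ∧ s'.reg 21 = y ∧ SearchTree L G t src s' ∧
        s'.arr 5 = s.arr 5) (by simp [Expr.eval, h21, hlay]) ?_ ?_ (by simp [Expr.cost]; omega)
    · refine (Run.of_loopFree (Q := fun s' => Collected L (insert i F) s' ∧ s'.reg 21 = y) rfl
        ?_ (by decide)).with_frame.mono le_rfl fun s' h => ⟨h.1.1, h.1.2,
          hS.congr (h.2.arr rfl) (h.2.arr rfl) (h.2.arr rfl) (h.2.arr rfl), h.2.arr rfl⟩
      have hF₁ : Collected L F (s.setReg 28 i) := hF.congr (by simp) rfl rfl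
      have hF₂ := hF₁.effect_addEdge hw (i := i) (by simp)
      have hfr : Frame addEdge (s.setReg 28 i) (addEdge.effect w (s.setReg 28 i)) :=
        Frame.of_effect rfl
      have e1 : Expr.eval w s (.get 4 (.reg 21)) = i := by simpa [Expr.eval, h21] using h4
      have e2 : Expr.eval w (addEdge.effect w (s.setReg 28 i)) (.get 3 (.reg 21)) = y := by
        have h21' := hfr.reg (x := 21) rfl
        have h3' := hfr.arr (a := 3) rfl
        simp only [Expr.eval, h21', h3']
        simpa [h21] using h3
      simp only [Program.effect, e1, e2]
      exact ⟨hF₂.congr (by simp) rfl rfl, by simp⟩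
    · rintro s₁ ⟨hF₁, h21₁, hS₁, h5₁⟩
      refine (ih hS₁ hF₁ hy hdy (by omega) h21₁).mono le_rfl ?_
      rintro s' ⟨F', hF', hsub, hcard, p, hp, hpath, hsupp, hedge, hnew, hroot⟩
      have hiF : i ∈ F' := hsub (Finset.mem_insert_self _ _)
      rw [h5₁] at hsupp hroot
      have hy5 : ∀ z ∈ p.support, z = src ∨ s.arr 5 z = s.arr 5 a := by
        intro z hz
        by_cases hys : y = src
        · -- The path from the root to itself is trivial.
          subst hys
          have : p.length = 0 := by
            rw [SimpleGraph.edist_self] at hdy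
            rw [hp]
            exact_mod_cast hdy.symm
          rw [(SimpleGraph.Walk.length_eq_zero_iff.mp this).eq_nil] at hz
          exact .inl (by simpa using hz)
        · rw [h5, if_neg hys]
          exact hsupp z hz
      refine ⟨F', hF', (Finset.subset_insert _ _).trans hsub, ?_, .cons hadj p, by simp [hp], ?_,
        ?_, ?_, ?_, fun _ => ?_⟩
      · have := Finset.card_insert_le i F
        omega
      · refine (SimpleGraph.Walk.cons_isPath_iff hadj p).mpr ⟨hpath, fun hmem => ?_⟩
        have h1 := (p.dropUntil a hmem).edist_le
        rw [SimpleGraph.edist_comm, hd] at h1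
        have h2 := p.length_dropUntil_le_length hmem
        have h3 : d + 1 ≤ (p.dropUntil a hmem).length := by exact_mod_cast h1
        omega
      · simp only [SimpleGraph.Walk.support_cons, List.mem_cons]
        rintro z (rfl | hz)
        exacts [.inr rfl, hy5 z hz]
      · simp only [SimpleGraph.Walk.edges_cons, List.mem_cons]
        rintro e (rfl | hz)
        exacts [he ▸ edgeAt_mem_edgesOf hiF, hedge e hz]
      · intro j hj hjF
        rw [SimpleGraph.Walk.edges_cons, List.mem_cons]
        by_cases hji : j = i
        · exact .inl (by rw [hji, he])
        · exact .inr (hnew j hj (by simp [hji, hjF]))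
      · by_cases hys : y = src
        · refine ⟨a, by rw [h5, if_pos hys], ?_⟩
          rw [← hys, ← he]
          exact edgeAt_mem_edgesOf hiF
        · rw [h5, if_neg hys]
          exact hroot hys


theorem layer_le {H : SimpleGraph (Fin n)} {inf r : ℕ} (h : r ≤ inf) (x : Fin n) :
    layer H src inf r x ≤ inf := by
  by_cases hle : H.edist src x ≤ r
  · obtain ⟨m, hm, hm'⟩ := SimpleGraph.exists_edist_eq_of_le hle
    rw [layer_of_eq hm hm']
    omega
  · rw [layer_of_not_le hle]

theorem SearchTree.edist_eq (h : SearchTree L G t src s) {x : Fin n} (hx : Touched L src x)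
    (hle : s.arr 2 x ≤ t) : G.edist src x = s.arr 2 x :=
  (layer_eq_iff hle (by have := src.pos; omega)).mp (h x hx).1.symm

theorem SearchTree.arr_eq (h : SearchTree L G t src s) {x : Fin n} (hx : Touched L src x)
    {d : ℕ} (hd : G.edist src x = d) (hle : d ≤ t) : s.arr 2 x = d :=
  (h x hx).1.trans (layer_of_eq hd hle)

/-- The tree paths from `a` and from `b` to the root have at most `t + 1` edges in total, and they
belong to different branches of the search tree. -/
def Bridge (t : ℕ) (s : State) (a b : Fin n) : Prop :=
  s.arr 2 a ≠ 0 ∧ s.arr 2 b ≠ 0 ∧ s.arr 2 a + s.arr 2 b < t + 2 ∧ s.arr 5 a ≠ s.arr 5 b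

theorem Bridge.symm {a b : Fin n} (h : Bridge t s a b) : Bridge t s b a :=
  ⟨h.2.1, h.1, by rw [add_comm]; exact h.2.2.1, h.2.2.2.symm⟩

theorem Bridge.congr {a b : Fin n} (h : Bridge t s a b) (h2 : s'.arr 2 = s.arr 2)
    (h5 : s'.arr 5 = s.arr 5) : Bridge t s' a b := by
  unfold Bridge
  rwa [h2, h5]

theorem eval_selectionTest (hs : HasInput t k L s) (hw : WordBound w t k L) {a b : Fin n}
    (ha : s.reg 18 = a) (hb : s.reg 19 = b) (ha' : s.arr 2 a ≤ n + t) (hb' : s.arr 2 b ≤ n + t) :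
    selectionTest.eval w s ≠ 0 ↔ s.reg 20 < k ∧ Bridge t s a b := by
  unfold WordBound at hw
  have hmod0 : 0 % 2 ^ w = 0 := Nat.zero_mod _
  have hmod1 : 1 % 2 ^ w = 1 := Nat.mod_eq_of_lt (by omega)
  have hmod2 : 2 % 2 ^ w = 2 := Nat.mod_eq_of_lt (by omega)
  have hmod3 : (t + 2) % 2 ^ w = t + 2 := Nat.mod_eq_of_lt (by omega)
  have hmod4 : (s.arr 2 a + s.arr 2 b) % 2 ^ w = s.arr 2 a + s.arr 2 b :=
    Nat.mod_eq_of_lt (by omega)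
  simp only [selectionTest, Expr.eval, BinOp.eval, ha, hb, hs.reg_two, hs.reg_three, hmod0, hmod1,
    hmod2, hmod3, hmod4, Bridge, Nat.pos_iff_ne_zero]
  by_cases h1 : s.reg 20 < k
  swap
  · simp [h1]
  by_cases h2 : s.arr 2 a = 0
  · simp [h2]
  by_cases h3 : s.arr 2 b = 0
  · simp [h3]
  by_cases h4 : s.arr 2 a + s.arr 2 b < t + 2
  swap
  · simp [h4]
  by_cases h5 : s.arr 5 a = s.arr 5 b <;> simp [h1, h2, h3, h4, h5, hmod1]

/-- The union of two paths from `src` in different branches and of an edge between their ends. -/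
theorem isCircuit_of_branches {a b : Fin n} {p : G.Walk a src} {q : G.Walk b src}
    (hp : p.IsPath) (hq : q.IsPath) (hab : G.Adj a b) {f : Fin n → ℕ} (hf : f a ≠ f b)
    (ha : a ≠ src) (hb : b ≠ src)
    (hpf : ∀ z ∈ p.support, z = src ∨ f z = f a) (hqf : ∀ z ∈ q.support, z = src ∨ f z = f b) :
    (p.reverse.append (.cons hab q)).IsCircuit := by
  have hb' : b ∉ p.support := fun h => (hpf b h).elim hb fun h => hf h.symm
  have ha' : a ∉ q.support := fun h => (hqf a h).elim ha fun h => hf h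
  refine (SimpleGraph.Walk.isCircuit_def _).mpr ⟨?_, ?_⟩
  · rw [SimpleGraph.Walk.isTrail_def, SimpleGraph.Walk.edges_append,
      SimpleGraph.Walk.edges_reverse, SimpleGraph.Walk.edges_cons, List.nodup_append]
    refine ⟨List.nodup_reverse.mpr hp.isTrail.edges_nodup, List.nodup_cons.mpr
      ⟨fun h => ha' (q.fst_mem_support_of_mem_edges h), hq.isTrail.edges_nodup⟩, ?_⟩
    rintro e he e' he' rfl
    rw [List.mem_reverse] at he
    rcases List.mem_cons.mp he' with rfl | he'
    · exact hb' (p.snd_mem_support_of_mem_edges he)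
    · -- A common edge of the two paths would have the root as both of its ends.
      induction e with
      | _ x y =>
        have key : ∀ z, z ∈ p.support → z ∈ q.support → z = src := fun z h1 h2 =>
          (hpf z h1).elim id fun h3 => (hqf z h2).elim id fun h4 => absurd (h3.symm.trans h4) hf
        have hx := key x (p.fst_mem_support_of_mem_edges he) (q.fst_mem_support_of_mem_edges he')
        have hy := key y (p.snd_mem_support_of_mem_edges he) (q.snd_mem_support_of_mem_edges he')
        exact (p.adj_of_mem_edges he).ne (hx.trans hy.symm)
  · intro h
    have := congrArg SimpleGraph.Walk.length h
    simp at this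

/-- The edge between `x`'s branch and the root belongs to `F`. -/
def BranchIn (L : List (Fin n × Fin n)) (src : Fin n) (s : State) (F : Finset (Fin L.length))
    (x : Fin n) : Prop :=
  ∃ y : Fin n, s.arr 5 x = y ∧ s(y, src) ∈ edgesOf L F

theorem BranchIn.mono {F' : Finset (Fin L.length)} {x : Fin n} (h : BranchIn L src s F x)
    (hF : F ⊆ F') : BranchIn L src s F' x :=
  let ⟨y, h1, h2⟩ := h
  ⟨y, h1, edgesOf_subset hF h2⟩

theorem BranchIn.congr {x : Fin n} (h : BranchIn L src s F x) (h5 : s'.arr 5 = s.arr 5) :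
    BranchIn L src s' F x := by
  unfold BranchIn
  rwa [h5]

/-- The state of the collection when the edges with the numbers below `j` have been considered:
`F₀` has grown to `F`, and the circuits of the edges in `C` have been added. -/
structure Selection (L : List (Fin n × Fin n)) (G : SimpleGraph (Fin n)) (t k : ℕ) (src : Fin n)
    (F₀ F C : Finset (Fin L.length)) (j : ℕ) (s : State) : Prop where
  collected : Collected L F s
  subset : F₀ ⊆ F
  card_le : F.card ≤ F₀.card + C.card * (t + 2)
  covered : G.CoveredByShortCircuits t (edgesOf L F)
  selected_subset : C ⊆ F
  count : s.reg 20 = C.card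
  count_le : C.card ≤ k
  lt : ∀ i ∈ C, (i : ℕ) < j
  bridge : ∀ i ∈ C, Bridge t s L[(i : ℕ)].1 L[(i : ℕ)].2
  complete : C.card < k → ∀ (i : ℕ) (h : i < L.length), i < j → Bridge t s L[i].1 L[i].2 →
    BranchIn L src s F L[i].1 ∧ BranchIn L src s F L[i].2

/-- A bound for the running time of `selectEdge`. -/
def selectTime (t : ℕ) : ℕ := 100 + 23 * (t + 1)

theorem selectEdge_spec (hL : IsEdgeList G L) (hw : WordBound w t k L) (hs : HasInput t k L s)
    (hS : SearchTree L G t src s) {F₀ F C : Finset (Fin L.length)} {j : ℕ} (hj : j < L.length)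
    (h17 : s.reg 17 = j) (h : Selection L G t k src F₀ F C j s) :
    Run w selectEdge s (selectTime t) fun s' =>
      ∃ F' C', Selection L G t k src F₀ F' C' (j + 1) s' := by
  have hw' := hw
  unfold WordBound at hw'
  have e1 := hs.eval_fstEnd hw (e := .reg 17) hj h17
  set a := L[j].1 with ha
  set b := L[j].2 with hb
  have hea : edgeAt L ⟨j, hj⟩ = s(a, b) := rfl
  have hadj : G.Adj a b := hL.mem_edgeSet_iff.mpr ⟨_, hea⟩
  obtain ⟨hTa, hTb⟩ := touched_of_edgeAt_eq (src := src) hea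
  have hDa : s.arr 2 a ≤ n + t := (hS a hTa).1 ▸ layer_le (by omega) a
  have hDb : s.arr 2 b ≤ n + t := (hS b hTb).1 ▸ layer_le (by omega) b
  refine Run.seq (T₁ := 5) (T₂ := 95 + 23 * (t + 1)) (Q := fun s' => s' = s.setReg 18 a)
    (Run.of_loopFree rfl (by simp only [Program.effect, e1]) (by decide)) ?_
    (by rw [selectTime]; omega)
  rintro s₁ rfl
  have hs₁ : HasInput t k L (s.setReg 18 a) :=
    ⟨hs.1, hs.2, hs.3, hs.4, hs.5, hs.6, hs.7, hs.8⟩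
  have e2 := hs₁.eval_sndEnd hw (e := .reg 17) hj (by simpa [Expr.eval] using h17)
  refine Run.seq (T₁ := 7) (T₂ := 88 + 23 * (t + 1))
    (Q := fun s' => s' = (s.setReg 18 a).setReg 19 b)
    (Run.of_loopFree rfl (by simp only [Program.effect, e2]; rfl) (by decide)) ?_ (by omega)
  rintro s₂ rfl
  set s₂ := (s.setReg 18 a).setReg 19 b with hs₂def
  have hs₂ : HasInput t k L s₂ := ⟨hs.1, hs.2, hs.3, hs.4, hs.5, hs.6, hs.7, hs.8⟩
  have h20 : s₂.reg 20 = C.card := by simpa [hs₂def] using h.count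
  have htest := eval_selectionTest hs₂ hw (a := a) (b := b) (by simp [hs₂def]) (by simp [hs₂def])
    hDa hDb
  have hS₂ : SearchTree L G t src s₂ := hS.congr rfl rfl rfl rfl
  have hF₂ : Collected L F s₂ := h.collected.congr (by simp [hs₂def]) rfl rfl
  refine Run.cond (T₁ := 50 + 23 * (t + 1)) (fun he => ?_) (fun he => ?_)
    (by simp [selectionTest, Expr.cost]; omega)
  swap
  · refine Run.skip ⟨F, C, hF₂, h.subset, h.card_le, h.covered, h.selected_subset, h20, h.count_le,
      fun i hi => (h.lt i hi).trans (by omega), fun i hi => h.bridge i hi, ?_⟩ (by omega)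
    intro hC i hi hij hbr
    rcases Nat.lt_succ_iff_lt_or_eq.mp hij with hij | rfl
    · exact h.complete hC i hi hij hbr
    · exact absurd he (htest.mpr ⟨by omega, hbr⟩)
  obtain ⟨hCk, hbr⟩ := htest.mp he
  have hbr' : Bridge t s a b := hbr
  obtain ⟨ha0, hb0, hsum, hne⟩ := hbr'
  have hdA := hS.edist_eq hTa (by omega)
  have hdB := hS.edist_eq hTb (by omega)
  rw [h20] at hCk
  have hjC : (⟨j, hj⟩ : Fin L.length) ∉ C := fun h' => lt_irrefl _ (h.lt _ h')
  have hcardC : (insert (⟨j, hj⟩ : Fin L.length) C).card = C.card + 1 :=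
    Finset.card_insert_of_notMem hjC
  refine Run.seq (T₁ := 30) (T₂ := 20 + 23 * (t + 1)) (Q := fun s₃ =>
    Collected L (insert ⟨j, hj⟩ F) s₃ ∧ s₃.reg 21 = a ∧ s₃.reg 19 = b ∧ s₃.reg 20 = C.card + 1 ∧
      s₃.arr 2 = s.arr 2 ∧ s₃.arr 5 = s.arr 5 ∧ SearchTree L G t src s₃) ?_ ?_ (by omega)
  · refine (Run.of_loopFree (Q := fun s₃ => Collected L (insert ⟨j, hj⟩ F) s₃ ∧ s₃.reg 21 = a ∧
      s₃.reg 20 = C.card + 1) rfl ?_ (by decide)).with_frame.mono le_rfl fun s₃ h₃ =>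
        ⟨h₃.1.1, h₃.1.2.1, (h₃.2.reg rfl).trans (by simp [hs₂def]), h₃.1.2.2, h₃.2.arr rfl,
          h₃.2.arr rfl, hS₂.congr (h₃.2.arr rfl) (h₃.2.arr rfl) (h₃.2.arr rfl) (h₃.2.arr rfl)⟩
    have hClt : C.card < L.length := by
      have : (insert (⟨j, hj⟩ : Fin L.length) C).card ≤ L.length := by
        simpa using Finset.card_le_univ (insert (⟨j, hj⟩ : Fin L.length) C)
      omega
    have e3 : Expr.eval w s₂ (.op .add (.reg 20) (.const 1)) = C.card + 1 := by
      simp only [Expr.eval, BinOp.eval, h20]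
      rw [Nat.add_mod_mod, Nat.mod_eq_of_lt (by omega)]
    set s₃ := (s₂.setReg 20 (C.card + 1)).setReg 28 j with hs₃
    have e4 : Expr.eval w (s₂.setReg 20 (C.card + 1)) (.reg 17) = j := by
      simpa [Expr.eval, hs₂def] using h17
    have hF₃ : Collected L F s₃ := hF₂.congr (by simp [hs₃]) rfl rfl
    have hF₄ := hF₃.effect_addEdge hw (i := ⟨j, hj⟩) (by simp [hs₃])
    have hfr : Frame addEdge s₃ (addEdge.effect w s₃) :=
        Frame.of_effect rfl
    have e5 : Expr.eval w (addEdge.effect w s₃) (.reg 18) = a := by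
      rw [Expr.eval, hfr.reg rfl]
      simp [hs₃, hs₂def]
    have e6 : (addEdge.effect w s₃).reg 20 = C.card + 1 := by
      rw [hfr.reg rfl]
      simp [hs₃]
    simp only [Program.effect, e3, e4, ← hs₃, e5]
    exact ⟨hF₄.congr (by simp) rfl rfl, by simp, by simpa using e6⟩
  rintro s₃ ⟨hF₃, h21, h19, h20₃, hD, hB, hS₃⟩
  refine Run.seq (T₁ := s.arr 2 a * 23 + 3) (T₂ := 5 + s.arr 2 b * 23)
    (addPath_spec hL hw _ hS₃ hF₃ hTa hdA (by omega) h21).with_frame ?_ (by omega)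
  rintro s₄ ⟨⟨F₁, hF₁, hsub₁, hcard₁, p, hp, hpath, hsupp, hedge, hnew, hroot⟩, hfr₄⟩
  refine Run.seq (T₁ := 2) (Q := fun s₅ => Collected L F₁ s₅ ∧ SearchTree L G t src s₅ ∧
    s₅.reg 21 = b ∧ s₅.reg 20 = C.card + 1 ∧ s₅.arr 2 = s.arr 2 ∧ s₅.arr 5 = s.arr 5)
    (Run.of_loopFree rfl ?_ (by decide)) ?_
    (T₂ := s.arr 2 b * 23 + 3) (by omega)
  · have h19' : s₄.reg 19 = b := (hfr₄.reg rfl).trans h19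
    exact ⟨hF₁.congr (by simp [Program.effect]) rfl rfl,
      hS₃.congr (hfr₄.arr rfl) (hfr₄.arr rfl) (hfr₄.arr rfl) (hfr₄.arr rfl),
      by simpa [Program.effect, Expr.eval] using h19',
      by simpa [Program.effect] using (hfr₄.reg (x := 20) rfl).trans h20₃,
      (hfr₄.arr rfl).trans hD, (hfr₄.arr rfl).trans hB⟩
  rintro s₅ ⟨hF₅, hS₅, h21₅, h20₅, hD₅, hB₅⟩
  refine (addPath_spec hL hw _ hS₅ hF₅ hTb hdB (by omega) h21₅).with_frame.mono le_rfl ?_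
  rintro s' ⟨⟨F₂, hF₂', hsub₂, hcard₂, q, hq, hpath', hsupp', hedge', hnew', hroot'⟩, hfr'⟩
  rw [hB] at hsupp hroot
  rw [hB₅] at hsupp' hroot'
  have hD' : s'.arr 2 = s.arr 2 := (hfr'.arr rfl).trans hD₅
  have hB' : s'.arr 5 = s.arr 5 := (hfr'.arr rfl).trans hB₅
  have hFF : F ⊆ F₂ := (Finset.subset_insert _ _).trans (hsub₁.trans hsub₂)
  have hjF : (⟨j, hj⟩ : Fin L.length) ∈ F₂ := hsub₂ (hsub₁ (Finset.mem_insert_self _ _))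
  have has : a ≠ src := by
    rintro h'
    rw [h', SimpleGraph.edist_self] at hdA
    exact ha0 (by rw [h']; exact_mod_cast hdA.symm)
  have hbs : b ≠ src := by
    rintro h'
    rw [h', SimpleGraph.edist_self] at hdB
    exact hb0 (by rw [h']; exact_mod_cast hdB.symm)
  have hcirc := isCircuit_of_branches hpath hpath' hadj (f := fun z => s.arr 5 z) hne has hbs
    hsupp hsupp'
  set W := p.reverse.append (.cons hadj q) with hW
  have hWe : ∀ e, e ∈ W.edges ↔ e ∈ p.edges ∨ e = s(a, b) ∨ e ∈ q.edges := by
    intro e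
    simp [hW]
  have hWF : ∀ e ∈ W.edges, e ∈ edgesOf L F₂ := by
    intro e he
    rcases (hWe e).mp he with h1 | rfl | h1
    · exact edgesOf_subset hsub₂ (hedge e h1)
    · exact hea ▸ edgeAt_mem_edgesOf hjF
    · exact hedge' e h1
  have hbrA : BranchIn L src s F₂ a := by
    obtain ⟨y, h1, h2⟩ := hroot has
    exact ⟨y, h1, edgesOf_subset hsub₂ h2⟩
  have hbrB : BranchIn L src s F₂ b := hroot' hbs
  refine ⟨F₂, insert ⟨j, hj⟩ C, hF₂', h.subset.trans hFF, ?_, ?_, ?_, ?_, by rw [hcardC]; omega, ?_, ?_,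
    ?_⟩
  · have h1 := Finset.card_insert_le (⟨j, hj⟩ : Fin L.length) F
    have h2 := h.card_le
    rw [hcardC, add_mul, one_mul]
    omega
  · intro e he
    obtain ⟨i, hi, rfl⟩ := mem_edgesOf.mp he
    by_cases hiF : i ∈ F
    · obtain ⟨v, c, h1, h2, h3, h4⟩ := h.covered _ (edgeAt_mem_edgesOf hiF)
      exact ⟨v, c, h1, h2, h3, fun e' he' => edgesOf_subset hFF (h4 e' he')⟩
    · refine ⟨src, W, hcirc, ?_, (hWe _).mpr ?_, hWF⟩
      · simp only [hW, SimpleGraph.Walk.length_append, SimpleGraph.Walk.length_reverse,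
          SimpleGraph.Walk.length_cons, hp, hq]
        omega
      · by_cases hi1 : i ∈ F₁
        · by_cases hij : i = ⟨j, hj⟩
          · exact .inr (.inl (by rw [hij, hea]))
          · exact .inl (hnew i hi1 (by simp [hij, hiF]))
        · exact .inr (.inr (hnew' i hi hi1))
  · exact Finset.insert_subset hjF (h.selected_subset.trans hFF)
  · rw [hcardC]
    exact (hfr'.reg rfl).trans h20₅
  · intro i hi
    rcases Finset.mem_insert.mp hi with rfl | hi
    · exact Nat.lt_succ_self _
    · exact (h.lt i hi).trans (Nat.lt_succ_self _)
  · intro i hi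
    rcases Finset.mem_insert.mp hi with rfl | hi
    · exact Bridge.congr (s := s) hbr hD' hB'
    · exact (h.bridge i hi).congr hD' hB'
  · intro hC i hi hij hbri
    rcases Nat.lt_succ_iff_lt_or_eq.mp hij with hij | rfl
    · have := h.complete (by omega) i hi hij (hbri.congr hD'.symm hB'.symm)
      exact ⟨(this.1.mono hFF).congr hB', (this.2.mono hFF).congr hB'⟩
    · exact ⟨hbrA.congr hB', hbrB.congr hB'⟩


/-- Edges between different branches of a search tree are not tree edges, so that they can be
removed together if all of them lie on short circuits through the root. -/
theorem isRemovable_of_bridge (hL : IsEdgeList G L) (hS : SearchTree L G t src s)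
    {C : Finset (Fin L.length)}
    (hC : ∀ i ∈ C, Bridge t s L[(i : ℕ)].1 L[(i : ℕ)].2) :
    IsRemovable t G (edgesOf L C : Set (Sym2 (Fin n))) := by
  classical
  have hbr : ∀ x y, s(x, y) ∈ edgesOf L C →
      Bridge t s x y ∧ Touched L src x ∧ Touched L src y := by
    intro x y hxy
    obtain ⟨i, hi, he⟩ := mem_edgesOf.mp hxy
    refine ⟨?_, touched_of_edgeAt_eq he⟩
    rcases Sym2.eq_iff.mp he with ⟨rfl, rfl⟩ | ⟨rfl, rfl⟩
    exacts [hC i hi, (hC i hi).symm]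
  obtain ⟨par₀, hpar₀⟩ := SimpleGraph.exists_isParent G src
  -- Inside the search tree the parents are those in the memory.
  have hpar : ∀ x, ∃ y, x ≠ src → G.edist x src ≠ ⊤ → (G.Adj x y ∧
      G.edist x src = G.edist y src + 1) ∧ s(x, y) ∉ edgesOf L C := by
    intro x
    by_cases hx : x ≠ src ∧ G.edist x src ≠ ⊤
    swap
    · exact ⟨x, fun h1 h2 => absurd ⟨h1, h2⟩ hx⟩
    obtain ⟨hadj₀, hdist₀⟩ := hpar₀ x hx.1 hx.2
    have hTx : Touched L src x := by
      obtain ⟨i, hi⟩ := hL.mem_edgeSet_iff.mp (show s(x, par₀ x) ∈ G.edgeSet from hadj₀)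
      exact (touched_of_edgeAt_eq hi).1
    obtain ⟨m, hm⟩ := ENat.ne_top_iff_exists.mp hx.2
    rw [SimpleGraph.edist_comm] at hm
    by_cases hmt : m ≤ t
    · have hm0 : m ≠ 0 := by
        rintro rfl
        exact hx.1 (SimpleGraph.edist_eq_zero_iff.mp hm.symm).symm
      obtain ⟨d, rfl⟩ := Nat.exists_eq_succ_of_ne_zero hm0
      obtain ⟨i, y, -, -, he, hadj, hTy, hdy, h5⟩ := hS.exists_parent hL hTx hm.symm hmt
      refine ⟨y, fun _ _ => ⟨⟨hadj, ?_⟩, fun hmem => ?_⟩⟩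
      · rw [SimpleGraph.edist_comm, ← hm, SimpleGraph.edist_comm, hdy]
        push_cast
        rfl
      · obtain ⟨⟨-, hy0, -, hne⟩, -, -⟩ := hbr x y hmem
        have hys : y ≠ src := by
          rintro rfl
          exact hy0 (hS.arr_eq hTy SimpleGraph.edist_self (Nat.zero_le _))
        rw [if_neg hys] at h5
        exact hne h5
    · refine ⟨par₀ x, fun _ _ => ⟨⟨hadj₀, hdist₀⟩, fun hmem => ?_⟩⟩
      obtain ⟨⟨-, h0, hsum, -⟩, -, -⟩ := hbr x _ hmem
      have := hS.edist_eq hTx (by omega)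
      rw [this] at hm
      have : m = s.arr 2 x := by exact_mod_cast hm
      omega
  choose par hpar using hpar
  refine SimpleGraph.IsParent.isRemovable (w := src) (par := par)
    (fun x h1 h2 => (hpar x h1 h2).1) ?_ (fun x h1 h2 h3 => (hpar x h1 h2).2 h3) ?_
  · intro e he
    obtain ⟨i, -, rfl⟩ := mem_edgesOf.mp he
    exact hL.mem_edgeSet_iff.mpr ⟨i, rfl⟩
  · intro x y hxy
    obtain ⟨⟨h1, h2, hsum, -⟩, hTx, hTy⟩ := hbr x y hxy
    rw [SimpleGraph.edist_comm, hS.edist_eq hTx (by omega), SimpleGraph.edist_comm,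
      hS.edist_eq hTy (by omega)]
    exact_mod_cast (by omega : s.arr 2 x + s.arr 2 y ≤ t + 1)

/-- A closed walk that leaves the root into the branch of `y` and returns on another edge contains
an edge from this branch to another one. -/
theorem SearchTree.exists_bridge (hS : SearchTree L G t src s) (hL : IsEdgeList G L) {y x : Fin n}
    (q : G.Walk x src) {c : ℕ} (hx : x ≠ src) (hc : G.edist src x ≤ c) (h5 : s.arr 5 x = y)
    (hq : q.length + c ≤ t + 2) (ht : 0 < t) (he : s(y, src) ∉ q.edges) :
    ∃ u u', G.Adj u u' ∧ Bridge t s u u' ∧ s.arr 5 u = y := by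
  induction q generalizing c with
  | nil => exact absurd rfl hx
  | @cons x x' src h q ih =>
    rw [SimpleGraph.Walk.edges_cons, List.mem_cons, not_or] at he
    rw [SimpleGraph.Walk.length_cons] at hq
    obtain ⟨i, hi⟩ := hL.mem_edgeSet_iff.mp (show s(x, x') ∈ G.edgeSet from h)
    obtain ⟨hTx, hTx'⟩ := touched_of_edgeAt_eq (src := src) hi
    by_cases hx' : x' = src
    · -- An edge to the root is a tree edge.
      subst hx'
      have hd : G.edist x' x = (0 + 1 : ℕ) := by
        simpa using SimpleGraph.edist_eq_one_iff_adj.mpr h.symm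
      obtain ⟨-, z, -, -, -, -, -, hz, h5'⟩ := hS.exists_parent hL hTx hd (by omega)
      have hz' : x' = z := SimpleGraph.edist_eq_zero_iff.mp (by rw [hz]; rfl)
      rw [if_pos hz'.symm, h5] at h5'
      exact absurd (by rw [Fin.ext h5']) he.1
    have hpos : ∀ z, z ≠ src → ∀ m : ℕ, G.edist src z = m → m ≠ 0 := by
      rintro z hz m hm rfl
      exact hz (SimpleGraph.edist_eq_zero_iff.mp hm).symm
    by_cases hbr : s.arr 5 x' = y
    · exact ih hS hx' (SimpleGraph.edist_le_add_of_le hc h.edist_le_one) hbr (by omega) he.2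
    · obtain ⟨d, hd, hd'⟩ := SimpleGraph.exists_edist_eq_of_le hc
      obtain ⟨d', hd1, hd1'⟩ := SimpleGraph.exists_edist_eq_of_le
        ((SimpleGraph.edist_comm (G := G)).trans_le q.edist_le)
      have h1 := hpos x hx d hd
      have h2 := hpos x' hx' d' hd1
      refine ⟨x, x', h, ⟨?_, ?_, ?_, ?_⟩, h5⟩
      · rwa [hS.arr_eq hTx hd (by omega)]
      · rwa [hS.arr_eq hTx' hd1 (by omega)]
      · rw [hS.arr_eq hTx hd (by omega), hS.arr_eq hTx' hd1 (by omega)]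
        omega
      · rw [h5]
        exact Ne.symm hbr

/-- A bound for the running time of `collect`. -/
def collectTime (m t : ℕ) : ℕ := 2 + (m * (selectTime t + 8) + 6)

theorem collect_spec (hL : IsEdgeList G L) (hw : WordBound w t k L) (hs : HasInput t k L s)
    (hS : SearchTree L G t src s) (ht : 0 < t) {F₀ : Finset (Fin L.length)}
    (hF₀ : Collected L F₀ s) (hcov : G.CoveredByShortCircuits t (edgesOf L F₀)) :
    Run w collect s (collectTime L.length t) fun s' => ∃ F, Collected L F s' ∧ F₀ ⊆ F ∧
      F.card ≤ F₀.card + k * (t + 2) ∧ G.CoveredByShortCircuits t (edgesOf L F) ∧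
      ((∃ C ⊆ F, C.card = k ∧ IsRemovable t G (edgesOf L C : Set (Sym2 (Fin n)))) ∨
        ∀ (y : Fin n) (q : G.Walk y src), G.Adj y src → q.length ≤ t + 1 →
          s(y, src) ∉ q.edges → s(y, src) ∈ edgesOf L F) := by
  have hw' := hw
  unfold WordBound at hw'
  refine Run.seq (T₁ := 2) (Q := fun s₁ => s₁ = s.setReg 20 0)
    (Run.of_loopFree rfl (by simp [Program.effect, Expr.eval]) (by decide)) ?_ le_rfl
  rintro s₁ rfl
  have hs₁ : HasInput t k L (s.setReg 20 0) :=
    ⟨hs.1, hs.2, hs.3, hs.4, hs.5, hs.6, hs.7, hs.8⟩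
  have hS₁ : SearchTree L G t src (s.setReg 20 0) := hS.congr rfl rfl rfl rfl
  refine (Run.forLoop (N := L.length) (B := selectTime t)
    (Inv := fun j s' => ∃ F C, Selection L G t k src F₀ F C j s') hs₁.reg_one rfl rfl (by decide)
    (by omega) ⟨F₀, ∅, hF₀.congr (by simp) rfl rfl, subset_rfl, by simp, hcov, by simp, by simp,
      by simp, by simp, by simp, fun _ i h h' => absurd h' (by omega)⟩ ?_ le_rfl).with_frame.mono
    le_rfl ?_
  · rintro j hj s' ⟨F, C, h⟩ h17 hfr
    refine (selectEdge_spec hL hw (hs₁.frame hfr rfl)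
      (hS₁.congr (hfr.arr rfl) (hfr.arr rfl) (hfr.arr rfl) (hfr.arr rfl)) hj h17 h).mono le_rfl ?_
    rintro s'' ⟨F', C', h'⟩
    exact ⟨F', C', h'.collected.congr (by simp) rfl rfl, h'.subset, h'.card_le, h'.covered,
      h'.selected_subset, by simpa using h'.count, h'.count_le, h'.lt, h'.bridge, h'.complete⟩
  · rintro s' ⟨⟨F, C, h⟩, hfr⟩
    have hS' : SearchTree L G t src s' :=
      hS₁.congr (hfr.arr rfl) (hfr.arr rfl) (hfr.arr rfl) (hfr.arr rfl)
    refine ⟨F, h.collected, h.subset, h.card_le.trans (Nat.add_le_add_left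
      (Nat.mul_le_mul_right _ h.count_le) _), h.covered, ?_⟩
    rcases h.count_le.eq_or_lt with hk | hk
    · exact .inl ⟨C, h.selected_subset, hk, isRemovable_of_bridge hL hS' h.bridge⟩
    · refine .inr fun y q hy hq hyq => ?_
      have hd : G.edist src y = (0 + 1 : ℕ) := by
        simpa using SimpleGraph.edist_eq_one_iff_adj.mpr hy.symm
      obtain ⟨i, hi⟩ := hL.mem_edgeSet_iff.mp (show s(y, src) ∈ G.edgeSet from hy)
      obtain ⟨-, z, -, -, -, -, -, hz, h5⟩ :=
        hS'.exists_parent hL (touched_of_edgeAt_eq (src := src) hi).1 hd (by omega)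
      have hz' : src = z := SimpleGraph.edist_eq_zero_iff.mp (by rw [hz]; rfl)
      rw [if_pos hz'.symm] at h5
      obtain ⟨u, u', huu, hbr, hu5⟩ := hS'.exists_bridge hL q hy.ne hd.le h5 (by omega) ht hyq
      obtain ⟨j, hj⟩ := hL.mem_edgeSet_iff.mp (show s(u, u') ∈ G.edgeSet from huu)
      have hB : BranchIn L src s' F u := by
        rcases Sym2.eq_iff.mp hj with ⟨rfl, rfl⟩ | ⟨rfl, rfl⟩
        · exact (h.complete hk j j.2 j.2 hbr).1
        · exact (h.complete hk j j.2 j.2 hbr.symm).2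
      obtain ⟨y', h1, h2⟩ := hB
      rw [hu5] at h1
      rwa [Fin.ext h1]

end WordRAM

/-! ### Testing all small sets of collected edges -/

namespace WordRAM

open SpannerProblem

/-- Mark the edges of the tuple in array 8, whose entries are positions in the collection, and write
their ends into array 9. Register 23 tells whether the edges are distinct. -/
def markTuple : Program :=
  .seq (.assign 23 (.const 1))
    (.forLoop 24 3
      (.seq (.assign 25 (.get 6 (.get 8 (.reg 24))))
        (.seq (.cond (.get 1 (.reg 25)) (.assign 23 (.const 0)) (.store 1 (.reg 25) (.const 1)))
          (.seq (.store 9 (.op .mul (.const 2) (.reg 24)) (fstEnd (.reg 25)))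
            (.store 9 (.op .add (.op .mul (.const 2) (.reg 24)) (.const 1)) (sndEnd (.reg 25)))))))

/-- Remove the marks of the edges of the tuple. -/
def unmarkTuple : Program :=
  .forLoop 24 3 (.store 1 (.get 6 (.get 8 (.reg 24))) (.const 0))

/-- Copy the distances of the vertices in array 9 into array 10. -/
def copyDistances : Program :=
  .forLoop 27 7 (.store 10 (.reg 27) (.get 2 (.get 9 (.reg 27))))

/-- Compare the distances of the vertices in array 9 with those in array 10. -/
def compareDistances : Program :=
  .forLoop 27 7
    (.cond (.op .lt (.op .add (.get 10 (.reg 27)) (.reg 2)) (.get 2 (.get 9 (.reg 27))))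
      (.assign 23 (.const 0)) .skip)

/-- Clear register 23 if the deletion of the marked edges increases the distance between two of
their ends by more than `t`. -/
def testMarked : Program :=
  .forLoop 26 7
    (.seq (.seq (.assign 10 (.get 9 (.reg 26))) (.seq (.assign 11 (.const 0)) (.assign 12 (.reg 0))))
      (.seq bfs (.seq copyDistances (.seq (.assign 11 (.const 1)) (.seq bfs compareDistances)))))

/-- Replace the tuple in array 8 by the next one, or clear register 22 if it is the last one. The
tuples are ordered like the numbers whose digits, least significant first, are their entries. -/
def nextTuple : Program :=
  .seq (.assign 24 (.const 0))
    (.seq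
      (.loop (.op .mul (.op .lt (.reg 24) (.reg 3))
          (.op .eq (.op .add (.get 8 (.reg 24)) (.const 1)) (.reg 5)))
        (.seq (.store 8 (.reg 24) (.const 0)) (.assign 24 (.op .add (.reg 24) (.const 1)))))
      (.cond (.op .lt (.reg 24) (.reg 3))
        (.store 8 (.reg 24) (.op .add (.get 8 (.reg 24)) (.const 1))) (.assign 22 (.const 0))))

/-- Test one tuple. If it is a solution, then its marks are kept and register 6 is set. -/
def tryTuple : Program :=
  .seq markTuple
    (.seq (.cond (.reg 23) testMarked .skip)
      (.cond (.reg 23) (.seq (.assign 6 (.const 1)) (.assign 22 (.const 0)))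
        (.seq unmarkTuple nextTuple)))

/-- Search for a solution among the `k`-tuples of collected edges. -/
def search : Program :=
  .seq (.seq (.assign 22 (.const 1)) (.forLoop 24 3 (.store 8 (.reg 24) (.const 0))))
    (.loop (.reg 22) tryTuple)

variable {n t k w : ℕ} {L : List (Fin n × Fin n)} {s s' : State} {G : SimpleGraph (Fin n)}
  {F C : Finset (Fin L.length)}

/-- The edges with the numbers in `C` are marked in array 1. -/
def Marked (L : List (Fin n × Fin n)) (C : Finset (Fin L.length)) (s : State) : Prop :=
  ∀ i : Fin L.length, s.arr 1 i = if i ∈ C then 1 else 0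

/-- The ends of the edges of the tuple `f`, in a row. -/
def endAt (L : List (Fin n × Fin n)) (f : ℕ → Fin L.length) (j : ℕ) : Fin n :=
  if j % 2 = 0 then L[(f (j / 2) : ℕ)].1 else L[(f (j / 2) : ℕ)].2

theorem touched_endAt {src : Fin n} (f : ℕ → Fin L.length) (j : ℕ) :
    Touched L src (endAt L f j) := by
  unfold endAt
  split_ifs
  exacts [.inr ⟨_, (f (j / 2)).2, .inl rfl⟩, .inr ⟨_, (f (j / 2)).2, .inr rfl⟩]

/-- The array 8 contains the tuple `f` of edges. -/
def HasTuple (L : List (Fin n × Fin n)) (k : ℕ) (f : ℕ → Fin L.length) (s : State) : Prop :=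
  ∀ p < k, s.arr 6 (s.arr 8 p) = f p

theorem markTuple_spec {f : ℕ → Fin L.length} (hw : WordBound w t k L) (hs : HasInput t k L s)
    (hf : HasTuple L k f s) (hM : Marked L ∅ s) :
    Run w markTuple s (8 + k * 60) fun s' =>
      (s'.reg 23 ≠ 0 ↔ Set.InjOn f (Set.Iio k)) ∧ Marked L ((Finset.range k).image f) s' ∧
        ∀ j < 2 * k, s'.arr 9 j = endAt L f j := by
  have hw' := hw
  unfold WordBound at hw'
  have hmod1 : 1 % 2 ^ w = 1 := Nat.mod_eq_of_lt (by omega)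
  have hmod2 : 2 % 2 ^ w = 2 := Nat.mod_eq_of_lt (by omega)
  refine Run.seq (T₁ := 2) (T₂ := 6 + k * 60) (Q := fun s₁ => s₁ = s.setReg 23 1)
    (Run.of_loopFree rfl (by simp [Program.effect, Expr.eval, hmod1]) (by decide)) ?_ (by omega)
  rintro s₁ rfl
  have hs₁ : HasInput t k L (s.setReg 23 1) :=
    ⟨hs.1, hs.2, hs.3, hs.4, hs.5, hs.6, hs.7, hs.8⟩
  refine Run.forLoop (N := k) (B := 50) (Inv := fun p s' =>
    (s'.reg 23 ≠ 0 ↔ Set.InjOn f (Set.Iio p)) ∧ Marked L ((Finset.range p).image f) s' ∧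
        ∀ j < 2 * p, s'.arr 9 j = endAt L f j) hs₁.reg_three rfl rfl (by decide) (by omega)
    ⟨by simp, fun i => by simpa using hM i, fun j hj => absurd hj (by omega)⟩ ?_ (by omega)
  rintro p hp s₂ ⟨hI, hM₂, hE⟩ h24 hfr
  have hs₂ := hs₁.frame hfr rfl
  refine Run.of_loopFree rfl ?_ (by decide)
  have hfp : s₂.arr 6 (s₂.arr 8 p) = f p := by
    rw [hfr.arr rfl, hfr.arr rfl]
    exact hf p hp
  have hinj : Set.InjOn f (Set.Iio (p + 1)) ↔
      Set.InjOn f (Set.Iio p) ∧ f p ∉ (Finset.range p).image f := by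
    rw [← Order.succ_eq_add_one, Order.Iio_succ_eq_insert, Set.injOn_insert (by simp)]
    simp
  set s₃ := s₂.setReg 25 (f p) with hs₃
  -- The effect of the test for repetitions.
  set s₄ := if s₂.arr 1 (f p) = 0 then s₃.setArr 1 (f p) 1 else s₃.setReg 23 0 with hs₄
  have hs₄in : HasInput t k L s₄ := by
    rw [hs₄]
    split_ifs
    exacts [⟨hs₂.1, hs₂.2, hs₂.3, hs₂.4, hs₂.5, hs₂.6, hs₂.7, hs₂.8⟩,
      ⟨hs₂.1, hs₂.2, hs₂.3, hs₂.4, hs₂.5, hs₂.6, hs₂.7, hs₂.8⟩]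
  have h24' : s₄.reg 24 = p := by
    rw [hs₄]
    split_ifs <;> simpa [hs₃] using h24
  have h25 : s₄.reg 25 = f p := by
    rw [hs₄]
    split_ifs <;> simp [hs₃]
  have h9 : s₄.arr 9 = s₂.arr 9 := by
    rw [hs₄]
    split_ifs <;> simp [hs₃]
  have h23 : s₄.reg 23 ≠ 0 ↔ Set.InjOn f (Set.Iio (p + 1)) := by
    have := hM₂ (f p)
    rw [hinj, ← hI, hs₄]
    by_cases hmem : f p ∈ (Finset.range p).image f
    · rw [if_pos hmem] at this
      simp [this, hmem]
    · rw [if_neg hmem] at this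
      rw [if_pos this]
      simp only [hmem, not_false_eq_true, and_true]
      rw [hs₃]
      simp
  have hM₄ : Marked L ((Finset.range (p + 1)).image f) s₄ := by
    intro i
    have h1 := hM₂ (f p)
    have h2 := hM₂ i
    rw [Finset.range_add_one, Finset.image_insert, hs₄]
    by_cases hmem : f p ∈ (Finset.range p).image f
    · rw [if_pos hmem] at h1
      rw [if_neg (by omega), Finset.insert_eq_of_mem hmem]
      exact h2
    · rw [if_neg hmem] at h1
      rw [if_pos h1]
      by_cases hi : i = f p
      · simp [hi]
      · have hv : (i : ℕ) ≠ f p := fun h => hi (Fin.ext h)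
        simpa [hs₃, hi, hv, Function.update_apply] using h2
  have e1 : Expr.eval w s₂ (.get 6 (.get 8 (.reg 24))) = f p := by simpa [Expr.eval, h24] using hfp
  have hcond : (Program.cond (.get 1 (.reg 25)) (.assign 23 (.const 0))
      (.store 1 (.reg 25) (.const 1))).effect w s₃ = s₄ := by
    have h25₃ : s₃.reg 25 = f p := by simp [hs₃]
    have h1₃ : s₃.arr 1 = s₂.arr 1 := rfl
    rw [hs₄]
    simp [Program.effect, Expr.eval, h25₃, h1₃, hmod1]
  have e2 : Expr.eval w s₄ (.op .mul (.const 2) (.reg 24)) = 2 * p := by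
    simp only [Expr.eval, BinOp.eval, h24', hmod2]
    exact Nat.mod_eq_of_lt (by omega)
  have e3 := hs₄in.eval_fstEnd hw (e := .reg 25) (f p).2 h25
  set s₅ := s₄.setArr 9 (2 * p) L[(f p : ℕ)].1 with hs₅
  have hs₅in : HasInput t k L s₅ := by
    refine ⟨hs₄in.1, hs₄in.2, hs₄in.3, hs₄in.4, hs₄in.5, hs₄in.6, fun i hi => ?_, fun i hi => ?_⟩
    exacts [hs₄in.7 i hi, hs₄in.8 i hi]
  have e4 : Expr.eval w s₅ (.op .add (.op .mul (.const 2) (.reg 24)) (.const 1)) = 2 * p + 1 := by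
    have h24₅ : s₅.reg 24 = p := h24'
    simp only [Expr.eval, BinOp.eval, h24₅, hmod2, hmod1]
    rw [Nat.mod_eq_of_lt (a := 2 * p) (by omega), Nat.mod_eq_of_lt (by omega)]
  have e5 := hs₅in.eval_sndEnd hw (e := .reg 25) (f p).2 h25
  rw [Program.effect, Program.effect, e1, ← hs₃, Program.effect, hcond, Program.effect,
    Program.effect, Program.effect, e2, e3, ← hs₅, e4, e5]
  refine ⟨h23, hM₄, fun j hj => ?_⟩
  rw [State.arr_setReg, State.arr_setArr, if_pos rfl, hs₅, State.arr_setArr, if_pos rfl, h9]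
  by_cases h1 : j = 2 * p + 1
  · have h2 : j % 2 ≠ 0 := by omega
    have h3 : j / 2 = p := by omega
    rw [h1, Function.update_self, ← h1, endAt, if_neg h2]
    simp only [h3]
  · rw [Function.update_of_ne h1]
    by_cases h2 : j = 2 * p
    · have h4 : j % 2 = 0 := by omega
      have h3 : j / 2 = p := by omega
      rw [h2, Function.update_self, ← h2, endAt, if_pos h4]
      simp only [h3]
    · rw [Function.update_of_ne h2]
      exact hE j (by omega)

theorem unmarkTuple_spec {f : ℕ → Fin L.length} (hw : WordBound w t k L) (hs : HasInput t k L s)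
    (hf : HasTuple L k f s) (hM : Marked L ((Finset.range k).image f) s) :
    Run w unmarkTuple s (6 + k * 20) fun s' => Marked L ∅ s' := by
  have hw' := hw
  unfold WordBound at hw'
  refine (Run.forLoop (N := k) (B := 10) (Inv := fun p s' => ∀ i : Fin L.length,
    s'.arr 1 i = if i ∈ (Finset.range k).image f ∧ ∀ a < p, f a ≠ i then 1 else 0)
    hs.reg_three rfl rfl (by decide) (by omega) (fun i => ?_) ?_ (by omega)).mono le_rfl
    fun s' h i => ?_
  · rw [State.arr_setReg, hM i]
    simp
  · rintro p hp s₁ h h24 hfr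
    refine Run.of_loopFree rfl (fun i => ?_) (by decide)
    have hfp : s₁.arr 6 (s₁.arr 8 p) = f p := by
      rw [hfr.arr rfl, hfr.arr rfl]
      exact hf p hp
    have heff : (Program.store 1 (.get 6 (.get 8 (.reg 24))) (.const 0)).effect w s₁ =
        s₁.setArr 1 (f p) 0 := by
      simp [Program.effect, Expr.eval, h24, hfp]
    rw [heff, State.arr_setReg, State.arr_setArr, if_pos rfl]
    by_cases hi : i = f p
    · rw [if_neg (fun h' => h'.2 p (Nat.lt_succ_self p) hi.symm), hi, Function.update_self]
    · rw [Function.update_of_ne (fun h' => hi (Fin.ext h')), h i]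
      refine if_congr (and_congr_right fun _ => ⟨fun h' a ha => ?_, fun h' a ha => h' a (by omega)⟩)
        rfl rfl
      rcases Nat.lt_succ_iff_lt_or_eq.mp ha with ha | rfl
      exacts [h' a ha, Ne.symm hi]
  · rw [h i, if_neg, if_neg (Finset.notMem_empty _)]
    rintro ⟨h1, h2⟩
    obtain ⟨a, ha, h3⟩ := Finset.mem_image.mp h1
    exact h2 a (Finset.mem_range.mp ha) h3

theorem bfs_spec_marked (hL : IsEdgeList G L) (hw : WordBound w t k L) (hs : HasInput t k L s)
    {src : Fin n} (hsrc : s.reg 10 = src) {R : ℕ} (h12 : s.reg 12 = R) (hR : R < n + t)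
    (h11 : s.reg 11 = 1) (hM : Marked L C s) :
    Run w bfs s (bfsTime L.length R) fun s' => ∀ x, Touched L src x →
      s'.arr 2 x = layer (G.deleteEdges (edgesOf L C : Set (Sym2 (Fin n)))) src (n + t) R x := by
  have hw' := hw
  unfold WordBound at hw'
  refine (bfs_spec (U := fun i => s.arr 1 i = 0)
    (H := G.deleteEdges (edgesOf L C : Set (Sym2 (Fin n)))) hs hw hsrc h12 hR (fun i hi => ?_)
    fun x y => ?_).mono le_rfl fun s' h x hx => (h x hx).1
  · have := hM ⟨i, hi⟩
    simp only at this
    rw [h11, one_mul, this]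
    split_ifs
    · rw [Nat.mod_eq_of_lt (by omega)]
      simp
    · simp
  · rw [SimpleGraph.deleteEdges_adj, ← SimpleGraph.mem_edgeSet, hL.mem_edgeSet_iff]
    constructor
    · rintro ⟨⟨i, hi⟩, h⟩
      refine ⟨i, i.2, ?_, hi⟩
      rw [hM i, if_neg]
      exact fun h' => h (hi ▸ edgeAt_mem_edgesOf h')
    · rintro ⟨i, hi, h, he⟩
      refine ⟨⟨⟨i, hi⟩, he⟩, fun h' => ?_⟩
      obtain ⟨j, hj, hj'⟩ := mem_edgesOf.mp h'
      have hij : j = ⟨i, hi⟩ := hL.edgeAt_injective (hj'.trans he.symm)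
      have := hM j
      rw [if_pos hj, hij] at this
      exact one_ne_zero (this.symm.trans h)

theorem bfs_spec_whole (hL : IsEdgeList G L) (hw : WordBound w t k L) (hs : HasInput t k L s)
    {src : Fin n} (hsrc : s.reg 10 = src) {R : ℕ} (h12 : s.reg 12 = R) (hR : R < n + t)
    (h11 : s.reg 11 = 0) :
    Run w bfs s (bfsTime L.length R) fun s' => ∀ x, Touched L src x →
      s'.arr 2 x = layer G src (n + t) R x ∧
        (x ≠ src → G.edist src x ≤ R → TreeAt L G src s' x) := by
  refine bfs_spec (U := fun _ => True) hs hw hsrc h12 hR (fun i hi => by simp [h11]) fun x y => ?_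
  rw [← SimpleGraph.mem_edgeSet, hL.mem_edgeSet_iff]
  exact ⟨fun ⟨i, hi⟩ => ⟨i, i.2, trivial, hi⟩, fun ⟨i, hi, _, h⟩ => ⟨⟨i, hi⟩, h⟩⟩

theorem exists_edist_eq_lt_card {H : SimpleGraph (Fin n)} {u v : Fin n} (h : H.edist u v ≠ ⊤) :
    ∃ d < n, H.edist u v = d := by
  classical
  obtain ⟨p, hp⟩ := SimpleGraph.exists_walk_of_edist_ne_top h
  obtain ⟨d, hd, hd'⟩ := SimpleGraph.exists_edist_eq_of_le p.bypass.edist_le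
  have := p.bypass_isPath.length_lt
  rw [Fintype.card_fin] at this
  exact ⟨d, by omega, hd⟩

/-- The comparison of the computed distances, where `n + t` stands for infinity. -/
theorem layer_le_layer_add_iff {H : SimpleGraph (Fin n)} {u v : Fin n} :
    layer H u (n + t) n v ≤ layer G u (n + t) n v + t ↔ H.edist u v ≤ G.edist u v + t := by
  by_cases hG : G.edist u v = ⊤
  · rw [layer_of_not_le (H := G) (by rw [hG]; simp), hG]
    simp only [top_add, le_top, iff_true]
    exact (layer_le (by omega) v).trans (by omega)
  obtain ⟨d, hd, hGd⟩ := exists_edist_eq_lt_card hG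
  rw [layer_of_eq hGd hd.le, hGd]
  by_cases hH : H.edist u v = ⊤
  · rw [layer_of_not_le (by rw [hH]; simp), hH]
    refine iff_of_false (by omega) ?_
    rw [top_le_iff]
    exact_mod_cast ENat.natCast_ne_top (d + t)
  obtain ⟨d', hd', hHd⟩ := exists_edist_eq_lt_card hH
  rw [layer_of_eq hHd hd'.le, hHd]
  norm_cast

theorem mem_edgesOf_image_iff {f : ℕ → Fin L.length} {a : Fin n} :
    (∃ e ∈ edgesOf L ((Finset.range k).image f), a ∈ e) ↔ ∃ j < 2 * k, endAt L f j = a := by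
  constructor
  · rintro ⟨e, he, ha⟩
    obtain ⟨i, hi, rfl⟩ := mem_edgesOf.mp he
    obtain ⟨p, hp, rfl⟩ := Finset.mem_image.mp hi
    have hp := Finset.mem_range.mp hp
    rcases Sym2.mem_iff.mp ha with rfl | rfl
    · exact ⟨2 * p, by omega, by simp [endAt]⟩
    · refine ⟨2 * p + 1, by omega, ?_⟩
      have h1 : (2 * p + 1) % 2 ≠ 0 := by omega
      have h2 : (2 * p + 1) / 2 = p := by omega
      rw [endAt, if_neg h1]
      simp only [h2]
  · rintro ⟨j, hj, rfl⟩
    refine ⟨edgeAt L (f (j / 2)), edgeAt_mem_edgesOf (Finset.mem_image_of_mem _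
      (Finset.mem_range.mpr (by omega))), ?_⟩
    unfold endAt
    split_ifs
    exacts [Sym2.mem_mk_left _ _, Sym2.mem_mk_right _ _]

theorem isRemovable_iff_endAt (hL : IsEdgeList G L) (f : ℕ → Fin L.length) :
    IsRemovable t G (edgesOf L ((Finset.range k).image f) : Set (Sym2 (Fin n))) ↔
      ∀ i < 2 * k, ∀ j < 2 * k,
        layer (G.deleteEdges (edgesOf L ((Finset.range k).image f) : Set (Sym2 (Fin n))))
          (endAt L f i) (n + t) n (endAt L f j) ≤ layer G (endAt L f i) (n + t) n (endAt L f j) + t := by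
  constructor
  · exact fun h i _ j _ => layer_le_layer_add_iff.mpr (h.2.2 _ _)
  · refine fun h => SimpleGraph.isRemovable_of_endpoints ?_ fun a b ha hb => ?_
    · intro e he
      obtain ⟨i, -, rfl⟩ := mem_edgesOf.mp he
      exact hL.mem_edgeSet_iff.mpr ⟨i, rfl⟩
    · obtain ⟨i, hi, rfl⟩ := mem_edgesOf_image_iff.mp ha
      obtain ⟨j, hj, rfl⟩ := mem_edgesOf_image_iff.mp hb
      exact layer_le_layer_add_iff.mp (h i hi j hj)

/-- A bound for the running time of `testMarked`. -/
def testTime (n m k : ℕ) : ℕ := 2 * k * (2 * bfsTime m n + 2 * (2 * k * 30 + 6) + 30) + 6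

theorem testMarked_spec {f : ℕ → Fin L.length} (hL : IsEdgeList G L) (hw : WordBound w t k L)
    (hs : HasInput t k L s) (ht : 0 < t) (hM : Marked L ((Finset.range k).image f) s)
    (hE : ∀ j < 2 * k, s.arr 9 j = endAt L f j) (h23 : s.reg 23 ≠ 0) :
    Run w testMarked s (testTime n L.length k) fun s' => s'.reg 23 ≠ 0 ↔
      IsRemovable t G (edgesOf L ((Finset.range k).image f) : Set (Sym2 (Fin n))) := by
  have hw' := hw
  unfold WordBound at hw'
  rw [isRemovable_iff_endAt hL]
  set C := (Finset.range k).image f with hC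
  set H := G.deleteEdges (edgesOf L C : Set (Sym2 (Fin n))) with hH
  set K : State → Prop := fun s' => HasInput t k L s' ∧ Marked L C s' ∧
    ∀ j < 2 * k, s'.arr 9 j = endAt L f j with hK
  have hKf : ∀ (p : Program) {s' s''}, p.keepsInput = true → p.writesArr 1 = false →
      p.writesArr 9 = false → K s' → Frame p s' s'' → K s'' := fun p _ _ hp h1 h9 hs' hf =>
    ⟨hs'.1.frame hf hp, by unfold Marked; rw [hf.arr h1]; exact hs'.2.1,
      by rw [hf.arr h9]; exact hs'.2.2⟩
  have hKs : K s := ⟨hs, hM, hE⟩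
  refine Run.forLoop (N := 2 * k) (B := 2 * bfsTime L.length n + 2 * (2 * k * 30 + 6) + 22)
    (Inv := fun a s' => s'.reg 23 ≠ 0 ↔ ∀ i < a, ∀ j < 2 * k,
      layer H (endAt L f i) (n + t) n (endAt L f j) ≤
        layer G (endAt L f i) (n + t) n (endAt L f j) + t)
    hs.reg_seven rfl rfl (by decide) (by omega) (by simpa using h23) ?_ (by rw [testTime])
  intro a ha s₁ hI h26 hfr
  have hK₁ := hKf _ rfl rfl rfl hKs hfr
  set src := endAt L f a with hsrc
  have hn : 0 < n := src.pos
  -- The distances in the whole graph.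
  refine Run.seq (T₁ := 10) (Q := fun s₂ => K s₂ ∧ s₂.reg 23 = s₁.reg 23 ∧ s₂.reg 10 = src ∧
    s₂.reg 11 = 0 ∧ s₂.reg 12 = n)
    (T₂ := 2 * bfsTime L.length n + 2 * (2 * k * 30 + 6) + 12) ?_ ?_ (by omega)
  · refine (Run.of_loopFree (Q := fun s₂ => s₂.reg 10 = src ∧ s₂.reg 11 = 0 ∧ s₂.reg 12 = n) rfl ?_
      (by decide)).with_frame.mono le_rfl fun s₂ h => ⟨hKf _ rfl rfl rfl hK₁ h.2, h.2.reg rfl, h.1⟩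
    simp [Program.effect, Expr.eval, h26, hK₁.2.2 a ha, hK₁.1.reg_zero, hsrc]
  rintro s₂ ⟨hK₂, h23₂, h10₂, h11₂, h12₂⟩
  refine Run.seq (T₁ := bfsTime L.length n) (Q := fun s₃ => K s₃ ∧ s₃.reg 23 = s₁.reg 23 ∧
    s₃.reg 10 = src ∧ s₃.reg 12 = n ∧ ∀ x, Touched L src x → s₃.arr 2 x = layer G src (n + t) n x)
    (T₂ := bfsTime L.length n + 2 * (2 * k * 30 + 6) + 12) ?_ ?_ (by omega)
  · exact (bfs_spec_whole hL hw hK₂.1 h10₂ h12₂ (by omega) h11₂).with_frame.mono le_rfl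
      fun s₃ h => ⟨hKf _ rfl rfl rfl hK₂ h.2, (h.2.reg rfl).trans h23₂, (h.2.reg rfl).trans h10₂,
        (h.2.reg rfl).trans h12₂, fun x hx => (h.1 x hx).1⟩
  rintro s₃ ⟨hK₃, h23₃, h10₃, h12₃, hD⟩
  refine Run.seq (T₁ := 2 * k * 30 + 6) (Q := fun s₄ => K s₄ ∧ s₄.reg 23 = s₁.reg 23 ∧
    s₄.reg 10 = src ∧ s₄.reg 12 = n ∧
      ∀ j < 2 * k, s₄.arr 10 j = layer G src (n + t) n (endAt L f j))
    (T₂ := bfsTime L.length n + (2 * k * 30 + 6) + 12) ?_ ?_ (by omega)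
  · refine (Run.forLoop (N := 2 * k) (B := 20) (Inv := fun b s' => ∀ j < b,
      s'.arr 10 j = layer G src (n + t) n (endAt L f j)) hK₃.1.reg_seven rfl rfl (by decide)
      (by omega) (fun j hj => absurd hj (by omega)) ?_ (by omega)).with_frame.mono le_rfl
      fun s₄ h => ⟨hKf _ rfl rfl rfl hK₃ h.2, (h.2.reg rfl).trans h23₃, (h.2.reg rfl).trans h10₃,
        (h.2.reg rfl).trans h12₃, h.1⟩
    rintro b hb s' h h27 hfr'
    refine Run.of_loopFree rfl (fun j hj => ?_) (by decide)
    have h9 : s'.arr 9 b = endAt L f b := by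
      rw [hfr'.arr rfl]
      exact hK₃.2.2 b hb
    have h2 : s'.arr 2 (endAt L f b) = layer G src (n + t) n (endAt L f b) := by
      rw [hfr'.arr rfl]
      exact hD _ (touched_endAt f b)
    rcases Nat.lt_succ_iff_lt_or_eq.mp hj with hj | rfl
    · simpa [Program.effect, Expr.eval, h27, hj.ne] using h j hj
    · simp [Program.effect, Expr.eval, h27, h9, h2]
  rintro s₄ ⟨hK₄, h23₄, h10₄, h12₄, hD₄⟩
  -- The distances after the deletion of the marked edges.
  refine Run.seq (T₁ := 2) (Q := fun s₅ => s₅ = s₄.setReg 11 1)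
    (T₂ := bfsTime L.length n + (2 * k * 30 + 6) + 10) ?_ ?_ (by omega)
  · refine Run.of_loopFree rfl ?_ (by decide)
    rw [Program.effect, Expr.eval, Nat.mod_eq_of_lt (by omega)]
  rintro s₅ rfl
  have hK₅ : K (s₄.setReg 11 1) := ⟨⟨hK₄.1.1, hK₄.1.2, hK₄.1.3, hK₄.1.4, hK₄.1.5, hK₄.1.6,
    hK₄.1.7, hK₄.1.8⟩, hK₄.2⟩
  refine Run.seq (T₁ := bfsTime L.length n) (Q := fun s₆ => K s₆ ∧ s₆.reg 23 = s₁.reg 23 ∧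
    (∀ j < 2 * k, s₆.arr 10 j = layer G src (n + t) n (endAt L f j)) ∧
      ∀ x, Touched L src x → s₆.arr 2 x = layer H src (n + t) n x)
    (T₂ := 2 * k * 30 + 6) ?_ ?_ (by omega)
  · refine (bfs_spec_marked hL hw hK₅.1 (src := src) (by simpa using h10₄) (by simpa using h12₄)
      (by omega) (by simp) hK₅.2.1).with_frame.mono le_rfl fun s₆ h =>
        ⟨hKf _ rfl rfl rfl hK₅ h.2, (h.2.reg rfl).trans (by simpa using h23₄), ?_, h.1⟩
    rw [h.2.arr rfl]
    exact hD₄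
  rintro s₆ ⟨hK₆, h23₆, hD₆, hH₆⟩
  refine (Run.forLoop (N := 2 * k) (B := 20) (Inv := fun b s' => s'.reg 23 ≠ 0 ↔ s₁.reg 23 ≠ 0 ∧
    ∀ j < b, layer H src (n + t) n (endAt L f j) ≤ layer G src (n + t) n (endAt L f j) + t)
    hK₆.1.reg_seven rfl rfl (by decide) (by omega) (by simp [h23₆]) ?_ (by omega)).mono le_rfl ?_
  · rintro b hb s' h h27 hfr'
    refine Run.of_loopFree rfl ?_ (by decide)
    have h9 : s'.arr 9 b = endAt L f b := by
      rw [hfr'.arr rfl]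
      exact hK₆.2.2 b hb
    have h2 : s'.arr 2 (endAt L f b) = layer H src (n + t) n (endAt L f b) := by
      rw [hfr'.arr rfl]
      exact hH₆ _ (touched_endAt f b)
    have h10 : s'.arr 10 b = layer G src (n + t) n (endAt L f b) := by
      rw [hfr'.arr rfl]
      exact hD₆ b hb
    have h2' : s'.reg 2 = t := (hK₆.1.frame hfr' rfl).reg_two
    have hle : layer G src (n + t) n (endAt L f b) ≤ n + t := layer_le (by omega) _
    have hmod : (layer G src (n + t) n (endAt L f b) + t) % 2 ^ w =
        layer G src (n + t) n (endAt L f b) + t := Nat.mod_eq_of_lt (by omega)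
    have hsplit : (∀ j < b + 1, layer H src (n + t) n (endAt L f j) ≤
        layer G src (n + t) n (endAt L f j) + t) ↔
        (∀ j < b, layer H src (n + t) n (endAt L f j) ≤
          layer G src (n + t) n (endAt L f j) + t) ∧
        layer H src (n + t) n (endAt L f b) ≤ layer G src (n + t) n (endAt L f b) + t := by
      simp only [Nat.lt_succ_iff_lt_or_eq, or_imp, forall_and, forall_eq]
    rw [hsplit, ← and_assoc, ← h]
    by_cases hlt : layer G src (n + t) n (endAt L f b) + t < layer H src (n + t) n (endAt L f b)
    · have := not_le.mpr hlt
      simp [Program.effect, Expr.eval, BinOp.eval, h27, h9, h2, h10, h2', hmod, hlt]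
    · simp [Program.effect, Expr.eval, BinOp.eval, h27, h9, h2, h10, h2', hmod, hlt, not_lt.mp hlt]
  · intro s' h
    rw [State.reg_setReg, if_neg (by decide), h, hI]
    simp only [Nat.lt_succ_iff_lt_or_eq, or_imp, forall_and, forall_eq]
    exact Iff.rfl

/-- The array 8 contains the digits of `i` in base `q`, least significant first. -/
def HasDigits (q k i : ℕ) (s : State) : Prop :=
  ∀ p < k, s.arr 8 p = i / q ^ p % q

theorem nextTuple_spec (hw : WordBound w t k L) (hs : HasInput t k L s) {q i : ℕ}
    (hq : q ≤ L.length) (hq0 : 0 < q) (h5 : s.reg 5 = q) (hd : HasDigits q k i s)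
    (hi : i < q ^ k) :
    Run w nextTuple s (30 + k * 30) fun s' =>
      (i + 1 < q ^ k ∧ s'.reg 22 = s.reg 22 ∧ HasDigits q k (i + 1) s') ∨
        (i + 1 = q ^ k ∧ s'.reg 22 = 0) := by
  have hw' := hw
  unfold WordBound at hw'
  have hmod1 : 1 % 2 ^ w = 1 := Nat.mod_eq_of_lt (by omega)
  have hmod : ∀ x < q, (x + 1) % 2 ^ w = x + 1 := fun x hx => Nat.mod_eq_of_lt (by omega)
  refine Run.seq (T₁ := 2) (T₂ := 28 + k * 30) (Q := fun s₁ => s₁ = s.setReg 24 0)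
    (Run.of_loopFree rfl (by simp [Program.effect, Expr.eval]) (by decide)) ?_ (by omega)
  rintro s₁ rfl
  -- The first `p` digits are the largest possible ones.
  refine Run.seq (T₁ := 15 + k * 30) (T₂ := 13) (Q := fun s' => ∃ p ≤ k, s'.reg 24 = p ∧
    s'.reg 3 = k ∧ s'.reg 22 = s.reg 22 ∧ q ^ p ∣ i + 1 ∧ (∀ r < p, s'.arr 8 r = 0) ∧
      (∀ r, p ≤ r → r < k → s'.arr 8 r = i / q ^ r % q) ∧ (p < k → i / q ^ p % q + 1 ≠ q))
    ?_ ?_ (by omega)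
  · refine (Run.loop (s := s.setReg 24 0) (B := 8) (Inv := fun j s' => ∃ p, j + p = k ∧ s'.reg 24 = p ∧ s'.reg 3 = k ∧
      s'.reg 5 = q ∧ s'.reg 22 = s.reg 22 ∧ q ^ p ∣ i + 1 ∧ (∀ r < p, s'.arr 8 r = 0) ∧
      (∀ r, p ≤ r → r < k → s'.arr 8 r = i / q ^ r % q)) ?_ k
      ⟨0, rfl, by simp, by simpa using hs.reg_three, by simpa using h5, by simp, by simp, by simp,
        fun r _ hr => hd r hr⟩ (by simp only [Expr.cost]; omega)).mono le_rfl ?_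
    · rintro j s' ⟨p, hjp, h24, h3', h5', h22', hdvd, hz, hnz⟩ he
      have hpk : p < k := by
        by_contra hpk
        simp [Expr.eval, BinOp.eval, h24, h3', hpk] at he
      have hdig := hnz p le_rfl hpk
      have hlt : i / q ^ p % q < q := Nat.mod_lt _ hq0
      have hlast : i / q ^ p % q + 1 = q := by
        by_contra hne
        simp [Expr.eval, BinOp.eval, h24, h3', h5', hpk, hdig, hmod _ hlt, hmod1, hne] at he
      refine ⟨j - 1, by omega, Run.of_loopFree rfl ⟨p + 1, by omega, ?_⟩ (by decide)⟩
      have hp1 : (p + 1) % 2 ^ w = p + 1 := Nat.mod_eq_of_lt (by omega)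
      refine ⟨by simp [Program.effect, Expr.eval, BinOp.eval, h24, hmod1, hp1],
        by simpa [Program.effect] using h3', by simpa [Program.effect] using h5',
        by simpa [Program.effect] using h22', ?_, fun r hr => ?_, fun r hr hrk => ?_⟩
      · have h1 : (i + 1) / q ^ p = i / q ^ p + 1 := Nat.succ_div_of_dvd hdvd
        have h2 : q ∣ i / q ^ p + 1 := by
          have h4 := Nat.div_add_mod (i / q ^ p) q
          exact ⟨i / q ^ p / q + 1, by rw [mul_add, mul_one]; omega⟩
        rw [← Nat.div_mul_cancel hdvd, h1, pow_succ, mul_comm]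
        exact Nat.mul_dvd_mul h2 dvd_rfl
      · rcases Nat.lt_succ_iff_lt_or_eq.mp hr with hr | rfl
        · simpa [Program.effect, Expr.eval, h24, hr.ne] using hz r hr
        · simp [Program.effect, Expr.eval, h24]
      · have : r ≠ p := by omega
        simpa [Program.effect, Expr.eval, h24, this] using hnz r (by omega) hrk
    · rintro s' ⟨⟨j, p, hjp, h24, h3', h5', h22', hdvd, hz, hnz⟩, he⟩
      refine ⟨p, by omega, h24, h3', h22', hdvd, hz, hnz, fun hpk hlast => ?_⟩
      have hlt : i / q ^ p % q < q := Nat.mod_lt _ hq0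
      have hmodq : q % 2 ^ w = q := Nat.mod_eq_of_lt (by omega)
      simp [Expr.eval, BinOp.eval, h24, h3', h5', hpk, hnz p le_rfl hpk, hmod1, hlast, hmodq] at he
  rintro s₂ ⟨p, hpk, h24, h3', h22, hdvd, hz, hnz, hlast⟩
  refine Run.of_loopFree rfl ?_ (by decide)
  rcases hpk.eq_or_lt with rfl | hpk
  · right
    refine ⟨le_antisymm hi (Nat.le_of_dvd (by omega) hdvd), ?_⟩
    simp [Program.effect, Expr.eval, BinOp.eval, h24, h3']
  left
  have hlt : i / q ^ p % q < q := Nat.mod_lt _ hq0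
  have hndvd : ∀ r, p < r → ¬ q ^ r ∣ i + 1 := by
    intro r hr h
    have h1 : q ^ (p + 1) ∣ i + 1 := (pow_dvd_pow q hr).trans h
    have h2 : (i + 1) / q ^ p = i / q ^ p + 1 := Nat.succ_div_of_dvd hdvd
    have h3 : q ∣ i / q ^ p + 1 := by
      rw [← h2]
      exact Nat.dvd_div_of_mul_dvd (by rwa [← pow_succ])
    have h4 : (i / q ^ p % q + 1) % q = 0 := by
      rw [Nat.mod_add_mod]
      exact Nat.mod_eq_zero_of_dvd h3
    have h5 : i / q ^ p % q + 1 < q := lt_of_le_of_ne hlt (hlast hpk)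
    rw [Nat.mod_eq_of_lt h5] at h4
    omega
  have hmodp := hmod _ hlt
  have heff : (Program.cond (.op .lt (.reg 24) (.reg 3))
      (.store 8 (.reg 24) (.op .add (.get 8 (.reg 24)) (.const 1)))
      (.assign 22 (.const 0))).effect w s₂ = s₂.setArr 8 p (i / q ^ p % q + 1) := by
    simp [Program.effect, Expr.eval, BinOp.eval, h24, h3', hpk, hnz p le_rfl hpk, hmodp, hmod1]
  rw [heff]
  refine ⟨?_, h22, fun r hr => ?_⟩
  · refine lt_of_le_of_ne hi fun h => hndvd k hpk ?_
    rw [← h]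
  · rw [State.arr_setArr, if_pos rfl]
    rcases lt_trichotomy r p with h | rfl | h
    · rw [Function.update_of_ne h.ne, hz r h]
      have h1 : q ^ r * q ∣ i + 1 := by
        rw [← pow_succ]
        exact (pow_dvd_pow q h).trans hdvd
      exact (Nat.mod_eq_zero_of_dvd (Nat.dvd_div_of_mul_dvd h1)).symm
    · rw [Function.update_self, Nat.succ_div_of_dvd hdvd, ← Nat.mod_add_mod,
        Nat.mod_eq_of_lt (lt_of_le_of_ne hlt (hlast hpk))]
    · rw [Function.update_of_ne h.ne', hnz r h.le hr, Nat.succ_div_of_not_dvd (hndvd r h)]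

/-- A bound for the running time of `tryTuple`. -/
def tryTime (n m k : ℕ) : ℕ := testTime n m k + k * 110 + 60

theorem tryTuple_spec {f : ℕ → Fin L.length} (hL : IsEdgeList G L) (hw : WordBound w t k L)
    (hs : HasInput t k L s) (ht : 0 < t) (hf : HasTuple L k f s) (hM : Marked L ∅ s) {q i : ℕ}
    (hq : q ≤ L.length) (hq0 : 0 < q) (h5 : s.reg 5 = q) (hd : HasDigits q k i s)
    (hi : i < q ^ k) (h6 : s.reg 6 = 0) :
    Run w tryTuple s (tryTime n L.length k) fun s' =>
      ((Set.InjOn f (Set.Iio k) ∧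
          IsRemovable t G (edgesOf L ((Finset.range k).image f) : Set (Sym2 (Fin n)))) ∧
        s'.reg 6 = 1 ∧ s'.reg 22 = 0 ∧ Marked L ((Finset.range k).image f) s') ∨
      (¬ (Set.InjOn f (Set.Iio k) ∧
          IsRemovable t G (edgesOf L ((Finset.range k).image f) : Set (Sym2 (Fin n)))) ∧
        s'.reg 6 = 0 ∧ Marked L ∅ s' ∧
        ((i + 1 < q ^ k ∧ s'.reg 22 = s.reg 22 ∧ HasDigits q k (i + 1) s') ∨
          (i + 1 = q ^ k ∧ s'.reg 22 = 0))) := by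
  have hw' := hw
  unfold WordBound at hw'
  refine Run.seq (T₁ := 8 + k * 60) (T₂ := testTime n L.length k + k * 50 + 52)
    (markTuple_spec hw hs hf hM).with_frame ?_ (by rw [tryTime]; omega)
  rintro s₁ ⟨⟨h23, hM₁, hE⟩, hfr₁⟩
  have hs₁ := hs.frame hfr₁ rfl
  refine Run.seq (T₁ := testTime n L.length k + 2) (T₂ := k * 50 + 50) (Q := fun s₂ =>
    (s₂.reg 23 ≠ 0 ↔ Set.InjOn f (Set.Iio k) ∧
      IsRemovable t G (edgesOf L ((Finset.range k).image f) : Set (Sym2 (Fin n)))) ∧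
    Frame (.cond (.reg 23) testMarked .skip) s₁ s₂) ?_ ?_ (by omega)
  · refine (Run.cond (T₁ := testTime n L.length k) (fun he => ?_) (fun he => ?_)
      (by simp only [Expr.cost]; omega)).with_frame
    · refine (testMarked_spec hL hw hs₁ ht hM₁ hE he).mono le_rfl fun s₂ h => ?_
      rw [h, and_iff_right (h23.mp he)]
    · have he' : s₁.reg 23 = 0 := he
      refine Run.skip ?_ (by rw [testTime]; omega)
      rw [← h23]
      simp [he']
  rintro s₂ ⟨hgood, hfr₂⟩
  have hs₂ := hs₁.frame hfr₂ rfl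
  have hM₂ : Marked L ((Finset.range k).image f) s₂ := by
    unfold Marked
    rw [hfr₂.arr rfl]
    exact hM₁
  have h6₂ : s₂.reg 6 = 0 := (hfr₂.reg rfl).trans ((hfr₁.reg rfl).trans h6)
  refine Run.cond (T₁ := k * 50 + 40) (fun he => ?_) (fun he => ?_)
    (by simp only [Expr.cost]; omega)
  · have h1 : 1 % 2 ^ w = 1 := Nat.mod_eq_of_lt (by omega)
    refine Run.of_loopFree rfl (.inl ⟨hgood.mp he, ?_, ?_, hM₂⟩)
      (le_trans (by decide : _ ≤ 10) (by omega))
    · simp [Program.effect, Expr.eval, h1]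
    · simp [Program.effect, Expr.eval]
  · have he' : ¬ s₂.reg 23 ≠ 0 := not_not.mpr he
    rw [hgood] at he'
    have hf₂ : HasTuple L k f s₂ := by
      unfold HasTuple
      rw [hfr₂.arr rfl, hfr₂.arr rfl, hfr₁.arr rfl, hfr₁.arr rfl]
      exact hf
    refine Run.seq (T₁ := 6 + k * 20) (T₂ := 30 + k * 30)
      (unmarkTuple_spec hw hs₂ hf₂ hM₂).with_frame ?_ (by omega)
    rintro s₃ ⟨hM₃, hfr₃⟩
    have hd₃ : HasDigits q k i s₃ := by
      unfold HasDigits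
      rw [hfr₃.arr rfl, hfr₂.arr rfl, hfr₁.arr rfl]
      exact hd
    have h5₃ : s₃.reg 5 = q := (hfr₃.reg rfl).trans ((hfr₂.reg rfl).trans ((hfr₁.reg rfl).trans h5))
    have h22₃ : s₃.reg 22 = s.reg 22 :=
      (hfr₃.reg rfl).trans ((hfr₂.reg rfl).trans (hfr₁.reg rfl))
    refine (nextTuple_spec hw (hs₂.frame hfr₃ rfl) hq hq0 h5₃ hd₃ hi).with_frame.mono le_rfl ?_
    rintro s₄ ⟨h, hfr₄⟩
    refine .inr ⟨he', (hfr₄.reg rfl).trans ((hfr₃.reg rfl).trans h6₂), ?_, by rwa [← h22₃]⟩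
    unfold Marked
    rw [hfr₄.arr rfl]
    exact hM₃

/-- Every set of `k` of `q` elements is listed by a number below `q ^ k`. -/
theorem exists_digits {q : ℕ} (cell : ℕ → Fin L.length) (hC : C.card = k)
    (hcell : ∀ c ∈ C, ∃ j < q, cell j = c) :
    ∃ i < q ^ k, Set.InjOn (fun p => cell (i / q ^ p % q)) (Set.Iio k) ∧
      (Finset.range k).image (fun p => cell (i / q ^ p % q)) = C := by
  choose! pos hpos hpos' using hcell
  let e := C.equivFinOfCardEq hC
  let d : Fin k → Fin q := fun p => ⟨pos (e.symm p), hpos _ (e.symm p).2⟩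
  have hdig : ∀ p : Fin k, cell ((finFunctionFinEquiv d : ℕ) / q ^ (p : ℕ) % q) = e.symm p := by
    intro p
    have h1 : finFunctionFinEquiv.symm (finFunctionFinEquiv d) p = d p := by simp
    have h2 := congrArg Fin.val h1
    simp only [finFunctionFinEquiv_symm_apply_val] at h2
    rw [h2]
    exact hpos' _ (e.symm p).2
  refine ⟨finFunctionFinEquiv d, (finFunctionFinEquiv d).2, ?_, ?_⟩
  · intro p hp p' hp' h
    simp only [hdig ⟨p, hp⟩, hdig ⟨p', hp'⟩] at h
    exact congrArg Fin.val (e.symm.injective (Subtype.ext h))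
  · ext c
    simp only [Finset.mem_image, Finset.mem_range]
    constructor
    · rintro ⟨p, hp, rfl⟩
      rw [hdig ⟨p, hp⟩]
      exact (e.symm _).2
    · exact fun hc => ⟨e ⟨c, hc⟩, (e ⟨c, hc⟩).2, by rw [hdig]; simp⟩

/-- A bound for the running time of `search` in a collection of `q` edges. -/
def searchTime (n m k q : ℕ) : ℕ := 20 + k * 20 + q ^ k * (tryTime n m k + 2)

theorem search_spec (hL : IsEdgeList G L) (hw : WordBound w t k L) (hs : HasInput t k L s)
    (ht : 0 < t) (hF : Collected L F s) (hne : F.Nonempty) (hM : Marked L ∅ s)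
    (h6 : s.reg 6 = 0) :
    Run w search s (searchTime n L.length k F.card) fun s' =>
      (s'.reg 6 = 1 ∧ ∃ C ⊆ F, C.card = k ∧
        IsRemovable t G (edgesOf L C : Set (Sym2 (Fin n))) ∧ Marked L C s') ∨
      (s'.reg 6 = 0 ∧ Marked L ∅ s' ∧
        ∀ C ⊆ F, C.card = k → ¬ IsRemovable t G (edgesOf L C : Set (Sym2 (Fin n)))) := by
  have hw' := hw
  unfold WordBound at hw'
  have hmod1 : 1 % 2 ^ w = 1 := Nat.mod_eq_of_lt (by omega)
  obtain ⟨i₀, hi₀⟩ := hne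
  obtain ⟨q, hq⟩ : ∃ q, F.card = q := ⟨_, rfl⟩
  have hq0 : 0 < q := hq ▸ Finset.card_pos.mpr ⟨i₀, hi₀⟩
  have hqL : q ≤ L.length := by simpa [hq] using Finset.card_le_univ F
  have hqk : 0 < q ^ k := Nat.pow_pos hq0
  rw [hq]
  have hcell : ∀ j, ∃ i : Fin L.length, i ∈ F ∧ (j < q → s.arr 6 j = i) := by
    intro j
    by_cases hj : j < q
    · obtain ⟨i, hi, h⟩ := hF.cell j (hq ▸ hj)
      exact ⟨i, hi, fun _ => h⟩
    · exact ⟨i₀, hi₀, fun h => absurd h hj⟩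
  choose cell hcellF hcell using hcell
  set f : ℕ → ℕ → Fin L.length := fun i p => cell (i / q ^ p % q) with hf
  set good : ℕ → Prop := fun i => Set.InjOn (f i) (Set.Iio k) ∧
    IsRemovable t G (edgesOf L ((Finset.range k).image (f i)) : Set (Sym2 (Fin n))) with hgood
  refine Run.seq (T₁ := 2 + (6 + k * 18)) (T₂ := q ^ k * (tryTime n L.length k + 2) + 2)
    (Q := fun s₁ => HasInput t k L s₁ ∧ s₁.reg 5 = q ∧ s₁.arr 6 = s.arr 6 ∧ s₁.reg 22 = 1 ∧
      s₁.reg 6 = 0 ∧ HasDigits q k 0 s₁ ∧ Marked L ∅ s₁) ?_ ?_ (by rw [searchTime]; omega)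
  · refine Run.seq (T₁ := 2) (T₂ := 6 + k * 18) (Q := fun s₁ => s₁ = s.setReg 22 1)
      (Run.of_loopFree rfl (by simp [Program.effect, Expr.eval, hmod1]) (by decide)) ?_ le_rfl
    rintro s₁ rfl
    have hs₁ : HasInput t k L (s.setReg 22 1) :=
      ⟨hs.1, hs.2, hs.3, hs.4, hs.5, hs.6, hs.7, hs.8⟩
    refine (Run.forLoop (N := k) (B := 10) (Inv := fun p s' => ∀ r < p, s'.arr 8 r = 0)
      hs₁.reg_three rfl rfl (by decide) (by omega) (fun r hr => absurd hr (by omega)) ?_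
      (by omega)).with_frame.mono le_rfl fun s₂ h => ⟨hs₁.frame h.2 rfl,
        (h.2.reg rfl).trans (by simpa using hF.card.trans hq), h.2.arr rfl,
        (h.2.reg rfl).trans (by simp), (h.2.reg rfl).trans (by simpa using h6),
        fun r hr => by simpa using h.1 r hr, ?_⟩
    · rintro p hp s' h h24 hfr
      refine Run.of_loopFree rfl (fun r hr => ?_) (by decide)
      rcases Nat.lt_succ_iff_lt_or_eq.mp hr with hr | rfl
      · simpa [Program.effect, Expr.eval, h24, hr.ne] using h r hr
      · simp [Program.effect, Expr.eval, h24]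
    · unfold Marked
      rw [h.2.arr rfl]
      exact hM
  rintro s₁ ⟨hs₁, h5₁, ha6, h22₁, h6₁, hd₁, hM₁⟩
  refine (Run.loop (s := s₁) (B := tryTime n L.length k) (Inv := fun j s' => HasInput t k L s' ∧
    s'.reg 5 = q ∧ s'.arr 6 = s.arr 6 ∧
      ((s'.reg 22 = 0 ∧ s'.reg 6 = 1 ∧ ∃ i, good i ∧ Marked L ((Finset.range k).image (f i)) s') ∨
        (s'.reg 22 = 0 ∧ s'.reg 6 = 0 ∧ Marked L ∅ s' ∧ ∀ i < q ^ k, ¬ good i) ∨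
        (s'.reg 22 = 1 ∧ s'.reg 6 = 0 ∧ Marked L ∅ s' ∧ ∃ i, i + j = q ^ k ∧ i < q ^ k ∧
          HasDigits q k i s' ∧ ∀ i' < i, ¬ good i'))) ?_ (q ^ k)
    ⟨hs₁, h5₁, ha6, .inr (.inr ⟨h22₁, h6₁, hM₁, 0, by simp, hqk, hd₁, by simp⟩)⟩
    (by simp only [Expr.cost, add_assoc, Nat.reduceAdd, le_refl])).mono le_rfl ?_
  · rintro j s₂ ⟨hs₂, h5₂, ha6₂, h⟩ he
    have he' : s₂.reg 22 ≠ 0 := he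
    obtain ⟨h22₂, h6₂, hM₂, i, hij, hi, hd₂, hbad⟩ := (h.resolve_left fun h => he' h.1).resolve_left
      fun h => he' h.1
    refine ⟨j - 1, by omega, ?_⟩
    have hf₂ : HasTuple L k (f i) s₂ := by
      intro p hp
      rw [hd₂ p hp, ha6₂]
      exact hcell _ (Nat.mod_lt _ hq0)
    refine (tryTuple_spec hL hw hs₂ ht hf₂ hM₂ hqL hq0 h5₂ hd₂ hi h6₂).with_frame.mono le_rfl ?_
    rintro s₃ ⟨h', hfr⟩
    refine ⟨hs₂.frame hfr rfl, (hfr.reg rfl).trans h5₂, (hfr.arr rfl).trans ha6₂, ?_⟩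
    rcases h' with ⟨h1, h2, h3, h4⟩ | ⟨h1, h2, h3, h4⟩
    · exact .inl ⟨h3, h2, i, h1, h4⟩
    have hbad' : ∀ i' < i + 1, ¬ good i' := by
      intro i' hi'
      rcases Nat.lt_succ_iff_lt_or_eq.mp hi' with hi' | rfl
      exacts [hbad i' hi', h1]
    rcases h4 with ⟨h4, h5, h6⟩ | ⟨h4, h5⟩
    · exact .inr (.inr ⟨h5.trans h22₂, h2, h3, i + 1, by omega, h4, h6, hbad'⟩)
    · exact .inr (.inl ⟨h5, h2, h3, h4 ▸ hbad'⟩)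
  · rintro s₂ ⟨⟨j, -, -, -, h⟩, he⟩
    have he' : s₂.reg 22 = 0 := he
    rcases h with ⟨-, h2, i, hi, h4⟩ | ⟨-, h2, h3, h4⟩ | ⟨h1, -⟩
    · refine .inl ⟨h2, _, ?_, ?_, hi.2, h4⟩
      · exact Finset.image_subset_iff.mpr fun p _ => hcellF _
      · rw [Finset.card_image_of_injOn, Finset.card_range]
        simpa using hi.1
    · refine .inr ⟨h2, h3, fun C hC hCk hrem => ?_⟩
      obtain ⟨i, hi, hinj, himg⟩ := exists_digits (q := q) cell hCk fun c hc => by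
        obtain ⟨j, hj, h⟩ := hF.cover c (hC hc)
        rw [hq] at hj
        exact ⟨j, hj, Fin.ext ((hcell j hj).symm.trans h)⟩
      exact h4 i hi ⟨hinj, by rw [show (Finset.range k).image (f i) = C from himg]; exact hrem⟩
    · rw [h1] at he'
      exact absurd he' one_ne_zero

end WordRAM

/-! ### The algorithm -/

namespace WordRAM

open SpannerProblem

/-- Collect edges on short circuits through the vertex in register 8. If new ones have been found,
then search for a solution among the collected edges. -/
def vertexStep : Program :=
  .seq (.seq (.assign 10 (.reg 8)) (.seq (.assign 11 (.const 0))
      (.seq (.assign 12 (.reg 2)) (.assign 9 (.reg 5)))))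
    (.seq bfs (.seq collect (.cond (.op .lt (.reg 9) (.reg 5)) search .skip)))

/-- The algorithm: treat all vertices until a solution has been found. -/
def spannerProgram : Program :=
  .cond (.reg 1)
    (.seq (.seq (.assign 4 (.op .add (.reg 0) (.reg 2)))
        (.assign 7 (.op .mul (.const 2) (.reg 3))))
      (.seq (.forLoop 8 0 (.cond (.reg 6) .skip vertexStep)) (.assign 0 (.reg 6))))
    (.assign 0 (.const 0))

variable {n t k w : ℕ} {L : List (Fin n × Fin n)} {s s' : State} {G : SimpleGraph (Fin n)}
  {F : Finset (Fin L.length)}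

/-- A solution is marked. -/
def Solved (L : List (Fin n × Fin n)) (G : SimpleGraph (Fin n)) (t k : ℕ) (s : State) : Prop :=
  s.reg 6 = 1 ∧ ∃ C, C.card = k ∧ IsRemovable t G (edgesOf L C : Set (Sym2 (Fin n))) ∧ Marked L C s

/-- No edge is marked, and there is no solution among the edges in `F`. -/
def Unsolved (L : List (Fin n × Fin n)) (G : SimpleGraph (Fin n)) (t k : ℕ)
    (F : Finset (Fin L.length)) (s : State) : Prop :=
  s.reg 6 = 0 ∧ Marked L ∅ s ∧
    ∀ C ⊆ F, C.card = k → ¬ IsRemovable t G (edgesOf L C : Set (Sym2 (Fin n)))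

/-- All edges at `v` that lie on a short circuit belong to `F`. -/
def CompleteAt (L : List (Fin n × Fin n)) (G : SimpleGraph (Fin n)) (t : ℕ)
    (F : Finset (Fin L.length)) (v : Fin n) : Prop :=
  ∀ (y : Fin n) (q : G.Walk y v), G.Adj y v → q.length ≤ t + 1 → s(y, v) ∉ q.edges →
    s(y, v) ∈ edgesOf L F

theorem exists_edgesOf_eq (hL : IsEdgeList G L) {E' : Set (Sym2 (Fin n))} (hE : E'.ncard = k)
    (hF : ∀ e ∈ E', e ∈ edgesOf L F) : ∃ C ⊆ F, C.card = k ∧ (edgesOf L C : Set _) = E' := by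
  classical
  have hfin : E'.Finite := (edgesOf L F).finite_toSet.subset hF
  have h1 : hfin.toFinset ⊆ F.image (edgeAt L) := fun e he => hF e (hfin.mem_toFinset.mp he)
  obtain ⟨C, hC, hCE⟩ := Finset.subset_image_iff.mp h1
  have h2 : edgesOf L C = hfin.toFinset := hCE
  refine ⟨C, by exact_mod_cast hC, ?_, by rw [h2]; simp⟩
  rw [← hL.card_edgesOf, h2, ← Set.ncard_eq_toFinset_card, hE]

/-- A collection without a solution is small. -/
theorem card_le_edgeBound (hL : IsEdgeList G L) (hcov : G.CoveredByShortCircuits t (edgesOf L F))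
    (hno : ∀ C ⊆ F, C.card = k → ¬ IsRemovable t G (edgesOf L C : Set (Sym2 (Fin n)))) :
    F.card ≤ SimpleGraph.edgeBound t k := by
  by_contra! hlt
  rw [← hL.card_edgesOf] at hlt
  obtain ⟨E', hrem, hcard, hsub⟩ := hcov.exists_isRemovable hlt
  obtain ⟨C, hC, hCk, rfl⟩ := exists_edgesOf_eq hL hcard hsub
  exact hno C hC hCk hrem

/-- A bound for the time that a vertex takes without the search for a solution. -/
def vertexTime (m t : ℕ) : ℕ := 30 + bfsTime m t + collectTime m t

/-- A bound for the number of collected edges. -/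
def maxCollected (t k : ℕ) : ℕ := SimpleGraph.edgeBound t k + k * (t + 2)

theorem searchTime_mono {m q q' : ℕ} (h : q ≤ q') : searchTime n m k q ≤ searchTime n m k q' := by
  unfold searchTime
  gcongr

theorem vertexStep_spec (hL : IsEdgeList G L) (hw : WordBound w t k L) (hs : HasInput t k L s)
    (ht : 0 < t) {v : Fin n} (h8 : s.reg 8 = v) (hF : Collected L F s)
    (hcov : G.CoveredByShortCircuits t (edgesOf L F)) (hun : Unsolved L G t k F s) :
    RunT w vertexStep s fun T s' => ∃ F', Collected L F' s' ∧ F ⊆ F' ∧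
      G.CoveredByShortCircuits t (edgesOf L F') ∧ F'.card ≤ maxCollected t k ∧
      T ≤ vertexTime L.length t +
        (F'.card - F.card) * searchTime n L.length k (maxCollected t k) ∧
      (Solved L G t k s' ∨ Unsolved L G t k F' s' ∧ CompleteAt L G t F' v) := by
  have hw' := hw
  unfold WordBound at hw'
  obtain ⟨h6, hM, hno⟩ := hun
  have hpre : Run w (.seq (.seq (.assign 10 (.reg 8)) (.seq (.assign 11 (.const 0))
      (.seq (.assign 12 (.reg 2)) (.assign 9 (.reg 5))))) (.seq bfs collect)) s
      (vertexTime L.length t - 10) fun s₁ => ∃ F', HasInput t k L s₁ ∧ Collected L F' s₁ ∧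
        F ⊆ F' ∧ F'.card ≤ F.card + k * (t + 2) ∧
        G.CoveredByShortCircuits t (edgesOf L F') ∧ s₁.reg 9 = F.card ∧ s₁.reg 6 = 0 ∧
        Marked L ∅ s₁ ∧
        ((∃ C ⊆ F', C.card = k ∧ IsRemovable t G (edgesOf L C : Set (Sym2 (Fin n)))) ∨
          CompleteAt L G t F' v) := by
    refine Run.seq (T₁ := 20) (Q := fun s₁ => HasInput t k L s₁ ∧ Collected L F s₁ ∧
      s₁.reg 10 = v ∧ s₁.reg 11 = 0 ∧ s₁.reg 12 = t ∧ s₁.reg 9 = F.card ∧ s₁.reg 6 = 0 ∧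
      Marked L ∅ s₁) (T₂ := bfsTime L.length t + collectTime L.length t) ?_ ?_
      (by rw [vertexTime]; omega)
    · refine (Run.of_loopFree (Q := fun s₁ => s₁.reg 10 = v ∧ s₁.reg 11 = 0 ∧ s₁.reg 12 = t ∧
        s₁.reg 9 = F.card) rfl ?_ (by decide)).with_frame.mono le_rfl fun s₁ h =>
          ⟨hs.frame h.2 rfl, hF.congr (h.2.reg rfl) (h.2.arr rfl) (h.2.arr rfl), h.1.1, h.1.2.1,
            h.1.2.2.1, h.1.2.2.2, (h.2.reg rfl).trans h6, ?_⟩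
      · simp [Program.effect, Expr.eval, h8, hs.reg_two, hF.card]
      · unfold Marked
        rw [h.2.arr rfl]
        exact hM
    rintro s₁ ⟨hs₁, hF₁, h10, h11, h12, h9, h6₁, hM₁⟩
    refine Run.seq (bfs_spec_whole hL hw hs₁ h10 h12 (by have := v.pos; omega) h11).with_frame ?_
      le_rfl
    rintro s₂ ⟨hS, hfr⟩
    have hF₂ : Collected L F s₂ := hF₁.congr (hfr.reg rfl) (hfr.arr rfl) (hfr.arr rfl)
    refine (collect_spec hL hw (hs₁.frame hfr rfl) hS ht hF₂ hcov).with_frame.mono le_rfl ?_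
    rintro s₃ ⟨⟨F', hF', hsub, hcard, hcov', h⟩, hfr'⟩
    refine ⟨F', (hs₁.frame hfr rfl).frame hfr' rfl, hF', hsub, hcard, hcov',
      (hfr'.reg rfl).trans ((hfr.reg rfl).trans h9), (hfr'.reg rfl).trans ((hfr.reg rfl).trans h6₁),
      ?_, h⟩
    unfold Marked
    rw [hfr'.arr rfl, hfr.arr rfl]
    exact hM₁
  -- The sequence of programs is regrouped.
  have hassoc : ∀ {p₁ p₂ p₃ p₄ : Program} {Q : ℕ → State → Prop},
      RunT w (.seq (.seq p₁ (.seq p₂ p₃)) p₄) s Q → RunT w (.seq p₁ (.seq p₂ (.seq p₃ p₄))) s Q := by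
    rintro p₁ p₂ p₃ p₄ Q ⟨T, s', h, hQ⟩
    cases h with | seq h h4 =>
    cases h with | seq h1 h =>
    cases h with | seq h2 h3 =>
    exact ⟨_, s', .seq h1 (.seq h2 (.seq h3 h4)), by simpa only [add_assoc] using hQ⟩
  refine hassoc (RunT.seq hpre ?_)
  rintro T₁ s₁ ⟨hT₁, F', hs₁, hF', hsub, hcard, hcov', h9, h6₁, hM₁, h⟩
  have hT₁' : T₁ + 10 ≤ vertexTime L.length t := by
    have : 10 ≤ vertexTime L.length t := by rw [vertexTime]; omega
    omega
  have hQ : F'.card ≤ maxCollected t k :=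
    hcard.trans (Nat.add_le_add_right (card_le_edgeBound hL hcov hno) _)
  have he : Expr.eval w s₁ (.op .lt (.reg 9) (.reg 5)) = if F.card < F'.card then 1 else 0 := by
    simp [Expr.eval, BinOp.eval, h9, hF'.card]
  by_cases hlt : F.card < F'.card
  · rw [if_pos hlt] at he
    have hne : F'.Nonempty := Finset.card_pos.mp (by omega)
    refine (Run.cond (T₁ := searchTime n L.length k F'.card) (fun _ =>
      (search_spec hL hw hs₁ ht hF' hne hM₁ h6₁).with_frame)
      (fun h => absurd (he.symm.trans h) one_ne_zero) le_rfl).mono le_rfl (fun _ h => h) |> fun hrun =>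
        RunT.mono hrun ?_
    rintro T₂ s₂ ⟨hT₂, hres, hfr⟩
    refine ⟨F', hF'.congr (hfr.reg rfl) (hfr.arr rfl) (hfr.arr rfl), hsub, hcov', hQ, ?_, ?_⟩
    · have h1 : searchTime n L.length k F'.card ≤
          (F'.card - F.card) * searchTime n L.length k (maxCollected t k) :=
        (searchTime_mono hQ).trans (Nat.le_mul_of_pos_left _ (by omega))
      simp only [Expr.cost] at hT₂
      omega
    · rcases hres with ⟨h1, C, -, hC⟩ | hres
      · exact .inl ⟨h1, C, hC⟩
      · refine .inr ⟨hres, ?_⟩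
        rcases h with ⟨C, hC, hCk, hrem⟩ | h
        exacts [absurd hrem (hres.2.2 C hC hCk), h]
  · rw [if_neg hlt] at he
    obtain rfl : F = F' := Finset.eq_of_subset_of_card_le hsub (by omega)
    refine (Run.cond (T₁ := 1) (Q := fun s' => s' = s₁) (fun h => absurd he h)
      (fun _ => Run.skip rfl le_rfl) le_rfl).mono le_rfl (fun _ h => h) |> fun hrun => RunT.mono hrun ?_
    rintro T₂ s₂ ⟨hT₂, rfl⟩
    refine ⟨F, hF', subset_rfl, hcov, hQ, ?_, .inr ⟨⟨h6₁, hM₁, hno⟩, ?_⟩⟩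
    · simp only [Expr.cost] at hT₂
      omega
    · rcases h with ⟨C, hC, hCk, hrem⟩ | h
      exacts [absurd hrem (hno C hC hCk), h]

theorem outputEdges_eq {C : Finset (Fin L.length)} (h : Marked L C s) :
    outputEdges L s = (edgesOf L C : Set (Sym2 (Fin n))) := by
  ext e
  rw [Finset.mem_coe, mem_edgesOf]
  constructor
  · rintro ⟨i, hi, h1, rfl⟩
    refine ⟨⟨i, hi⟩, ?_, rfl⟩
    by_contra hC
    exact h1 (by rw [h ⟨i, hi⟩, if_neg hC])
  · rintro ⟨i, hi, rfl⟩
    exact ⟨i, i.2, by rw [h i, if_pos hi]; exact one_ne_zero, rfl⟩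

/-- A bound for the running time of the algorithm. -/
def totalTime (n m t k : ℕ) : ℕ :=
  n * (vertexTime m t + 11) + maxCollected t k * searchTime n m k (maxCollected t k) + 20

theorem spannerProgram_spec (hL : IsEdgeList G L) (hw : WordBound w t k L) (ht : 0 < t)
    (hk : 0 < k) (hm : 0 < L.length) :
    Run w spannerProgram (initState t k L) (totalTime n L.length t k) (CorrectAnswer t k G L) := by
  have hw' := hw
  unfold WordBound at hw'
  have hmod2 : 2 % 2 ^ w = 2 := Nat.mod_eq_of_lt (by omega)
  set Q := maxCollected t k with hQ
  set A := vertexTime L.length t + 3 with hA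
  set B := searchTime n L.length k Q with hB
  have hTt : totalTime n L.length t k = n * A + 8 * n + Q * B + 20 := by
    rw [totalTime, hA]
    ring
  rw [hTt]
  refine Run.cond (T₁ := n * A + 8 * n + Q * B + 18) (fun _ => ?_)
    (fun h => absurd h (by simpa [Expr.eval, initState] using hm.ne')) (by simp only [Expr.cost]; omega)
  refine Run.seq (T₁ := 8) (Q := fun s₁ => s₁ = ((initState t k L).setReg 4 (n + t)).setReg 7 (2 * k))
    (T₂ := n * A + 8 * n + Q * B + 8) ?_ ?_ (by omega)
  · refine Run.of_loopFree rfl ?_ (by decide)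
    have h1 : (n + t) % 2 ^ w = n + t := Nat.mod_eq_of_lt (by omega)
    have h2 : (2 * k) % 2 ^ w = 2 * k := Nat.mod_eq_of_lt (by omega)
    have h3 : ((initState t k L).setReg 4 (n + t)).reg 3 = k := rfl
    simp only [Program.effect, Expr.eval, BinOp.eval]
    rw [show (initState t k L).reg 0 = n from rfl, show (initState t k L).reg 2 = t from rfl, h1, h3,
      hmod2, h2]
  rintro s₁ rfl
  set s₁ := ((initState t k L).setReg 4 (n + t)).setReg 7 (2 * k) with hs₁
  have hin : HasInput t k L s₁ := by
    refine ⟨rfl, rfl, rfl, rfl, rfl, rfl, fun i hi => ?_, fun i hi => ?_⟩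
    · have h1 : 2 * i / 2 = i := by omega
      simp [hs₁, initState, h1, List.getElem?_eq_getElem hi]
    · have h1 : (2 * i + 1) / 2 = i := by omega
      have h2 : (2 * i + 1) % 2 ≠ 0 := by omega
      simp [hs₁, initState, h1, List.getElem?_eq_getElem hi]
  -- The time is charged to the vertices and to the collected edges.
  have hloop := RunT.forLoop (w := w) (i := 8) (x := 0) (N := n) (s := s₁)
    (p := .cond (.reg 6) .skip vertexStep)
    (Inv := fun j τ s' => ∃ F, Collected L F s' ∧ G.CoveredByShortCircuits t (edgesOf L F) ∧
      F.card ≤ Q ∧ τ ≤ j * A + F.card * B ∧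
      (Solved L G t k s' ∨ Unsolved L G t k F s' ∧ ∀ v : Fin n, (v : ℕ) < j → CompleteAt L G t F v))
    hin.reg_zero rfl rfl (by decide) (by omega) ?_ ?_
  · refine Run.seq (p := .forLoop 8 0 (.cond (.reg 6) .skip vertexStep))
      (T₁ := n * A + 8 * n + Q * B + 6) (T₂ := 2) (Q := fun s' => ∃ F, (Solved L G t k s' ∨
        Unsolved L G t k F s' ∧ ∀ v : Fin n, CompleteAt L G t F v)) ?_ ?_ (by omega)
    · refine RunT.mono hloop ?_
      rintro T s' ⟨τ, rfl, F, -, -, hFQ, hτ, h⟩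
      refine ⟨?_, F, h.imp id fun h => ⟨h.1, fun v => h.2 v v.2⟩⟩
      have := Nat.mul_le_mul_right B hFQ
      omega
    · rintro s₂ ⟨F, h⟩
      refine Run.of_loopFree rfl ?_ (by decide)
      rcases h with ⟨h6, C, hC, hrem, hM⟩ | ⟨⟨h6, hM, hno⟩, hcomp⟩
      · have hout : outputEdges L ((Program.assign 0 (.reg 6)).effect w s₂) =
          (edgesOf L C : Set (Sym2 (Fin n))) := outputEdges_eq hM
        refine .inl ⟨by simpa [Program.effect, Expr.eval] using h6, by rwa [hout], ?_⟩
        rw [hout, Set.ncard_coe_finset, hL.card_edgesOf, hC]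
      · refine .inr ⟨by simpa [Program.effect, Expr.eval] using h6, ?_⟩
        rintro ⟨E', hrem, hkE⟩
        obtain ⟨E'', hE'', hcard⟩ := Set.exists_subset_card_eq hkE
        have hrem' := hrem.mono hE''
        -- Every removable edge has been collected at its ends.
        have hmem : ∀ e ∈ E'', e ∈ edgesOf L F := by
          intro e he
          induction e with
          | _ x y =>
            obtain ⟨q, hq, hxy⟩ := hrem'.exists_walk he
            exact hcomp y x q (hrem'.1 he) hq hxy
        obtain ⟨C, hC, hCk, rfl⟩ := exists_edgesOf_eq hL hcard hmem
        exact hno C hC hCk hrem'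
  · refine ⟨∅, ⟨rfl, by simp [hs₁, initState], by simp, by simp⟩, ?_, by simp, by simp,
      .inr ⟨⟨rfl, fun i => by simp [hs₁, initState], fun C hC hCk => ?_⟩, fun v hv => absurd hv (by omega)⟩⟩
    · intro e he
      simp [edgesOf] at he
    · rw [Finset.subset_empty.mp hC] at hCk
      simp at hCk
      omega
  · rintro j hj τ s₂ ⟨F, hF, hcov, hFQ, hτ, h⟩ h8 hfr
    rcases h with h | ⟨hun, hcomp⟩
    · have h6 : Expr.eval w s₂ (.reg 6) ≠ 0 := by
        rw [Expr.eval, h.1]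
        exact one_ne_zero
      refine ⟨_, s₂, .cond_pos h6 (.skip s₂), F, hF.congr (by simp) rfl rfl, hcov, hFQ, ?_,
        .inl ⟨by simpa using h.1, h.2⟩⟩
      simp only [Expr.cost, add_mul, one_mul]
      omega
    · have h6 : Expr.eval w s₂ (.reg 6) = 0 := hun.1
      obtain ⟨T, s₃, hex, F', hF', hsub, hcov', hFQ', hT, h⟩ := vertexStep_spec hL hw
        (hin.frame hfr rfl) ht (v := ⟨j, hj⟩) h8 hF hcov hun
      refine ⟨_, s₃, .cond_neg h6 hex, F', hF'.congr (by simp) rfl rfl, hcov', hFQ', ?_, ?_⟩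
      · have h1 : F.card ≤ F'.card := Finset.card_le_card hsub
        have h2 : F'.card * B = F.card * B + (F'.card - F.card) * B := by
          rw [← add_mul]
          congr 1
          omega
        have h3 : T ≤ vertexTime L.length t + (F'.card - F.card) * B := hT
        simp only [Expr.cost, add_mul, one_mul]
        omega
      · rcases h with h | ⟨h1, h2⟩
        · exact .inl ⟨by simpa using h.1, h.2⟩
        · refine .inr ⟨⟨by simpa using h1.1, h1.2⟩, fun v hv => ?_⟩
          rcases Nat.lt_succ_iff_lt_or_eq.mp hv with hv | rfl
          · exact fun y q h3 h4 h5 => edgesOf_subset hsub (hcomp v hv y q h3 h4 h5)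
          · exact h2

theorem spannerProgram_spec_of_length_eq_zero (hL : IsEdgeList G L) (hk : 0 < k)
    (hm : L.length = 0) : Run w spannerProgram (initState t k L) 10 (CorrectAnswer t k G L) := by
  refine Run.cond (T₁ := 2) (fun h => absurd (by simpa [Expr.eval, initState] using hm) h)
    (fun _ => Run.of_loopFree rfl (.inr ⟨by simp [Program.effect, Expr.eval], ?_⟩) (by decide))
    (by decide)
  rintro ⟨E', hrem, hkE⟩
  have hE : E' = ∅ := by
    refine Set.eq_empty_of_forall_notMem fun e he => ?_
    obtain ⟨i, -⟩ := hL.mem_edgeSet_iff.mp (hrem.1 he)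
    exact absurd i.2 (by omega)
  rw [hE, Set.ncard_empty] at hkE
  omega

/-! ### The running time -/

theorem bfsTime_le {m : ℕ} (hm : 0 < m) (R : ℕ) : bfsTime m R ≤ 120 * (m * (R + 1)) := by
  have h : scanEdge.time = 71 := rfl
  rw [bfsTime, h]
  nlinarith [Nat.mul_le_mul_right R (Nat.succ_le_of_lt hm)]

theorem vertexTime_le {m : ℕ} (hm : 0 < m) (t : ℕ) : vertexTime m t ≤ 310 * (m * (t + 1)) := by
  have h := bfsTime_le hm t
  rw [vertexTime, collectTime, selectTime]
  nlinarith [Nat.zero_le (m * t)]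

theorem tryTime_le {n m k : ℕ} (hn : 0 < n) (hm : 0 < m) (hk : 0 < k) :
    tryTime n m k ≤ 1500 * (k ^ 2 * (n * m)) := by
  have h := bfsTime_le hm n
  have h1 : m * (n + 1) ≤ 2 * (n * m) := by nlinarith
  have hX : 1 ≤ n * m := Nat.mul_pos hn hm
  rw [tryTime, testTime]
  generalize n * m = X at *
  have h2 : bfsTime m n ≤ 240 * X := by omega
  have h3 : 1 ≤ k ^ 2 := Nat.one_le_pow _ _ hk
  have h4 : k ≤ k ^ 2 := Nat.le_self_pow two_ne_zero k
  have h5 : 1 ≤ k ^ 2 * X := Nat.mul_pos h3 hX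
  have h6 : k ≤ k ^ 2 * X := h4.trans (Nat.le_mul_of_pos_right _ hX)
  have h7 : k * X ≤ k ^ 2 * X := Nat.mul_le_mul_right _ h4
  have h8 : k ^ 2 ≤ k ^ 2 * X := Nat.le_mul_of_pos_right _ hX
  have h9 : 2 * k * (2 * bfsTime m n + 2 * (2 * k * 30 + 6) + 30) ≤
      2 * k * (2 * (240 * X) + 2 * (2 * k * 30 + 6) + 30) := by gcongr
  have h10 : 2 * k * (2 * (240 * X) + 2 * (2 * k * 30 + 6) + 30) =
      960 * (k * X) + 240 * k ^ 2 + 84 * k := by ring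
  omega

theorem maxCollected_le (ht : 0 < t) (hk : 0 < k) : maxCollected t k ≤ (t + 1) ^ (6 * k + 11) := by
  obtain ⟨T, hT⟩ : ∃ T, T = t + 1 := ⟨_, rfl⟩
  have hT2 : 2 ≤ T := by omega
  have h1 : k ≤ T ^ k := (Nat.lt_pow_self (by omega)).le
  have h2 : t + 2 ≤ T ^ 2 := by subst hT; nlinarith
  have h3 : T ^ k * T ^ 2 ≤ T ^ (6 * k + 10) := by
    rw [← pow_add]
    exact Nat.pow_le_pow_right (by omega) (by omega)
  have h4 := SimpleGraph.edgeBound_le ht hk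
  rw [maxCollected, ← hT] at *
  calc SimpleGraph.edgeBound t k + k * (t + 2)
      ≤ T ^ (6 * k + 10) + T ^ (6 * k + 10) := add_le_add h4 ((Nat.mul_le_mul h1 h2).trans h3)
    _ ≤ T ^ (6 * k + 10) * T := by nlinarith [Nat.zero_le (T ^ (6 * k + 10))]
    _ = T ^ (6 * k + 11) := by rw [← pow_succ]

theorem totalTime_le {n m : ℕ} (hn : 0 < n) (hm : 0 < m) (ht : 0 < t) (hk : 0 < k) :
    totalTime n m t k ≤ (t + 1) ^ (60 * k ^ 2) * (n * m) := by
  obtain ⟨T, hT⟩ : ∃ T, T = t + 1 := ⟨_, rfl⟩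
  have hT2 : 2 ≤ T := by omega
  have hA := vertexTime_le hm t
  have hB := tryTime_le hn hm hk
  have hQ := maxCollected_le ht hk
  rw [totalTime, searchTime]
  rw [← hT] at hA hQ ⊢
  set Q := maxCollected t k
  obtain ⟨P, hP⟩ : ∃ P, P = T ^ (6 * k + 11) := ⟨_, rfl⟩
  have hP1 : 1 ≤ P := hP ▸ Nat.one_le_pow _ _ (by omega)
  rw [← hP] at hQ
  have hX : 1 ≤ n * m := Nat.mul_pos hn hm
  have hPk : 1 ≤ P ^ k := Nat.one_le_pow _ _ hP1
  have hk2 : 1 ≤ k ^ 2 := Nat.one_le_pow _ _ hk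
  have hkk : k ≤ k ^ 2 := Nat.le_self_pow two_ne_zero k
  -- All terms are compared with `Y = P ^ (k + 1) * k ^ 2 * n * m`.
  obtain ⟨Y, hY⟩ : ∃ Y, Y = P * P ^ k * (k ^ 2 * (n * m)) := ⟨_, rfl⟩
  have hXY : k ^ 2 * (n * m) ≤ Y := hY ▸ Nat.le_mul_of_pos_left _ (by positivity)
  have hTP : T ≤ P := hP ▸ Nat.le_self_pow (by omega) T
  have h1 : n * (vertexTime m t + 11) ≤ 321 * Y := by
    calc n * (vertexTime m t + 11) ≤ n * (310 * (m * T) + 11 * (m * T)) := by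
          gcongr
          nlinarith
      _ = 321 * (T * 1 * (1 * (n * m))) := by ring
      _ ≤ 321 * (P * P ^ k * (k ^ 2 * (n * m))) := by gcongr
      _ = 321 * Y := by rw [hY]
  have h2 : Q * (20 + k * 20 + Q ^ k * (tryTime n m k + 2)) ≤ 1542 * Y := by
    calc Q * (20 + k * 20 + Q ^ k * (tryTime n m k + 2))
        ≤ P * (P ^ k * (40 * (k ^ 2 * (n * m))) +
            P ^ k * (1500 * (k ^ 2 * (n * m)) + 2 * (k ^ 2 * (n * m)))) := by
          have h3 : 20 + k * 20 ≤ 40 * (k ^ 2 * (n * m)) := by nlinarith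
          have h4 : 2 ≤ 2 * (k ^ 2 * (n * m)) := by nlinarith
          gcongr
          exact h3.trans (Nat.le_mul_of_pos_left _ hPk)
      _ = 1542 * Y := by rw [hY]; ring
  have h3 : 20 ≤ 20 * Y := by nlinarith
  have h4 : k ≤ T ^ k := (Nat.lt_pow_self (by omega)).le
  have h5 : (1883 : ℕ) ≤ T ^ 11 :=
    le_trans (by norm_num : 1883 ≤ 2 ^ 11) (Nat.pow_le_pow_left hT2 11)
  calc n * (vertexTime m t + 11) + Q * (20 + k * 20 + Q ^ k * (tryTime n m k + 2)) + 20
      ≤ 1883 * Y := by omega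
    _ = (1883 * (P * P ^ k) * k ^ 2) * (n * m) := by rw [hY]; ring
    _ ≤ (T ^ 11 * (P * P ^ k) * (T ^ k) ^ 2) * (n * m) := by gcongr
    _ = T ^ (11 + (6 * k + 11) * (k + 1) + k * 2) * (n * m) := by
        rw [hP]
        ring
    _ ≤ T ^ (60 * k ^ 2) * (n * m) := by
        gcongr
        · omega
        · nlinarith

end WordRAM

namespace SpannerProblem

open WordRAM

theorem solvesInTime_spannerProgram {t : ℕ} (ht : 0 < t) :
    SolvesInTime spannerProgram 2 t fun k => (t + 1) ^ (60 * k ^ 2) := by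
  intro k hk n G L hL w hw
  have hwb : WordBound w t k L := by
    unfold WordBound
    refine le_trans ?_ hw
    rw [pow_two]
    exact Nat.mul_le_mul_right _ (by omega)
  have hcard : G.edgeSet.ncard = L.length := by
    have h1 : G.edgeSet = (edgesOf L Finset.univ : Set (Sym2 (Fin n))) := by
      ext e
      rw [Finset.mem_coe, mem_edgesOf, hL.mem_edgeSet_iff]
      simp
    rw [h1, Set.ncard_coe_finset, hL.card_edgesOf, Finset.card_univ, Fintype.card_fin]
  rw [hcard]
  rcases Nat.eq_zero_or_pos L.length with hm | hm
  · obtain ⟨T, s, h1, h2, h3⟩ :=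
      spannerProgram_spec_of_length_eq_zero (w := w) (t := t) hL hk hm
    refine ⟨T, s, h1, h2.trans ?_, h3⟩
    have h4 : 10 ≤ (t + 1) ^ (60 * k ^ 2) :=
      calc 10 ≤ 2 ^ (60 * 1 ^ 2) := by norm_num
        _ ≤ (t + 1) ^ (60 * k ^ 2) := by
          gcongr
          · norm_num
          · omega
          · omega
    simpa [hm] using h4
  · obtain ⟨T, s, h1, h2, h3⟩ := spannerProgram_spec hL hwb ht hk hm
    have hn : 0 < n := (L[0]).1.pos
    refine ⟨T, s, h1, h2.trans ((totalTime_le hn hm ht hk).trans ?_), h3⟩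
    gcongr
    exact le_max_right _ _

theorem SolvesInTime.mono {P : Program} {d t : ℕ} {f g : ℕ → ℕ} (h : SolvesInTime P d t f)
    (hfg : ∀ k, f k ≤ g k) : SolvesInTime P d t g := by
  intro k hk n G L hL w hw
  obtain ⟨T, s, h1, h2, h3⟩ := h k hk n G L hL w hw
  exact ⟨T, s, h1, h2.trans (Nat.mul_le_mul_right _ (hfg k)), h3⟩

end SpannerProblem

theorem theorem1 :
    -- one program, which gets `t`, `k` and the graph as its input
    (∃ (P : WordRAM.Program) (d : ℕ),
      -- running time `(t + 1) ^ O(k ^ 2 + t * k) * |V| * |E|`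
      (∃ c : ℕ, ∀ t : ℕ, 0 < t →
        SpannerProblem.SolvesInTime P d t (fun k => (t + 1) ^ (c * (k ^ 2 + t * k)))) ∧
      -- running time `2 ^ O(k ^ 2) * |V| * |E|` for fixed `t`
      (∀ t : ℕ, 0 < t → ∃ C : ℕ,
        SpannerProblem.SolvesInTime P d t (fun k => 2 ^ (C * k ^ 2)))) ∧
    -- many edges on short cycles force the existence of a solution
    (∃ f₄ : ℕ → ℕ → ℕ,
      (∃ c : ℕ, ∀ t k : ℕ, 0 < t → 0 < k → f₄ t k ≤ (t + 1) ^ (c * (k + t))) ∧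
      ∀ t k : ℕ, 0 < t → 0 < k → ∀ (n : ℕ) (G : SimpleGraph (Fin n)),
        f₄ t k < (G.shortCycleEdges (t + 2)).ncard →
          ∃ E' : Set (Sym2 (Fin n)), SpannerProblem.IsRemovable t G E' ∧ E'.ncard = k) := by
  refine ⟨⟨WordRAM.spannerProgram, 2, ⟨60, fun t ht => ?_⟩, fun t ht => ⟨60 * (t + 1), ?_⟩⟩,
    SimpleGraph.edgeBound, ⟨16, fun t k ht hk => ?_⟩, fun t k ht hk n G hcard => ?_⟩
  · refine (SpannerProblem.solvesInTime_spannerProgram ht).mono fun k => ?_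
    exact Nat.pow_le_pow_right (by omega) (Nat.mul_le_mul_left _ (Nat.le_add_right _ _))
  · refine (SpannerProblem.solvesInTime_spannerProgram ht).mono fun k => ?_
    calc (t + 1) ^ (60 * k ^ 2) ≤ (2 ^ (t + 1)) ^ (60 * k ^ 2) :=
          Nat.pow_le_pow_left (Nat.lt_two_pow_self).le _
      _ = 2 ^ (60 * (t + 1) * k ^ 2) := by
          rw [← pow_mul]
          congr 1
          ring
  · exact (SimpleGraph.edgeBound_le ht hk).trans (Nat.pow_le_pow_right (by omega) (by omega))
  · classical
    have hfin : (G.shortCycleEdges (t + 2)).Finite := Set.toFinite _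
    have hcov : G.CoveredByShortCircuits t (hfin.toFinset : Set (Sym2 (Fin n))) := by
      rw [hfin.coe_toFinset]
      exact SimpleGraph.coveredByShortCircuits_shortCycleEdges G t
    rw [Set.ncard_eq_toFinset_card _ hfin] at hcard
    obtain ⟨E', hrem, hE', -⟩ := hcov.exists_isRemovable hcard
    exact ⟨E', hrem, hE'⟩
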